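/- **Setting.** Let $\mathbb T=\mathbb R/2\pi\mathbb Z$, $e_k(x)=e^{ikx}$, and identify a distribution $u$ on $\mathbb T$ with its Fourier modes $(\hat u(k))_{k\in\mathbb Z}$ (at most polynomial growth), $u=\sum_k\hat u(k)e_k$. Let $T>0$, $\tfrac12\le\gamma<\tfrac34$, let $(\Omega,\mathbb P)$ be a probability space, and let $(W(k))_{k\in\mathbb Z}$ be standard Brownian motions (complex for $k\neq0$, real for $k=0$, with $\mathbb E|W_t(k)|^2=t$), independent up to the constraint $W(-k)=\overline{W(k)}$. Let $q_k\in\mathbb C$ with $q_0=0$ and $c|k|^{\gamma}\le|q_k|\le C|k|^{\gamma}$ for all $k\ne0$, for some constants $0<c\le C$. Let $z=z^{(\gamma)}$ be the Ornstein–Uhlenbeck process $z_t=\int_0^te^{-(t-s)A}Q\,dW_s$, $A=-\partial_{xx}$, $Qe_k=q_ke_k$, $t\in[0,T]$, i.e. (in the version with continuous modes) $$\hat z_t(k)=\int_0^te^{-|k|^2(t-s)}q_k\,dW_s(k),\qquad k\in\mathbb Z .$$ Let $\psi:\mathbb R\to\mathbb R$ be even, smooth and compactly supported with $\psi(0)=1$;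 for $\epsilon>0$ put $$z^{\epsilon}_t=\sum_{k\in\mathbb Z}\psi(\epsilon k)\,\hat z_t(k)\,e_k,\qquad (z^{\epsilon})^{\diamond2}_t=(z^{\epsilon}_t)^2-\mathbb E\big[(z^{\epsilon}_t)^2\big].$$ Let $(\chi,\varphi)$ be a dyadic partition of unity: $\chi,\varphi:\mathbb R\to[0,1]$ are smooth and even, $\chi$ is supported in a ball and $\varphi$ in an annulus centred at $0$, $\chi(\xi)+\sum_{j\ge0}\varphi(2^{-j}\xi)=1$ for all $\xi$, and $\operatorname{supp}\varphi(2^{-i}\cdot)\cap\operatorname{supp}\varphi(2^{-j}\cdot)=\emptyset$ for $|i-j|>1$. Put $\varphi_{-1}=\chi$, $\varphi_j=\varphi(2^{-j}\cdot)$, $\Delta_ju=\sum_k\varphi_j(k)\hat u(k)e_k$ and $\|u\|_{\mathcal C^\beta}=\sup_{j\ge-1}2^{j\beta}\|\Delta_ju\|_{L^\infty}$; $\mathcal C^\beta$ is the closure of $C^\infty(\mathbb T)$ in this norm, and $C_T\mathcal C^\beta$ is the space of continuous maps $[0,T]\to\mathcal C^\beta$ with norm $\|u\|_{C_T\mathcal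 C^\beta}=\sup_{t\in[0,T]}\|u_t\|_{\mathcal C^\beta}$. **Proposition.** There exists a process $z^{\diamond2}=(z^{(\gamma)})^{\diamond2}$ on $[0,T]$ with values in the distributions on $\mathbb T$ such that: 1. for every $\eta>0$ there is a constant $C_\eta$ such that for all $t\in[0,T]$ and all $k\in\mathbb Z\setminus\{0\}$ $$\mathbb E\Big[\big|\widehat{z^{\diamond2}_t}(k)\big|^2\Big]\le\frac{C_\eta}{|k|^{3-4\gamma-\eta}};$$ 2. for every $\beta<1-2\gamma$, almost surely $z^{\diamond2}\in C_T\mathcal C^\beta$, and for every $p\in(1,\infty)$, $\mathbb E\big[\|z^{\diamond2}\|_{C_T\mathcal C^\beta}^p\big]<\infty$ and $$\lim_{\epsilon\to0}\mathbb E\Big[\big\|(z^{\epsilon})^{\diamond2}-z^{\diamond2}\big\|^p_{C_T\mathcal C^\beta}\Big]=0 .$$ -/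

import Mathlib

open MeasureTheory ProbabilityTheory Filter Topology
open scoped NNReal ENNReal

noncomputable section

namespace BurgersOU

/-! ### Distributions on the torus `𝕋 = ℝ / 2πℤ` and Besov–Hölder spaces -/

/-- The one-dimensional torus `ℝ / 2πℤ`. -/
abbrev Torus : Type := AddCircle (2 * Real.pi)

instance two_pi_pos_fact : Fact (0 < 2 * Real.pi) := ⟨Real.two_pi_pos⟩

/-- A complex distribution on the torus, identified with the family `(û(k))_{k ∈ ℤ}` of its Fourier
modes: the families that arise are exactly those of at most polynomial growth. The Fourier basis is
`e_k(x) = exp(i k x)`, so that formally `u = ∑ k, û(k) e_k`. -/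
def TorusDistribution : Submodule ℂ (ℤ → ℂ) where
  carrier := {u | ∃ (C : ℝ) (N : ℕ), ∀ k : ℤ, ‖u k‖ ≤ C * (1 + |(k : ℝ)|) ^ N}
  zero_mem' := ⟨0, 0, fun k => by simp⟩
  add_mem' := by
    rintro u v ⟨C, N, hu⟩ ⟨D, M, hv⟩
    have hnn : ∀ (w : ℤ → ℂ) (E : ℝ) (L : ℕ), (∀ k : ℤ, ‖w k‖ ≤ E * (1 + |(k : ℝ)|) ^ L) →
        0 ≤ E := fun w E L h => by
      have := (norm_nonneg (w 0)).trans (h 0)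
      simpa using this
    have hC := hnn u C N hu
    have hD := hnn v D M hv
    refine ⟨C + D, N + M, fun k => ?_⟩
    have h1 : (1 : ℝ) ≤ 1 + |(k : ℝ)| := by linarith [abs_nonneg (k : ℝ)]
    calc ‖(u + v) k‖ ≤ ‖u k‖ + ‖v k‖ := norm_add_le _ _
      _ ≤ C * (1 + |(k : ℝ)|) ^ N + D * (1 + |(k : ℝ)|) ^ M := add_le_add (hu k) (hv k)
      _ ≤ C * (1 + |(k : ℝ)|) ^ (N + M) + D * (1 + |(k : ℝ)|) ^ (N + M) := by
          gcongr
          · omega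
          · omega
      _ = (C + D) * (1 + |(k : ℝ)|) ^ (N + M) := by ring
  smul_mem' := by
    rintro c u ⟨C, N, hu⟩
    refine ⟨‖c‖ * C, N, fun k => ?_⟩
    calc ‖(c • u) k‖ = ‖c‖ * ‖u k‖ := by simp
      _ ≤ ‖c‖ * (C * (1 + |(k : ℝ)|) ^ N) := by gcongr; exact hu k
      _ = ‖c‖ * C * (1 + |(k : ℝ)|) ^ N := by ring

/-- The `k`-th Fourier mode `û(k)` of a distribution. -/
def mode (u : TorusDistribution) (k : ℤ) : ℂ := (u : ℤ → ℂ) k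

/-- The distribution given by an (integrable) function `f` on the torus, with modes
`(2π)⁻¹ ∫ f(x) exp(-i k x) dx`. -/
def ofFun (f : Torus → ℂ) : TorusDistribution :=
  ⟨fourierCoeff f, ∫ x, ‖f x‖ ∂AddCircle.haarAddCircle, 0, fun k => by
    rw [pow_zero, mul_one, fourierCoeff]
    refine (norm_integral_le_integral_norm _).trans (le_of_eq ?_)
    congr 1
    ext x
    rw [norm_smul, fourier_apply, Circle.norm_coe, one_mul]⟩

/-- The distribution is given by a smooth function on the torus. -/
def IsSmoothDistribution (u : TorusDistribution) : Prop :=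
  ∃ f : Torus → ℂ, ContDiff ℝ (⊤ : ℕ∞) (fun x : ℝ => f (x : Torus)) ∧ u = ofFun f

/-- A dyadic partition of unity `(χ, φ)` on `ℝ`. -/
structure IsDyadicPartition (χ φ : ℝ → ℝ) : Prop where
  smooth_low : ContDiff ℝ (⊤ : ℕ∞) χ
  smooth_high : ContDiff ℝ (⊤ : ℕ∞) φ
  even_low : ∀ ξ, χ (-ξ) = χ ξ
  even_high : ∀ ξ, φ (-ξ) = φ ξ
  range_low : ∀ ξ, 0 ≤ χ ξ ∧ χ ξ ≤ 1
  range_high : ∀ ξ, 0 ≤ φ ξ ∧ φ ξ ≤ 1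
  sum_eq_one : ∀ ξ, HasSum (fun j : ℕ => φ (ξ / 2 ^ j)) (1 - χ ξ)
  supp_low : ∃ R : ℝ, 0 < R ∧ tsupport χ ⊆ {ξ | |ξ| ≤ R}
  supp_high : ∃ r R : ℝ, 0 < r ∧ r < R ∧ tsupport φ ⊆ {ξ | r ≤ |ξ| ∧ |ξ| ≤ R}
  disjoint_high : ∀ i j : ℕ, i + 1 < j →
    Disjoint (tsupport fun ξ : ℝ => φ (ξ / 2 ^ i)) (tsupport fun ξ : ℝ => φ (ξ / 2 ^ j))

/-- The symbols of the Littlewood–Paley blocks: index `0` is the low-frequency block `j = -1` with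
symbol `χ`, and index `n + 1` is the block `j = n ≥ 0` with symbol `φ(2^{-n} ·)`. -/
def lpSymbol (χ φ : ℝ → ℝ) : ℕ → ℝ → ℝ
  | 0 => χ
  | n + 1 => fun ξ => φ (ξ / 2 ^ n)

/-- The Littlewood–Paley block `Δ_{n-1} u`, a trigonometric polynomial (the sum is finite since the
symbol has compact support). -/
def lpBlock (χ φ : ℝ → ℝ) (n : ℕ) (u : TorusDistribution) : C(Torus, ℂ) :=
  ∑ᶠ k : ℤ, ((lpSymbol χ φ n (k : ℝ) : ℂ) * mode u k) • fourier k

/-- The norm of `B^β_{∞,∞}(𝕋)`, namely `sup_{j ≥ -1} 2^{jβ} ‖Δ_j u‖_{L^∞}`, with values in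
`[0, ∞]`. -/
def besovNorm (χ φ : ℝ → ℝ) (β : ℝ) (u : TorusDistribution) : ℝ≥0∞ :=
  ⨆ n : ℕ, ENNReal.ofReal ((2 : ℝ) ^ (((n : ℝ) - 1) * β)) * ‖lpBlock χ φ n u‖ₑ

/-- `u ∈ 𝓒^β`, the closure of the smooth functions in the norm of `B^β_{∞,∞}`. -/
def MemHolder (χ φ : ℝ → ℝ) (β : ℝ) (u : TorusDistribution) : Prop :=
  besovNorm χ φ β u < ∞ ∧
    ∀ δ : ℝ≥0∞, 0 < δ → ∃ v : TorusDistribution, IsSmoothDistribution v ∧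
      besovNorm χ φ β (u - v) < δ

/-- `u ∈ C_T 𝓒^β`, the continuous maps from `[0, T]` to `𝓒^β`. -/
def MemCTHolder (χ φ : ℝ → ℝ) (T : ℝ≥0) (β : ℝ) (u : ℝ≥0 → TorusDistribution) : Prop :=
  (∀ t ≤ T, MemHolder χ φ β (u t)) ∧
    ∀ t ≤ T, Tendsto (fun s => besovNorm χ φ β (u s - u t)) (𝓝[Set.Iic T] t) (𝓝 0)

/-- The norm of `C_T 𝓒^β`, namely `sup_{t ∈ [0,T]} ‖u_t‖_{𝓒^β}`. -/
def ctNorm (χ φ : ℝ → ℝ) (T : ℝ≥0) (β : ℝ) (u : ℝ≥0 → TorusDistribution) : ℝ≥0∞ :=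
  ⨆ t : Set.Iic T, besovNorm χ φ β (u t)

/-! ### The cylindrical Brownian motion and the Ornstein–Uhlenbeck process -/

variable {Ω : Type*} [MeasurableSpace Ω]

/-- The real coordinates of a family of complex processes `W(k)`: the `j`-th one is `√2 Re W(j)` for
`j > 0`, `√2 Im W(-j)` for `j < 0` and `Re W(0)` for `j = 0`. -/
def realCoord (W : ℤ → ℝ≥0 → Ω → ℂ) (j : ℤ) (t : ℝ≥0) (ω : Ω) : ℝ :=
  if 0 < j then Real.sqrt 2 * (W j t ω).re else if j < 0 then Real.sqrt 2 * (W (-j) t ω).im else (W 0 t ω).re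

/-- The Fourier modes `W(k)` of a (real) cylindrical Brownian motion: standard complex Brownian
motions, normalised by `E|W_t(k)|² = t`, that are independent up to the constraint
`W(-k) = conj W(k)`. -/
structure IsCylindricalBM (P : Measure Ω) (W : ℤ → ℝ≥0 → Ω → ℂ) : Prop where
  conj_symm : ∀ k t ω, W (-k) t ω = starRingEnd ℂ (W k t ω)
  brownian : ∀ j, IsBrownianReal (realCoord W j) P
  indep : iIndepFun (fun (j : ℤ) (ω : Ω) (t : ℝ≥0) => realCoord W j t ω) P

/-- A (deterministic) step function `∑ i, c_i 1_{(a_i, b_i]}` on the half-line. -/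
structure StepFn where
  size : ℕ
  coef : Fin size → ℂ
  left : Fin size → ℝ≥0
  right : Fin size → ℝ≥0
  left_le_right : ∀ i, left i ≤ right i

/-- The function `∑ i, c_i 1_{(a_i, b_i]}`. -/
def StepFn.toFun (S : StepFn) (s : ℝ) : ℂ :=
  ∑ i, (Set.Ioc (S.left i : ℝ) (S.right i : ℝ)).indicator (fun _ => S.coef i) s

/-- The stochastic integral `∑ i, c_i (B_{b_i} - B_{a_i})` of a step function. -/
def StepFn.integral (S : StepFn) (B : ℝ≥0 → Ω → ℂ) (ω : Ω) : ℂ :=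
  ∑ i, S.coef i * (B (S.right i) ω - B (S.left i) ω)

/-- `X = ∫_0^t f(s) dB_s` as an Itô (Wiener) integral of a deterministic `f`: `X` is the limit in
`L²(Ω)` of the integrals of step functions that converge to `f` in `L²([0, t])`. -/
def IsItoIntegral (P : Measure Ω) (B : ℝ≥0 → Ω → ℂ) (t : ℝ≥0) (f : ℝ → ℂ) (X : Ω → ℂ) : Prop :=
  MemLp X 2 P ∧ ∃ S : ℕ → StepFn, (∀ n i, (S n).right i ≤ t) ∧
    Tendsto (fun n => eLpNorm (fun s => (S n).toFun s - f s) 2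
      (volume.restrict (Set.Ioc 0 (t : ℝ)))) atTop (𝓝 0) ∧
    Tendsto (fun n => eLpNorm (fun ω => (S n).integral B ω - X ω) 2 P) atTop (𝓝 0)

/-- `Q ≈ A^{γ/2}` for a Fourier multiplier `Q` with eigenvalues `q_k` (on `e_k`):
`q_0 = 0` and `|q_k| ≂ |k|^γ` for `k ≠ 0`. -/
def IsComparableSymbol (γ : ℝ) (q : ℤ → ℂ) : Prop :=
  q 0 = 0 ∧ ∃ c C : ℝ, 0 < c ∧ 0 < C ∧
    ∀ k : ℤ, k ≠ 0 → c * |(k : ℝ)| ^ γ ≤ ‖q k‖ ∧ ‖q k‖ ≤ C * |(k : ℝ)| ^ γ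

/-- `z = ∫_0^t e^{-(t-s)A} Q dW_s` on `[0, T]` with `A = -∂_{xx}`, given by its Fourier modes
`ẑ_t(k) = ∫_0^t e^{-|k|²(t-s)} q_k dW_s(k)`, in the version with continuous modes. -/
structure IsOrnsteinUhlenbeck (P : Measure Ω) (T : ℝ≥0) (q : ℤ → ℂ) (W : ℤ → ℝ≥0 → Ω → ℂ)
    (z : ℤ → ℝ≥0 → Ω → ℂ) : Prop where
  measurable : ∀ k, ∀ t ≤ T, Measurable (z k t)
  eq_integral : ∀ k, ∀ t ≤ T, IsItoIntegral P (W k) t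
    (fun s => (Real.exp (-((k : ℝ) ^ 2) * ((t : ℝ) - s)) : ℂ) * q k) (z k t)
  continuous : ∀ᵐ ω ∂P, ∀ k, ContinuousOn (fun t => z k t ω) (Set.Iic T)

/-! ### Regularisation and the Wick-renormalised square -/

/-- A cutoff: an even smooth function with compact support and value `1` at the origin. -/
structure IsCutoff (ψ : ℝ → ℝ) : Prop where
  smooth : ContDiff ℝ (⊤ : ℕ∞) ψ
  even : ∀ ξ, ψ (-ξ) = ψ ξ
  compact : HasCompactSupport ψ
  at_zero : ψ 0 = 1

/-- The regularised process `z^ε_t = ∑ k, ψ(ε k) ẑ_t(k) e_k` (a finite sum for `ε > 0`). -/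
def regularise (ψ : ℝ → ℝ) (z : ℤ → ℝ≥0 → Ω → ℂ) (ε : ℝ) (t : ℝ≥0) (ω : Ω) : C(Torus, ℂ) :=
  ∑ᶠ k : ℤ, ((ψ (ε * (k : ℝ)) : ℂ) * z k t ω) • fourier k

/-- The renormalised square `(z^ε_t)² - E[(z^ε_t)²]`. -/
def wickSquare (P : Measure Ω) (ψ : ℝ → ℝ) (z : ℤ → ℝ≥0 → Ω → ℂ) (ε : ℝ) (t : ℝ≥0) (ω : Ω) :
    TorusDistribution :=
  ofFun fun x => (regularise ψ z ε t ω x) ^ 2 - ∫ ω', (regularise ψ z ε t ω' x) ^ 2 ∂P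

end BurgersOU

end

open BurgersOU

noncomputable section

namespace BurgersOU

/-! ### Moments of centred Gaussian vectors -/

/-! The modes of `z` are jointly Gaussian, and modes at distinct frequencies are orthogonal for `E[X
conj Y]`. The Itô isometry bounds the variance of `z k t - z k s` by a multiple of `|t-s|^κ
|k|^{-(2-2γ-2κ)}`, for every `κ` in `[0,1]`. Since `ψ` has compact support, each renormalised square
is a finite sum of Wick products `:z(l) z(m):` with coefficients `d l m`. Everything rests on moment
bounds for such sums that do not depend on the number of terms.

A Littlewood–Paley block at a point, or a single mode, is a centred quadratic form of a Gaussian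
vector. Its moment of order `2r` is controlled by the `r`-th power of `∑ |c_{lm}|² E|A_l|² E|B_m|²`
(`lintegral_quadratic_pow_le`). Decoupling takes the place of hypercontractivity here: an
independent copy replaces the expectation, a rotation by `π/4` turns `Q(x) - Q(y)` into a bilinear
form of two independent copies, and this form is Gaussian in each variable separately. The discrete
convolution estimate `exists_sum_freqWeight_le` then gives decay `|k|^{-(3-4γ-9κ)}` for the second
moment of mode `k`, and a factor `2^{n(1-(3-4γ-9κ))}` for the variance of block `n`.

The supremum over space is taken over a grid of order `2^{2n}` points, the supremum over time by
dyadic chaining, and the supremum over blocks is replaced by a sum. All these counts are beaten by a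
large `r`, which gives `exists_ctNorm_moment_le` for every `β < 1 - 2γ`.

For convergence, `ψ(εl)ψ(εm) - ψ(δl)ψ(δm)` is `O(ρ^κ |l|^κ |m|^κ)` when `ε, δ ≤ ρ`, and the small
frequency loss is absorbed by the weights. Along `ε = 2^{-n}` the differences are therefore almost
surely summable in `C_T 𝓒^{-1}`, so all modes converge at all times simultaneously. This defines one
limit, independent of `η`, `β` and `p`. Fatou's lemma and lower semicontinuity of the Besov norm
transfer the mode bounds and the rate `ε^κ` to it. The limit paths are uniform limits of continuous
paths of trigonometric polynomials, hence lie in `C_T 𝓒^β`. -/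

lemma add_pow_le_two_pow_mul (a b : ℝ≥0∞) (r : ℕ) :
    (a + b) ^ r ≤ 2 ^ r * (a ^ r + b ^ r) := by
  have h : a + b ≤ 2 * max a b := by
    rw [two_mul]; exact add_le_add (le_max_left _ _) (le_max_right _ _)
  calc (a + b) ^ r ≤ (2 * max a b) ^ r := by gcongr
    _ = 2 ^ r * max a b ^ r := mul_pow _ _ _
    _ ≤ _ := by
      gcongr
      rcases max_choice a b with h | h <;> rw [h]
      · exact le_self_add
      · exact le_add_self

/-- The absolute moment of order `2r` of the standard Gaussian law. -/
def gaussMoment (r : ℕ) : ℝ≥0∞ := ∫⁻ x, ‖x‖ₑ ^ (2 * r) ∂(gaussianReal 0 1)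

lemma gaussMoment_lt_top (r : ℕ) : gaussMoment r < ∞ := by
  have h : MemLp id ((2 * r : ℕ) : ℝ≥0∞) (gaussianReal 0 1) :=
    IsGaussian.memLp_id _ _ (ENNReal.natCast_ne_top _)
  have := h.eLpNorm_lt_top
  rcases Nat.eq_zero_or_pos r with rfl | hr
  · simp [gaussMoment]
  · rw [eLpNorm_lt_top_iff_lintegral_rpow_enorm_lt_top (by simp; lia)
      (ENNReal.natCast_ne_top _)] at this
    simpa [gaussMoment, ← ENNReal.rpow_natCast] using this

lemma lintegral_pow_gaussianReal (v : ℝ≥0) (r : ℕ) :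
    ∫⁻ x, ‖x‖ₑ ^ (2 * r) ∂(gaussianReal 0 v) = (v : ℝ≥0∞) ^ r * gaussMoment r := by
  have h := gaussianReal_map_const_mul (μ := 0) (v := 1) (Real.sqrt v)
  have hv : (NNReal.mk (Real.sqrt v ^ 2) (sq_nonneg _) * 1 : ℝ≥0) = v := by
    ext; simp
  rw [hv, mul_zero] at h
  rw [← h, lintegral_map (by fun_prop) (by fun_prop), gaussMoment,
    ← lintegral_const_mul _ (by fun_prop)]
  refine lintegral_congr fun x => ?_
  rw [enorm_mul, mul_pow, pow_mul]
  congr 2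
  rw [← enorm_pow, Real.sq_sqrt v.coe_nonneg]
  simp

lemma gaussMoment_one : gaussMoment 1 = 1 := by
  have h := variance_id_gaussianReal (μ := 0) (v := 1)
  rw [variance_eq_integral (by fun_prop)] at h
  simp only [id, integral_id_gaussianReal, sub_zero] at h
  have h2 : Integrable (fun x : ℝ => x ^ 2) (gaussianReal 0 1) :=
    (IsGaussian.memLp_id (gaussianReal 0 1) 2 (by simp)).integrable_sq
  have h3 := ofReal_integral_eq_lintegral_ofReal h2 (ae_of_all _ fun x => sq_nonneg x)
  rw [h] at h3
  simp only [NNReal.coe_one, ENNReal.ofReal_one] at h3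
  rw [h3, gaussMoment]
  refine lintegral_congr fun x => ?_
  rw [mul_one, ← enorm_pow, Real.enorm_eq_ofReal (sq_nonneg x)]

section Vector

variable {E : Type*} [NormedAddCommGroup E] [NormedSpace ℝ E] [MeasurableSpace E] [BorelSpace E]
  [CompleteSpace E] [SecondCountableTopology E] (μ : Measure E) [IsGaussian μ]

/-- A one-dimensional marginal is a centred real Gaussian, whose moments are fixed by its variance;
the case `r = 1` identifies that variance. -/
lemma lintegral_pow_dual (hμ : μ[id] = 0) (l : StrongDual ℝ E) (r : ℕ) :
    ∫⁻ x, ‖l x‖ₑ ^ (2 * r) ∂μ = (∫⁻ x, ‖l x‖ₑ ^ 2 ∂μ) ^ r * gaussMoment r := by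
  have h0 : μ[l] = 0 := by
    simp only [id_eq] at hμ
    simp [IsGaussian.integral_dual, hμ]
  have h := IsGaussian.map_eq_gaussianReal (μ := μ) l
  rw [h0] at h
  have key : ∀ r : ℕ, ∫⁻ x, ‖l x‖ₑ ^ (2 * r) ∂μ =
      ((Var[l; μ]).toNNReal : ℝ≥0∞) ^ r * gaussMoment r := fun r => by
    rw [← lintegral_pow_gaussianReal, ← h, lintegral_map (by fun_prop) (by fun_prop)]
  rw [key r]
  have := key 1
  simp only [mul_one, pow_one, gaussMoment_one] at this
  rw [this]

/-- The constant in the comparison of the moments of a complex Gaussian variable. -/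
def complexMoment (r : ℕ) : ℝ≥0∞ := 2 ^ r * (2 * gaussMoment r)

lemma complexMoment_lt_top (r : ℕ) : complexMoment r < ∞ := by
  have := gaussMoment_lt_top r
  unfold complexMoment
  exact ENNReal.mul_lt_top (by simp) (ENNReal.mul_lt_top (by simp) this)

lemma enorm_sq_eq_re_add_im (z : ℂ) : ‖z‖ₑ ^ 2 = ‖z.re‖ₑ ^ 2 + ‖z.im‖ₑ ^ 2 := by
  rw [← enorm_pow, ← enorm_pow, ← enorm_pow, ← ofReal_norm, norm_pow,
    Real.enorm_eq_ofReal (sq_nonneg _), Real.enorm_eq_ofReal (sq_nonneg _),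
    ← ENNReal.ofReal_add (sq_nonneg _) (sq_nonneg _), ← Complex.normSq_eq_norm_sq,
    Complex.normSq_apply]
  ring_nf

/-- No circular symmetry is assumed: the real and imaginary parts are treated as two possibly
correlated real Gaussians, each of variance at most that of `N`. This is why only an inequality
results. -/
lemma lintegral_pow_le_complexMoment (hμ : μ[id] = 0) (N : E →L[ℝ] ℂ) (r : ℕ) :
    ∫⁻ x, ‖N x‖ₑ ^ (2 * r) ∂μ ≤ complexMoment r * (∫⁻ x, ‖N x‖ₑ ^ 2 ∂μ) ^ r := by
  have hre := lintegral_pow_dual μ hμ (Complex.reCLM.comp N) r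
  have him := lintegral_pow_dual μ hμ (Complex.imCLM.comp N) r
  simp only [ContinuousLinearMap.comp_apply, Complex.reCLM_apply, Complex.imCLM_apply] at hre him
  calc ∫⁻ x, ‖N x‖ₑ ^ (2 * r) ∂μ
      ≤ ∫⁻ x, 2 ^ r * (‖(N x).re‖ₑ ^ (2 * r) + ‖(N x).im‖ₑ ^ (2 * r)) ∂μ := by
        refine lintegral_mono fun x => ?_
        dsimp only
        rw [pow_mul, enorm_sq_eq_re_add_im, pow_mul, pow_mul]
        exact add_pow_le_two_pow_mul _ _ _
    _ = 2 ^ r * ((∫⁻ x, ‖(N x).re‖ₑ ^ 2 ∂μ) ^ r * gaussMoment r +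
        (∫⁻ x, ‖(N x).im‖ₑ ^ 2 ∂μ) ^ r * gaussMoment r) := by
        rw [lintegral_const_mul _ (by fun_prop), lintegral_add_left (by fun_prop), hre, him]
    _ ≤ 2 ^ r * ((∫⁻ x, ‖N x‖ₑ ^ 2 ∂μ) ^ r * gaussMoment r +
        (∫⁻ x, ‖N x‖ₑ ^ 2 ∂μ) ^ r * gaussMoment r) := by
        have h1 : ∫⁻ x, ‖(N x).re‖ₑ ^ 2 ∂μ ≤ ∫⁻ x, ‖N x‖ₑ ^ 2 ∂μ := lintegral_mono fun x =>
          (enorm_sq_eq_re_add_im (N x)).ge.trans' le_self_add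
        have h2 : ∫⁻ x, ‖(N x).im‖ₑ ^ 2 ∂μ ≤ ∫⁻ x, ‖N x‖ₑ ^ 2 ∂μ := lintegral_mono fun x =>
          (enorm_sq_eq_re_add_im (N x)).ge.trans' le_add_self
        gcongr
    _ = _ := by rw [complexMoment]; ring

end Vector

/-- Minkowski's inequality in `L^r`. It handles a random conditional variance, a sum of squares
whose terms may be dependent. -/
lemma lintegral_sum_pow_le {α ι : Type*} [MeasurableSpace α] (μ : Measure α) (s : Finset ι)
    (f : ι → α → ℝ≥0∞) (hf : ∀ i, Measurable (f i)) (w S : ι → ℝ≥0∞) (K : ℝ≥0∞) {r : ℕ}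
    (hr : 1 ≤ r) (h : ∀ i, ∫⁻ x, f i x ^ r ∂μ ≤ K * S i ^ r) :
    ∫⁻ x, (∑ i ∈ s, w i * f i x) ^ r ∂μ ≤ K * (∑ i ∈ s, w i * S i) ^ r := by
  have hr0 : (r : ℝ) ≠ 0 := by positivity
  have key : (∫⁻ x, (∑ i ∈ s, w i * f i x) ^ (r : ℝ) ∂μ) ^ (1 / (r : ℝ)) ≤
      K ^ (1 / (r : ℝ)) * ∑ i ∈ s, w i * S i := by
    classical
    induction s using Finset.induction_on with
    | empty =>
      simp [Nat.pos_of_ne_zero (by lia : r ≠ 0)]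
      lia
    | insert a s ha ih =>
      simp only [Finset.sum_insert ha]
      refine (ENNReal.lintegral_Lp_add_le (f := fun x => w a * f a x)
        (g := fun x => ∑ i ∈ s, w i * f i x) (by fun_prop) (by fun_prop)
        (by exact_mod_cast hr)).trans ?_
      rw [mul_add]
      refine add_le_add ?_ ih
      have : ∫⁻ x, (w a * f a x) ^ (r : ℝ) ∂μ ≤ K * (w a * S a) ^ (r : ℝ) := by
        simp only [ENNReal.rpow_natCast, mul_pow]
        rw [lintegral_const_mul _ (by fun_prop)]
        calc w a ^ r * ∫⁻ x, f a x ^ r ∂μ ≤ w a ^ r * (K * S a ^ r) := by gcongr; exact h a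
          _ = _ := by ring
      calc _ ≤ (K * (w a * S a) ^ (r : ℝ)) ^ (1 / (r : ℝ)) := by gcongr
        _ = _ := by
          rw [ENNReal.mul_rpow_of_nonneg _ _ (by positivity), ← ENNReal.rpow_mul,
            mul_one_div_cancel hr0, ENNReal.rpow_one]
  have := ENNReal.rpow_le_rpow key (z := (r : ℝ)) (by positivity)
  rw [← ENNReal.rpow_mul, one_div_mul_cancel hr0, ENNReal.rpow_one,
    ENNReal.mul_rpow_of_nonneg _ _ (by positivity), ← ENNReal.rpow_mul, one_div_mul_cancel hr0,
    ENNReal.rpow_one] at this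
  simpa only [ENNReal.rpow_natCast] using this

lemma lintegral_enorm_sq_eq_ofReal {α : Type*} [MeasurableSpace α] {μ : Measure α} {f : α → ℂ}
    (hf : MemLp f 2 μ) : ∫⁻ x, ‖f x‖ₑ ^ 2 ∂μ = ENNReal.ofReal (∫ x, ‖f x‖ ^ 2 ∂μ) := by
  rw [ofReal_integral_eq_lintegral_ofReal hf.norm.integrable_sq (ae_of_all _ fun x => sq_nonneg _)]
  refine lintegral_congr fun x => ?_
  rw [ENNReal.ofReal_pow (norm_nonneg _), ofReal_norm]

/-- Pythagoras' identity for an orthogonal family. -/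
lemma lintegral_sum_orthogonal {α ι : Type*} [MeasurableSpace α] {μ : Measure α} (s : Finset ι)
    (f : ι → α → ℂ) (hf : ∀ i, MemLp (f i) 2 μ)
    (ho : ∀ i j, i ≠ j → ∫ x, f i x * starRingEnd ℂ (f j x) ∂μ = 0) (c : ι → ℂ) :
    ∫⁻ x, ‖∑ i ∈ s, c i * f i x‖ₑ ^ 2 ∂μ = ∑ i ∈ s, ‖c i‖ₑ ^ 2 * ∫⁻ x, ‖f i x‖ₑ ^ 2 ∂μ := by
  have hint : ∀ i j, Integrable (fun x => f i x * starRingEnd ℂ (f j x)) μ := fun i j =>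
    (hf i).integrable_mul (hf j).star
  have hsum : MemLp (fun x => ∑ i ∈ s, c i * f i x) 2 μ :=
    memLp_finsetSum s fun i _ => (hf i).const_mul (c i)
  have hnorm : ∀ z : ℂ, ((‖z‖ ^ 2 : ℝ) : ℂ) = z * starRingEnd ℂ z := fun z => by
    rw [Complex.mul_conj, Complex.normSq_eq_norm_sq]
  rw [lintegral_enorm_sq_eq_ofReal hsum]
  simp_rw [fun i => lintegral_enorm_sq_eq_ofReal (hf i)]
  have key : ((∫ x, ‖∑ i ∈ s, c i * f i x‖ ^ 2 ∂μ : ℝ) : ℂ) =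
      ((∑ i ∈ s, ‖c i‖ ^ 2 * ∫ x, ‖f i x‖ ^ 2 ∂μ : ℝ) : ℂ) := by
    rw [← integral_complex_ofReal]
    have : ∀ x, ((‖∑ i ∈ s, c i * f i x‖ ^ 2 : ℝ) : ℂ) =
        ∑ i ∈ s, ∑ j ∈ s, c i * starRingEnd ℂ (c j) * (f i x * starRingEnd ℂ (f j x)) := by
      intro x
      rw [hnorm, map_sum, Finset.sum_mul_sum]
      refine Finset.sum_congr rfl fun i _ => Finset.sum_congr rfl fun j _ => ?_
      rw [map_mul]; ring
    simp_rw [this]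
    rw [integral_finsetSum _ fun i _ => integrable_finsetSum _ fun j _ => (hint i j).const_mul _]
    push_cast
    refine Finset.sum_congr rfl fun i hi => ?_
    rw [integral_finsetSum _ fun j _ => (hint i j).const_mul _, Finset.sum_eq_single i]
    · rw [integral_const_mul, ← integral_complex_ofReal, ← hnorm]
      simp_rw [hnorm]
      rw [← hnorm]
      norm_cast
    · intro j _ hj
      rw [integral_const_mul, ho i j hj.symm, mul_zero]
    · exact fun h => absurd hi h
  rw [Complex.ofReal_inj.1 key, ENNReal.ofReal_sum_of_nonneg fun i _ => by positivity]
  refine Finset.sum_congr rfl fun i _ => ?_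
  rw [ENNReal.ofReal_mul (by positivity), ENNReal.ofReal_pow (norm_nonneg _), ofReal_norm]

lemma lintegral_rpow_le_rpow {α : Type*} [MeasurableSpace α] (μ : Measure α)
    [IsProbabilityMeasure μ] {f : α → ℝ≥0∞} (hf : AEMeasurable f μ) {p : ℝ} (hp : 1 ≤ p) :
    (∫⁻ x, f x ∂μ) ^ p ≤ ∫⁻ x, f x ^ p ∂μ := by
  rcases hp.eq_or_lt with rfl | hp
  · simp
  have h := ENNReal.lintegral_mul_le_Lp_mul_Lq μ (Real.HolderConjugate.conjExponent hp) hf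
    (g := fun _ => 1) aemeasurable_const
  simp only [Pi.mul_apply, mul_one, ENNReal.one_rpow, lintegral_const, measure_univ] at h
  have := ENNReal.rpow_le_rpow h (z := p) (by linarith)
  rwa [← ENNReal.rpow_mul, one_div_mul_cancel (by linarith), ENNReal.rpow_one] at this

lemma lintegral_pow_le_pow {α : Type*} [MeasurableSpace α] (μ : Measure α)
    [IsProbabilityMeasure μ] {f : α → ℝ≥0∞} (hf : AEMeasurable f μ) {n : ℕ} (hn : 1 ≤ n) :
    (∫⁻ x, f x ∂μ) ^ n ≤ ∫⁻ x, f x ^ n ∂μ := by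
  simpa only [ENNReal.rpow_natCast] using
    lintegral_rpow_le_rpow μ hf (p := (n : ℝ)) (by exact_mod_cast hn)

lemma lintegral_const_mul_add_swap {α : Type*} [MeasurableSpace α] (μ : Measure α) [SFinite μ]
    {f : α × α → ℝ≥0∞} (hf : Measurable f) (a : ℝ≥0∞) :
    ∫⁻ p, a * (f p + f p.swap) ∂(μ.prod μ) = a * (2 * ∫⁻ x, ∫⁻ y, f (x, y) ∂μ ∂μ) := by
  rw [lintegral_const_mul _ (by fun_prop), lintegral_add_left hf,
    lintegral_prod_swap, lintegral_prod _ hf.aemeasurable, two_mul]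

/-! ### Quadratic forms of Gaussian vectors by decoupling -/

section Decoupling

variable {E : Type*} [NormedAddCommGroup E] [NormedSpace ℝ E] [MeasurableSpace E] [BorelSpace E]
  [CompleteSpace E] [SecondCountableTopology E] (μ : Measure E) [IsGaussian μ]
  {ι : Type*} [Fintype ι] (L M : ι → E →L[ℝ] ℂ) (c : ι → ι → ℂ)

lemma memLp_two_clm (N : E →L[ℝ] ℂ) : MemLp N 2 μ :=
  N.comp_memLp' (IsGaussian.memLp_id μ 2 (by simp))

/-- Moments of a bilinear form of two independent copies of a Gaussian vector. -/
lemma lintegral_bilinear_pow_le (hμ : μ[id] = 0)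
    (hL : ∀ i j, i ≠ j → ∫ x, L i x * starRingEnd ℂ (L j x) ∂μ = 0)
    (hM : ∀ i j, i ≠ j → ∫ x, M i x * starRingEnd ℂ (M j x) ∂μ = 0) {r : ℕ} (hr : 1 ≤ r) :
    ∫⁻ x, ∫⁻ y, ‖∑ i, ∑ j, c i j * (L i x * M j y)‖ₑ ^ (2 * r) ∂μ ∂μ ≤
      complexMoment r * (complexMoment r * (∑ i, ∑ j, ‖c i j‖ₑ ^ 2 *
        ((∫⁻ x, ‖L i x‖ₑ ^ 2 ∂μ) * ∫⁻ x, ‖M j x‖ₑ ^ 2 ∂μ)) ^ r) := by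
  -- With `x` frozen the form is linear in `y`, hence Gaussian, and orthogonality of the `M j`
  -- computes its conditional variance.
  have h1 : ∀ x, ∫⁻ y, ‖∑ i, ∑ j, c i j * (L i x * M j y)‖ₑ ^ (2 * r) ∂μ ≤ complexMoment r *
      (∑ j, (∫⁻ y, ‖M j y‖ₑ ^ 2 ∂μ) * ‖∑ i, c i j * L i x‖ₑ ^ 2) ^ r := by
    intro x
    let N : E →L[ℝ] ℂ := ∑ j, (∑ i, c i j * L i x) • M j
    have hN : ∀ y, N y = ∑ j, (∑ i, c i j * L i x) * M j y := fun y => by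
      simp [N]
    have hN' : ∀ y, ∑ i, ∑ j, c i j * (L i x * M j y) = N y := fun y => by
      rw [hN, Finset.sum_comm]
      refine Finset.sum_congr rfl fun j _ => ?_
      rw [Finset.sum_mul]
      exact Finset.sum_congr rfl fun i _ => by ring
    simp_rw [hN']
    refine (lintegral_pow_le_complexMoment μ hμ N r).trans (le_of_eq ?_)
    congr 2
    simp_rw [hN]
    rw [lintegral_sum_orthogonal _ _ (fun j => memLp_two_clm μ (M j)) hM]
    exact Finset.sum_congr rfl fun j _ => mul_comm _ _
  -- Each term of the conditional variance is the square of a variable linear in `x`, so the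
  -- Gaussian moment bound applies a second time.
  have h2 : ∀ j, ∫⁻ x, (‖∑ i, c i j * L i x‖ₑ ^ 2) ^ r ∂μ ≤
      complexMoment r * (∑ i, ‖c i j‖ₑ ^ 2 * ∫⁻ x, ‖L i x‖ₑ ^ 2 ∂μ) ^ r := by
    intro j
    let N : E →L[ℝ] ℂ := ∑ i, c i j • L i
    have hN : ∀ x, N x = ∑ i, c i j * L i x := fun x => by
      simp [N]
    rw [← lintegral_sum_orthogonal _ _ (fun j => memLp_two_clm μ (L j)) hL]
    simp_rw [← hN, ← pow_mul]
    exact lintegral_pow_le_complexMoment μ hμ N r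
  calc _ ≤ ∫⁻ x, complexMoment r *
        (∑ j, (∫⁻ y, ‖M j y‖ₑ ^ 2 ∂μ) * ‖∑ i, c i j * L i x‖ₑ ^ 2) ^ r ∂μ := lintegral_mono h1
    _ = complexMoment r * ∫⁻ x,
        (∑ j, (∫⁻ y, ‖M j y‖ₑ ^ 2 ∂μ) * ‖∑ i, c i j * L i x‖ₑ ^ 2) ^ r ∂μ :=
        lintegral_const_mul _ (by fun_prop)
    _ ≤ complexMoment r * (complexMoment r * (∑ j, (∫⁻ y, ‖M j y‖ₑ ^ 2 ∂μ) *
        (∑ i, ‖c i j‖ₑ ^ 2 * ∫⁻ x, ‖L i x‖ₑ ^ 2 ∂μ)) ^ r) := by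
        gcongr
        exact lintegral_sum_pow_le μ _ _ (fun j => by fun_prop) _ _ _ hr h2
    _ = _ := by
        rw [Finset.sum_comm]
        congr 3
        refine Finset.sum_congr rfl fun j _ => ?_
        rw [Finset.mul_sum]
        exact Finset.sum_congr rfl fun i _ => by ring

/-- The constant in the comparison of the moments of second chaos variables. -/
def chaosMoment (r : ℕ) : ℝ≥0∞ := 2 ^ (2 * r) * (2 * (complexMoment r * complexMoment r))

lemma chaosMoment_lt_top (r : ℕ) : chaosMoment r < ∞ := by
  have := complexMoment_lt_top r
  unfold chaosMoment
  exact ENNReal.mul_lt_top (by simp) (ENNReal.mul_lt_top (by simp) (ENNReal.mul_lt_top this this))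

/-- Moments of a centred quadratic form of a Gaussian vector, by decoupling. -/
lemma lintegral_quadratic_pow_le (hμ : μ[id] = 0)
    (hL : ∀ i j, i ≠ j → ∫ x, L i x * starRingEnd ℂ (L j x) ∂μ = 0)
    (hM : ∀ i j, i ≠ j → ∫ x, M i x * starRingEnd ℂ (M j x) ∂μ = 0) {r : ℕ} (hr : 1 ≤ r) :
    ∫⁻ x, ‖∑ i, ∑ j, c i j * (L i x * M j x - ∫ y, L i y * M j y ∂μ)‖ₑ ^ (2 * r) ∂μ ≤
      chaosMoment r * (∑ i, ∑ j, ‖c i j‖ₑ ^ 2 *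
        ((∫⁻ x, ‖L i x‖ₑ ^ 2 ∂μ) * ∫⁻ x, ‖M j x‖ₑ ^ 2 ∂μ)) ^ r := by
  set Q : E → ℂ := fun x => ∑ i, ∑ j, c i j * (L i x * M j x) with hQ
  set B : E → E → ℂ := fun x y => ∑ i, ∑ j, c i j * (L i x * M j y) with hB
  have hLM : ∀ i j, Integrable (fun x => c i j * (L i x * M j x)) μ := fun i j =>
    ((memLp_two_clm μ (L i)).integrable_mul (memLp_two_clm μ (M j))).const_mul _
  have hQi : Integrable Q μ :=
    integrable_finsetSum _ fun i _ => integrable_finsetSum _ fun j _ => hLM i j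
  have hQint : ∫ x, Q x ∂μ = ∑ i, ∑ j, c i j * ∫ y, L i y * M j y ∂μ := by
    rw [hQ, integral_finsetSum _ fun i _ => integrable_finsetSum _ fun j _ => hLM i j]
    refine Finset.sum_congr rfl fun i _ => ?_
    rw [integral_finsetSum _ fun j _ => hLM i j]
    exact Finset.sum_congr rfl fun j _ => integral_const_mul _ _
  have hQm : Continuous Q := by rw [hQ]; fun_prop
  have hBm : Continuous (fun p : E × E => B p.1 p.2) := by simp only [hB]; fun_prop
  -- Polarisation: the rotated point is `((x + y)/√2, (y - x)/√2)`, so the diagonal terms cancel in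
  -- the difference and only the cross terms remain.
  have hrot : ∀ p : E × E, Q (ContinuousLinearMap.rotation (Real.pi / 4) p).1 -
      Q (ContinuousLinearMap.rotation (Real.pi / 4) p).2 = B p.1 p.2 + B p.2 p.1 := by
    intro p
    simp only [hQ, hB, ← Finset.sum_sub_distrib, ← Finset.sum_add_distrib]
    refine Finset.sum_congr rfl fun i _ => Finset.sum_congr rfl fun j _ => ?_
    have h2 : ((Real.sqrt 2 : ℝ) : ℂ) ^ 2 = 2 := by
      rw [← Complex.ofReal_pow, Real.sq_sqrt (by norm_num)]; norm_num
    simp only [ContinuousLinearMap.rotation_apply, Real.cos_pi_div_four, Real.sin_pi_div_four,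
      map_add, map_smul, Complex.real_smul, neg_smul, map_neg]
    push_cast
    linear_combination c i j * (L i p.1 * M j p.2 + L i p.2 * M j p.1) / 2 * h2
  have hprod := IsGaussian.map_rotation_eq_self (μ := μ) hμ (Real.pi / 4)
  have hBB := lintegral_bilinear_pow_le μ L M c hμ hL hM hr
  calc ∫⁻ x, ‖∑ i, ∑ j, c i j * (L i x * M j x - ∫ y, L i y * M j y ∂μ)‖ₑ ^ (2 * r) ∂μ
      = ∫⁻ x, ‖∫ y, (Q x - Q y) ∂μ‖ₑ ^ (2 * r) ∂μ := by
        refine lintegral_congr fun x => ?_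
        rw [integral_sub (integrable_const _) hQi, hQint, integral_const]
        simp [hQ, mul_sub, Finset.sum_sub_distrib]
    -- Jensen's inequality moves the power inside the average over the independent copy.
    _ ≤ ∫⁻ x, ∫⁻ y, ‖Q x - Q y‖ₑ ^ (2 * r) ∂μ ∂μ := by
        refine lintegral_mono fun x => ?_
        refine (pow_le_pow_left' (enorm_integral_le_lintegral_enorm _) _).trans ?_
        exact lintegral_pow_le_pow μ (by fun_prop) (by lia)
    _ = ∫⁻ p, ‖Q p.1 - Q p.2‖ₑ ^ (2 * r) ∂(μ.prod μ) := by
        rw [lintegral_prod _ (by fun_prop)]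
    _ = ∫⁻ p, ‖B p.1 p.2 + B p.2 p.1‖ₑ ^ (2 * r) ∂(μ.prod μ) := by
        conv_lhs => rw [← hprod]
        rw [lintegral_map (by fun_prop) (by fun_prop)]
        simp_rw [hrot]
    _ ≤ ∫⁻ p, 2 ^ (2 * r) * (‖B p.1 p.2‖ₑ ^ (2 * r) + ‖B p.2 p.1‖ₑ ^ (2 * r)) ∂(μ.prod μ) := by
        refine lintegral_mono fun p => ?_
        exact (pow_le_pow_left' (enorm_add_le _ _) _).trans (add_pow_le_two_pow_mul _ _ _)
    _ = 2 ^ (2 * r) * (2 * ∫⁻ x, ∫⁻ y, ‖B x y‖ₑ ^ (2 * r) ∂μ ∂μ) := by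
        exact lintegral_const_mul_add_swap μ (f := fun p : E × E => ‖B p.1 p.2‖ₑ ^ (2 * r))
          (hBm.enorm.measurable.pow_const _) _
    _ ≤ 2 ^ (2 * r) * (2 * (complexMoment r * (complexMoment r * (∑ i, ∑ j, ‖c i j‖ₑ ^ 2 *
        ((∫⁻ x, ‖L i x‖ₑ ^ 2 ∂μ) * ∫⁻ x, ‖M j x‖ₑ ^ 2 ∂μ)) ^ r))) := by gcongr
    _ = _ := by rw [chaosMoment]; ring

end Decoupling

/-- Moments of a centred quadratic form of two jointly Gaussian orthogonal families. -/
lemma lintegral_wick_pow_le {Ω ι : Type*} [MeasurableSpace Ω] {P : Measure Ω} [Fintype ι]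
    (A B : ι → Ω → ℂ) (hG : HasGaussianLaw (fun ω => (fun i => A i ω, fun i => B i ω)) P)
    (hA0 : ∀ i, ∫ ω, A i ω ∂P = 0) (hB0 : ∀ i, ∫ ω, B i ω ∂P = 0)
    (hA : ∀ i j, i ≠ j → ∫ ω, A i ω * starRingEnd ℂ (A j ω) ∂P = 0)
    (hB : ∀ i j, i ≠ j → ∫ ω, B i ω * starRingEnd ℂ (B j ω) ∂P = 0)
    (c : ι → ι → ℂ) {r : ℕ} (hr : 1 ≤ r) :
    ∫⁻ ω, ‖∑ i, ∑ j, c i j * (A i ω * B j ω - ∫ ω', A i ω' * B j ω' ∂P)‖ₑ ^ (2 * r) ∂P ≤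
      chaosMoment r * (∑ i, ∑ j, ‖c i j‖ₑ ^ 2 *
        ((∫⁻ ω, ‖A i ω‖ₑ ^ 2 ∂P) * ∫⁻ ω, ‖B j ω‖ₑ ^ 2 ∂P)) ^ r := by
  set X : Ω → (ι → ℂ) × (ι → ℂ) := fun ω => (fun i => A i ω, fun i => B i ω) with hX
  have hXm : AEMeasurable X P := hG.aemeasurable
  have : IsGaussian (P.map X) := hG.isGaussian_map
  let L : ι → (ι → ℂ) × (ι → ℂ) →L[ℝ] ℂ := fun i =>
    (ContinuousLinearMap.proj i).comp (ContinuousLinearMap.fst ℝ _ _)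
  let M : ι → (ι → ℂ) × (ι → ℂ) →L[ℝ] ℂ := fun i =>
    (ContinuousLinearMap.proj i).comp (ContinuousLinearMap.snd ℝ _ _)
  have hL : ∀ i ω, L i (X ω) = A i ω := fun i ω => rfl
  have hM : ∀ i ω, M i (X ω) = B i ω := fun i ω => rfl
  have hint : Integrable X P := hG.integrable
  have hμ : (P.map X)[id] = 0 := by
    rw [integral_map hXm (by fun_prop)]
    simp only [id]
    refine Prod.ext (funext fun i => ?_) (funext fun i => ?_)
    · have := (L i).integral_comp_comm hint
      simp only [hL, hA0] at this
      exact this.symm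
    · have := (M i).integral_comp_comm hint
      simp only [hM, hB0] at this
      exact this.symm
  have hint2 : ∀ f : (ι → ℂ) × (ι → ℂ) → ℂ, Continuous f →
      ∫ x, f x ∂(P.map X) = ∫ ω, f (X ω) ∂P := fun f hf =>
    integral_map hXm hf.aestronglyMeasurable
  have hlint : ∀ f : (ι → ℂ) × (ι → ℂ) → ℝ≥0∞, Measurable f →
      ∫⁻ x, f x ∂(P.map X) = ∫⁻ ω, f (X ω) ∂P := fun f hf => lintegral_map' hf.aemeasurable hXm
  have key := lintegral_quadratic_pow_le (P.map X) L M c hμ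
    (fun i j hij => by
      rw [hint2 _ (by fun_prop)]
      exact hA i j hij)
    (fun i j hij => by
      rw [hint2 _ (by fun_prop)]
      exact hB i j hij) hr
  rw [hlint _ (by fun_prop)] at key
  simp_rw [fun i => hlint (fun x => ‖L i x‖ₑ ^ 2) (by fun_prop),
    fun i => hlint (fun x => ‖M i x‖ₑ ^ 2) (by fun_prop),
    fun i j => hint2 (fun x => L i x * M j x) (by fun_prop)] at key
  exact key

/-! ### The Gaussian space of the cylindrical Brownian motion -/

section GaussianSpace

variable {Ω : Type*} [MeasurableSpace Ω] {P : Measure Ω}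

/-- `L²` limits of centred Gaussian variables are centred Gaussian. -/
lemma exists_hasLaw_gaussianReal_of_tendsto [IsProbabilityMeasure P] {X : Ω → ℝ}
    {Y : ℕ → Ω → ℝ} (hX : MemLp X 2 P) (hY : ∀ n, ∃ v, HasLaw (Y n) (gaussianReal 0 v) P)
    (h : Tendsto (fun n => eLpNorm (fun ω => Y n ω - X ω) 2 P) atTop (𝓝 0)) :
    ∃ v, HasLaw X (gaussianReal 0 v) P := by
  choose v hv using hY
  have hYL : ∀ n, MemLp (Y n) 2 P := fun n =>
    (HasLaw.hasGaussianLaw (hv n)).memLp_two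
  have hYL2 : ∀ n, ∫ ω, Y n ω ^ 2 ∂P = v n := fun n => by
    have h1 := (hv n).variance_eq
    rw [variance_id_gaussianReal, variance_eq_integral (hv n).aemeasurable,
      (hv n).integral_eq, integral_id_gaussianReal] at h1
    simpa using h1
  have hT : Tendsto (fun n => (hYL n).toLp (Y n)) atTop (𝓝 (hX.toLp X)) :=
    (Lp.tendsto_Lp_iff_tendsto_eLpNorm'' _ _ _ _).2 h
  have hnorm : ∀ {Z : Ω → ℝ} (hZ : MemLp Z 2 P), ‖hZ.toLp Z‖ ^ 2 = ∫ ω, Z ω ^ 2 ∂P :=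
    fun {Z} hZ => by
      rw [← real_inner_self_eq_norm_sq, L2.inner_def]
      refine integral_congr_ae ?_
      filter_upwards [hZ.coeFn_toLp] with ω hω
      rw [hω, real_inner_self_eq_norm_sq, Real.norm_eq_abs, sq_abs]
  -- Convergence in `L²` makes the variances converge, and an almost surely convergent subsequence
  -- makes the characteristic functions converge by domination; the two limits are then compared.
  have hvT : Tendsto (fun n => (v n : ℝ)) atTop (𝓝 (∫ ω, X ω ^ 2 ∂P)) := by
    have := hT.norm.pow 2
    simp only [hnorm, hYL2] at this
    exact this
  obtain ⟨ns, hns, hae⟩ :=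
    (tendstoInMeasure_of_tendsto_eLpNorm (p := 2) (by norm_num)
      (fun n => (hYL n).aestronglyMeasurable) hX.aestronglyMeasurable
      h).exists_seq_tendsto_ae
  refine ⟨(∫ ω, X ω ^ 2 ∂P).toNNReal, hX.aestronglyMeasurable.aemeasurable, ?_⟩
  have : IsProbabilityMeasure (P.map X) :=
    Measure.isProbabilityMeasure_map hX.aestronglyMeasurable.aemeasurable
  refine Measure.ext_of_charFun ?_
  ext u
  rw [charFun_gaussianReal, charFun_apply_real,
    integral_map hX.aestronglyMeasurable.aemeasurable (by fun_prop)]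
  have hlim1 : Tendsto (fun k => ∫ ω, Complex.exp (u * Y (ns k) ω * Complex.I) ∂P) atTop
      (𝓝 (∫ ω, Complex.exp (u * X ω * Complex.I) ∂P)) := by
    refine tendsto_integral_of_dominated_convergence (fun _ => 1) (fun k => ?_)
      (integrable_const _) (fun k => ae_of_all _ fun ω => ?_) ?_
    · have := (hv (ns k)).aemeasurable
      exact AEMeasurable.aestronglyMeasurable (by fun_prop)
    · rw [← Complex.ofReal_mul, Complex.norm_exp_ofReal_mul_I]
    · filter_upwards [hae] with ω hω
      have hc : Continuous fun x : ℝ => Complex.exp (u * x * Complex.I) := by fun_prop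
      exact (hc.tendsto _).comp hω
  have hlim2 : Tendsto (fun k => ∫ ω, Complex.exp (u * Y (ns k) ω * Complex.I) ∂P) atTop
      (𝓝 (Complex.exp (u * (0 : ℝ) * Complex.I -
        ((∫ ω, X ω ^ 2 ∂P).toNNReal : ℝ) * u ^ 2 / 2))) := by
    have he : ∀ k, ∫ ω, Complex.exp (u * Y (ns k) ω * Complex.I) ∂P =
        Complex.exp (u * (0 : ℝ) * Complex.I - ((v (ns k) : ℝ) : ℂ) * u ^ 2 / 2) := fun k => by
      have := charFun_gaussianReal (μ := 0) (v := v (ns k)) u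
      rw [← (hv (ns k)).map_eq, charFun_apply_real,
        integral_map (hv (ns k)).aemeasurable (by fun_prop)] at this
      exact this
    simp_rw [he]
    rw [Real.coe_toNNReal _ (integral_nonneg fun _ => sq_nonneg _)]
    have hc : Continuous fun x : ℝ => Complex.exp (u * (0 : ℝ) * Complex.I - x * u ^ 2 / 2) := by
      fun_prop
    exact (hc.tendsto _).comp (hvT.comp hns.tendsto_atTop)
  exact tendsto_nhds_unique hlim1 hlim2

variable (P) in
/-- The real variables that are `L²` limits of finite linear combinations of the values of a
real-valued process. -/
def gaussianSpace {τ : Type*} (B : τ → Ω → ℝ) : Submodule ℝ (Ω → ℝ) where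
  carrier := {X | MemLp X 2 P ∧ ∃ Y : ℕ → Ω → ℝ,
    (∀ n, MemLp (Y n) 2 P ∧ Y n ∈ Submodule.span ℝ (Set.range B)) ∧
    Tendsto (fun n => eLpNorm (fun ω => Y n ω - X ω) 2 P) atTop (𝓝 0)}
  zero_mem' := ⟨MemLp.zero, fun _ => 0, fun _ => ⟨MemLp.zero, Submodule.zero_mem _⟩, by simp⟩
  add_mem' := by
    rintro X X' ⟨hX, Y, hY, hT⟩ ⟨hX', Y', hY', hT'⟩
    refine ⟨hX.add hX', fun n => Y n + Y' n, fun n => ⟨(hY n).1.add (hY' n).1,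
      Submodule.add_mem _ (hY n).2 (hY' n).2⟩, ?_⟩
    refine tendsto_of_tendsto_of_tendsto_of_le_of_le tendsto_const_nhds
      (by simpa using hT.add hT') (fun _ => zero_le) fun n => ?_
    refine le_trans (le_of_eq ?_) (eLpNorm_add_le ((hY n).1.sub hX).aestronglyMeasurable
      ((hY' n).1.sub hX').aestronglyMeasurable (by norm_num))
    congr 1
    ext ω
    simp only [Pi.add_apply]
    ring
  smul_mem' := by
    rintro c X ⟨hX, Y, hY, hT⟩
    refine ⟨hX.const_smul c, fun n => c • Y n, fun n => ⟨(hY n).1.const_smul c,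
      Submodule.smul_mem _ c (hY n).2⟩, ?_⟩
    have : ∀ n, eLpNorm (fun ω => (c • Y n) ω - (c • X) ω) 2 P =
        ‖c‖ₑ * eLpNorm (fun ω => Y n ω - X ω) 2 P := fun n => by
      rw [← eLpNorm_const_smul]
      congr 1
      ext ω
      simp [mul_sub]
    simp_rw [this]
    simpa using ENNReal.Tendsto.const_mul hT (Or.inr enorm_ne_top)

lemma IsGaussianProcess.exists_hasLaw_of_mem_span {τ : Type*} {B : τ → Ω → ℝ}
    (hB : IsGaussianProcess B P) (hB0 : ∀ t, ∫ ω, B t ω ∂P = 0) {X : Ω → ℝ}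
    (hX : X ∈ Submodule.span ℝ (Set.range B)) : ∃ v, HasLaw X (gaussianReal 0 v) P := by
  obtain ⟨c, rfl⟩ := Finsupp.mem_span_range_iff_exists_finsupp.1 hX
  let L : (c.support → ℝ) →L[ℝ] ℝ := ∑ i : c.support, c i.1 • ContinuousLinearMap.proj i
  have hL : c.sum (fun i a => a • B i) = fun ω => L (c.support.restrict (B · ω)) := by
    ext ω
    simp only [Finsupp.sum, Finset.sum_apply, L, sum_apply, Pi.smul_apply]
    exact (Finset.sum_coe_sort c.support fun i => c i • B i ω).symm
  have hG := (hB.hasGaussianLaw c.support).map_fun L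
  rw [← hL] at hG
  refine ⟨Var[c.sum (fun i a => a • B i); P].toNNReal, hG.aemeasurable, ?_⟩
  have h0 : ∫ ω, c.sum (fun i a => a • B i) ω ∂P = 0 := by
    simp only [Finsupp.sum, Finset.sum_apply, Pi.smul_apply, smul_eq_mul]
    rw [integral_finsetSum _ fun i _ => ((hB.hasGaussianLaw_eval i).integrable.const_mul _)]
    simp [integral_const_mul, hB0]
  have := hG.map_eq_gaussianReal
  rw [h0] at this
  exact this

lemma IsGaussianProcess.exists_hasLaw_of_mem_gaussianSpace [IsProbabilityMeasure P] {τ : Type*}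
    {B : τ → Ω → ℝ} (hB : IsGaussianProcess B P) (hB0 : ∀ t, ∫ ω, B t ω ∂P = 0) {X : Ω → ℝ}
    (hX : X ∈ gaussianSpace P B) : ∃ v, HasLaw X (gaussianReal 0 v) P := by
  obtain ⟨h1, Y, hY, hT⟩ := hX
  exact exists_hasLaw_gaussianReal_of_tendsto h1
    (fun n => IsGaussianProcess.exists_hasLaw_of_mem_span hB hB0 (hY n).2) hT

/-- Finite families in the Gaussian space are jointly Gaussian. -/
lemma IsGaussianProcess.hasGaussianLaw_of_mem_gaussianSpace [IsProbabilityMeasure P] {τ : Type*}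
    {B : τ → Ω → ℝ} (hB : IsGaussianProcess B P) (hB0 : ∀ t, ∫ ω, B t ω ∂P = 0)
    {κ : Type*} [Fintype κ] {X : κ → Ω → ℝ} (hX : ∀ i, X i ∈ gaussianSpace P B) :
    HasGaussianLaw (fun ω i => X i ω) P := by
  classical
  have hXm : AEMeasurable (fun ω i => X i ω) P :=
    aemeasurable_pi_lambda _ fun i => (hX i).1.aestronglyMeasurable.aemeasurable
  refine ⟨⟨fun L => ?_⟩⟩
  -- Joint Gaussianity is tested on linear functionals, and these stay in the Gaussian space because
  -- it is a subspace.
  have hL : (fun ω => L (fun i => X i ω)) = ∑ i, L (Pi.single i 1) • X i := by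
    ext ω
    have : (fun i => X i ω) = ∑ i, X i ω • (Pi.single i 1 : κ → ℝ) := by
      ext j
      simp [Finset.sum_apply, Pi.single_apply]
    rw [this, map_sum, Finset.sum_apply]
    simp [mul_comm]
  obtain ⟨v, hv⟩ := IsGaussianProcess.exists_hasLaw_of_mem_gaussianSpace hB hB0
    (hL ▸ Submodule.sum_mem _ fun i _ => Submodule.smul_mem _ _ (hX i) :
      (fun ω => L (fun i => X i ω)) ∈ gaussianSpace P B)
  have hG := (HasLaw.hasGaussianLaw hv).map_eq_gaussianReal
  rw [AEMeasurable.map_map_of_aemeasurable (by fun_prop) hXm,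
    integral_map hXm (by fun_prop), variance_map (by fun_prop) hXm]
  exact hG

/-- A complex variable whose real and imaginary parts belong to the Gaussian space. -/
def IsComplexGaussian {τ : Type*} (P : Measure Ω) (B : τ → Ω → ℝ) (Z : Ω → ℂ) : Prop :=
  (fun ω => (Z ω).re) ∈ gaussianSpace P B ∧ (fun ω => (Z ω).im) ∈ gaussianSpace P B

lemma IsComplexGaussian.sub {τ : Type*} {B : τ → Ω → ℝ} {Z Z' : Ω → ℂ}
    (hZ : IsComplexGaussian P B Z) (hZ' : IsComplexGaussian P B Z') :
    IsComplexGaussian P B (fun ω => Z ω - Z' ω) :=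
  ⟨Submodule.sub_mem _ hZ.1 hZ'.1, Submodule.sub_mem _ hZ.2 hZ'.2⟩

lemma IsComplexGaussian.memLp {τ : Type*} {B : τ → Ω → ℝ} {Z : Ω → ℂ}
    (hZ : IsComplexGaussian P B Z) : MemLp Z 2 P := by
  have h := (hZ.1.1.ofReal (K := ℂ)).add ((hZ.2.1.ofReal (K := ℂ)).mul_const Complex.I)
  refine h.ae_eq (ae_of_all _ fun ω => ?_)
  exact Complex.re_add_im (Z ω)

lemma IsComplexGaussian.integral_eq_zero [IsProbabilityMeasure P] {τ : Type*} {B : τ → Ω → ℝ}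
    (hB : IsGaussianProcess B P) (hB0 : ∀ t, ∫ ω, B t ω ∂P = 0) {Z : Ω → ℂ}
    (hZ : IsComplexGaussian P B Z) : ∫ ω, Z ω ∂P = 0 := by
  have hZi := hZ.memLp.integrable (by norm_num)
  have h0 : ∀ {X : Ω → ℝ}, X ∈ gaussianSpace P B → ∫ ω, X ω ∂P = 0 := fun {X} hX => by
    obtain ⟨v, hv⟩ := IsGaussianProcess.exists_hasLaw_of_mem_gaussianSpace hB hB0 hX
    rw [hv.integral_eq, integral_id_gaussianReal]
  refine Complex.ext ?_ ?_
  · exact (Complex.reCLM.integral_comp_comm hZi).symm.trans (h0 hZ.1)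
  · exact (Complex.imCLM.integral_comp_comm hZi).symm.trans (h0 hZ.2)

/-- The four families of real and imaginary parts form one real Gaussian vector, of which the pair
is a linear image. Joint Gaussianity of the two families is what the decoupling bound requires. -/
lemma IsComplexGaussian.hasGaussianLaw_pair [IsProbabilityMeasure P] {τ : Type*} {B : τ → Ω → ℝ}
    (hB : IsGaussianProcess B P) (hB0 : ∀ t, ∫ ω, B t ω ∂P = 0) {ι : Type*} [Fintype ι]
    {Z Z' : ι → Ω → ℂ} (hZ : ∀ i, IsComplexGaussian P B (Z i))
    (hZ' : ∀ i, IsComplexGaussian P B (Z' i)) :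
    HasGaussianLaw (fun ω => (fun i => Z i ω, fun i => Z' i ω)) P := by
  let X : ι × Fin 4 → Ω → ℝ := fun p ω =>
    ![(Z p.1 ω).re, (Z p.1 ω).im, (Z' p.1 ω).re, (Z' p.1 ω).im] p.2
  have hX : ∀ p, X p ∈ gaussianSpace P B := by
    rintro ⟨i, j⟩
    fin_cases j
    exacts [(hZ i).1, (hZ i).2, (hZ' i).1, (hZ' i).2]
  let L : (ι × Fin 4 → ℝ) →ₗ[ℝ] (ι → ℂ) × (ι → ℂ) :=
    { toFun := fun x => (fun i => ⟨x (i, 0), x (i, 1)⟩, fun i => ⟨x (i, 2), x (i, 3)⟩)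
      map_add' := fun x y => rfl
      map_smul' := fun c x => by
        refine Prod.ext (funext fun i => ?_) (funext fun i => ?_) <;>
          simp [Complex.ext_iff] }
  exact (IsGaussianProcess.hasGaussianLaw_of_mem_gaussianSpace hB hB0 hX).map
    L.toContinuousLinearMap

end GaussianSpace

/-! ### Covariances of the cylindrical Brownian motion -/

section Cylindrical

variable {Ω : Type*} [MeasurableSpace Ω] {P : Measure Ω}
  {W : ℤ → ℝ≥0 → Ω → ℂ}

/-- The real coordinates as one process. -/
def coordProcess (W : ℤ → ℝ≥0 → Ω → ℂ) (p : ℤ × ℝ≥0) (ω : Ω) : ℝ := realCoord W p.1 p.2 ω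

/-- A finite set of (coordinate, time) pairs is enlarged to a product `J × K`. Each coordinate is
Gaussian along `K`, the coordinates are independent over `J`, and the original marginal is a
projection. -/
lemma IsCylindricalBM.isGaussianProcess (hW : IsCylindricalBM P W) :
    IsGaussianProcess (coordProcess W) P where
  hasGaussianLaw I := by
    classical
    let J := I.image Prod.fst
    let K := I.image Prod.snd
    have h1 : ∀ j : J, HasGaussianLaw (fun ω => K.restrict (realCoord W j · ω)) P := fun j => by
      have hB := hW.brownian j
      have hG := hB.isGaussianProcess
      exact hG.hasGaussianLaw K
    have h2 : iIndepFun (fun (j : J) ω => K.restrict (realCoord W j · ω)) P :=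
      (hW.indep.precomp (g := fun j : J => (j : ℤ)) Subtype.val_injective).comp
        (fun _ f => K.restrict f) fun _ => by fun_prop
    have h3 := h2.hasGaussianLaw h1
    let L : (J → K → ℝ) →L[ℝ] (I → ℝ) := ContinuousLinearMap.pi fun p =>
      (ContinuousLinearMap.proj (R := ℝ) (φ := fun _ : K => ℝ)
        ⟨p.1.2, Finset.mem_image_of_mem _ p.2⟩).comp
        (ContinuousLinearMap.proj ⟨p.1.1, Finset.mem_image_of_mem _ p.2⟩)
    exact h3.map L

lemma IsCylindricalBM.integral_coord (hW : IsCylindricalBM P W) (p : ℤ × ℝ≥0) :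
    ∫ ω, coordProcess W p ω ∂P = 0 :=
  (hW.brownian p.1).integral_eval p.2

lemma IsCylindricalBM.memLp_coord (hW : IsCylindricalBM P W) (p : ℤ × ℝ≥0) :
    MemLp (coordProcess W p) 2 P := by
  have hB := hW.brownian p.1
  have hG := hB.isGaussianProcess
  exact (hG.hasGaussianLaw_eval p.2).memLp_two

lemma IsCylindricalBM.integral_coord_mul [IsProbabilityMeasure P] (hW : IsCylindricalBM P W) (i j : ℤ) (s t : ℝ≥0) :
    ∫ ω, realCoord W i s ω * realCoord W j t ω ∂P = if i = j then (min s t : ℝ) else 0 := by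
  split_ifs with h
  · subst h
    have := (hW.brownian i).covariance_fun_eval s t
    have hc := covariance_eq_sub (hW.memLp_coord (i, s)) (hW.memLp_coord (i, t))
    have h0 := hW.integral_coord (i, s)
    rw [h0, zero_mul, sub_zero] at hc
    exact hc.symm.trans (by exact_mod_cast this)
  · have hi : IndepFun (realCoord W i s) (realCoord W j t) P :=
      (hW.indep.indepFun h).comp (measurable_pi_apply s) (measurable_pi_apply t)
    have := hi.integral_mul_eq_mul_integral
      (hW.memLp_coord (i, s)).aestronglyMeasurable (hW.memLp_coord (j, t)).aestronglyMeasurable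
    have h0 := hW.integral_coord (i, s)
    simp only [coordProcess] at h0
    rw [h0, zero_mul] at this
    exact this

/-- Coefficient of `W k` along the real coordinate `|k|`. -/
def coordRe (k : ℤ) : ℂ := if k = 0 then 1 else ((Real.sqrt 2)⁻¹ : ℝ)

/-- Coefficient of `W k` along the real coordinate `-|k|`. -/
def coordIm (k : ℤ) : ℂ :=
  if k = 0 then 0 else if 0 < k then ((Real.sqrt 2)⁻¹ : ℝ) * Complex.I
    else -(((Real.sqrt 2)⁻¹ : ℝ) * Complex.I)

lemma IsCylindricalBM.eq_coord (hW : IsCylindricalBM P W) (k : ℤ) (t : ℝ≥0) (ω : Ω) :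
    W k t ω = coordRe k * realCoord W |k| t ω + coordIm k * realCoord W (-|k|) t ω := by
  have h2 : (Real.sqrt 2)⁻¹ * Real.sqrt 2 = 1 := inv_mul_cancel₀ (by positivity)
  have key : ∀ m : ℤ, 0 < m → W m t ω = ((Real.sqrt 2)⁻¹ : ℝ) * (realCoord W m t ω : ℂ) +
      ((Real.sqrt 2)⁻¹ : ℝ) * Complex.I * (realCoord W (-m) t ω : ℂ) := fun m hm => by
    have h1 : ¬ (0 < -m) := by lia
    have h3 : -m < 0 := by lia
    simp only [realCoord, hm, if_true, h1, h3, if_false, neg_neg]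
    have h4 : (((Real.sqrt 2)⁻¹ : ℝ) : ℂ) * ((Real.sqrt 2 : ℝ) : ℂ) = 1 := by
      rw [← Complex.ofReal_mul, h2, Complex.ofReal_one]
    push_cast at h4 ⊢
    linear_combination -((W m t ω).re + (W m t ω).im * Complex.I) * h4 -
      Complex.re_add_im (W m t ω)
  rcases lt_trichotomy k 0 with hk | rfl | hk
  · have hk' : 0 < -k := by lia
    have hc := hW.conj_symm (-k) t ω
    rw [neg_neg] at hc
    rw [hc, key (-k) hk', abs_of_neg hk]
    have h1 : ¬ (0 < k) := by lia
    simp only [coordRe, coordIm, hk.ne, if_false, h1, map_add, map_mul, Complex.conj_ofReal,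
      Complex.conj_I]
    ring
  · have him : (W 0 t ω).im = 0 := by
      have := hW.conj_symm 0 t ω
      rw [neg_zero] at this
      exact Complex.conj_eq_iff_im.1 this.symm
    simp [coordRe, coordIm, realCoord, Complex.ext_iff, him]
  · rw [abs_of_pos hk, key k hk]
    simp [coordRe, coordIm, hk.ne', hk]

lemma IsCylindricalBM.memLp (hW : IsCylindricalBM P W) (k : ℤ) (t : ℝ≥0) :
    MemLp (W k t) 2 P := by
  have h := (((hW.memLp_coord (|k|, t)).ofReal (K := ℂ)).const_mul (coordRe k)).add
    (((hW.memLp_coord (-|k|, t)).ofReal (K := ℂ)).const_mul (coordIm k))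
  exact h.ae_eq (ae_of_all _ fun ω => (hW.eq_coord k t ω).symm)

/-- The delicate case is `l = -k ≠ 0`, where the two modes are conjugate and far from independent:
the contributions of the real and imaginary parts have equal variance and opposite sign. Thus
orthogonality holds for all `k ≠ l`, and independence is never needed for the quadratic forms. -/
lemma IsCylindricalBM.integral_mul_conj [IsProbabilityMeasure P] (hW : IsCylindricalBM P W) (k l : ℤ) (s t : ℝ≥0) :
    ∫ ω, W k s ω * starRingEnd ℂ (W l t ω) ∂P = if k = l then ((min s t : ℝ) : ℂ) else 0 := by
  have hint : ∀ i j : ℤ, Integrable (fun ω => ((realCoord W i s ω * realCoord W j t ω : ℝ) : ℂ)) P :=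
    fun i j => ((hW.memLp_coord (i, s)).integrable_mul (hW.memLp_coord (j, t))).ofReal
  have hval : ∀ i j : ℤ, ∫ ω, ((realCoord W i s ω * realCoord W j t ω : ℝ) : ℂ) ∂P =
      if i = j then ((min s t : ℝ) : ℂ) else 0 := fun i j => by
    rw [integral_complex_ofReal, hW.integral_coord_mul]
    split_ifs <;> simp
  have hexp : ∀ ω, W k s ω * starRingEnd ℂ (W l t ω) =
      coordRe k * starRingEnd ℂ (coordRe l) * (realCoord W |k| s ω * realCoord W |l| t ω : ℝ) +
      coordRe k * starRingEnd ℂ (coordIm l) * (realCoord W |k| s ω * realCoord W (-|l|) t ω : ℝ) +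
      (coordIm k * starRingEnd ℂ (coordRe l) * (realCoord W (-|k|) s ω * realCoord W |l| t ω : ℝ) +
      coordIm k * starRingEnd ℂ (coordIm l) *
        (realCoord W (-|k|) s ω * realCoord W (-|l|) t ω : ℝ)) := fun ω => by
    rw [hW.eq_coord k, hW.eq_coord l]
    simp only [map_add, map_mul, Complex.conj_ofReal]
    push_cast
    ring
  simp_rw [hexp]
  have hI : ∀ (a b : ℂ) (i j i' j' : ℤ), Integrable (fun ω =>
      a * ((realCoord W i s ω * realCoord W j t ω : ℝ) : ℂ) +
        b * ((realCoord W i' s ω * realCoord W j' t ω : ℝ) : ℂ)) P := fun a b i j i' j' =>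
    ((hint i j).const_mul a).add ((hint i' j').const_mul b)
  rw [integral_add (hI _ _ _ _ _ _) (hI _ _ _ _ _ _),
    integral_add ((hint _ _).const_mul _) ((hint _ _).const_mul _),
    integral_add ((hint _ _).const_mul _) ((hint _ _).const_mul _)]
  simp only [integral_const_mul, hval]
  have h2 : (((Real.sqrt 2)⁻¹ : ℝ) : ℂ) * (((Real.sqrt 2)⁻¹ : ℝ) : ℂ) = 2⁻¹ := by
    rw [← Complex.ofReal_mul, ← mul_inv, Real.mul_self_sqrt (by norm_num)]
    norm_num
  generalize ((min s t : ℝ) : ℂ) = m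
  rcases eq_or_ne |k| |l| with habs | habs
  · rcases eq_or_ne k l with rfl | hkl
    · rcases eq_or_ne k 0 with rfl | hk
      · simp [coordRe, coordIm]
      · have h1 : |k| ≠ -|k| := by grind
        have h3 : -|k| ≠ |k| := by grind
        rcases lt_or_gt_of_ne hk with h | h
        · have h4 : ¬ 0 < k := by lia
          simp only [h1, h3, coordRe, coordIm, hk, h4, if_true, if_false, map_mul, map_neg,
            Complex.conj_ofReal, Complex.conj_I]
          linear_combination m * (1 - Complex.I ^ 2) * h2 -
            m * 2⁻¹ * Complex.I_sq
        · simp only [h1, h3, coordRe, coordIm, hk, h, if_true, if_false, map_mul,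
            Complex.conj_ofReal, Complex.conj_I]
          linear_combination m * (1 - Complex.I ^ 2) * h2 -
            m * 2⁻¹ * Complex.I_sq
    · have hl : k = -l := by grind
      subst hl
      have hl0 : l ≠ 0 := by grind
      have h1 : |l| ≠ -|l| := by grind
      have h3 : -|l| ≠ |l| := by grind
      rcases lt_or_gt_of_ne hl0 with h | h
      · have h4 : ¬ 0 < l := by lia
        have h5 : 0 < -l := by lia
        simp only [abs_neg, h1, h3, coordRe, coordIm, hl0, neg_eq_zero, hkl, h4, h5, if_true,
          if_false, map_mul, map_neg, Complex.conj_ofReal, Complex.conj_I]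
        linear_combination m * (1 + Complex.I ^ 2) * h2 +
          m * 2⁻¹ * Complex.I_sq
      · have h4 : ¬ 0 < -l := by lia
        simp only [abs_neg, h1, h3, coordRe, coordIm, hl0, neg_eq_zero, hkl, h4, h, if_true,
          if_false, map_mul, Complex.conj_ofReal, Complex.conj_I]
        linear_combination m * (1 + Complex.I ^ 2) * h2 +
          m * 2⁻¹ * Complex.I_sq
  · have hkl : k ≠ l := fun h => habs (by rw [h])
    have h1 : -|k| ≠ -|l| := by grind
    have h3 : |k| ≠ -|l| := by grind
    have h4 : -|k| ≠ |l| := by grind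
    simp only [habs, hkl, h1, h3, h4, if_false, mul_zero, add_zero]

end Cylindrical

/-! ### Wiener integrals -/

section Wiener

variable {Ω : Type*} [MeasurableSpace Ω] {P : Measure Ω} {W : ℤ → ℝ≥0 → Ω → ℂ}

/-- The length of the overlap of the two intervals, written as the combination of minima that the
covariance of two Brownian increments produces. -/
lemma integral_indicator_Ioc_mul {a b a' b' : ℝ} (h : a ≤ b) (h' : a' ≤ b') (c c' : ℂ) :
    ∫ s, (Set.Ioc a b).indicator (fun _ => c) s *
      starRingEnd ℂ ((Set.Ioc a' b').indicator (fun _ => c') s) =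
      c * starRingEnd ℂ c' * ((min b b' - min b a' - min a b' + min a a' : ℝ) : ℂ) := by
  have h1 : ∀ s, (Set.Ioc a b).indicator (fun _ => c) s *
      starRingEnd ℂ ((Set.Ioc a' b').indicator (fun _ => c') s) =
      (Set.Ioc (max a a') (min b b')).indicator (fun _ => c * starRingEnd ℂ c') s := fun s => by
    rw [← Set.Ioc_inter_Ioc]
    by_cases h1 : s ∈ Set.Ioc a b <;> by_cases h2 : s ∈ Set.Ioc a' b' <;> simp [h1, h2]
  simp_rw [h1]
  rw [integral_indicator measurableSet_Ioc, setIntegral_const, Measure.real, Real.volume_Ioc,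
    Complex.real_smul, mul_comm, ENNReal.toReal_ofReal']
  congr 2
  grind

lemma StepFn.memLp_integral (hW : IsCylindricalBM P W) (S : StepFn) (k : ℤ) :
    MemLp (S.integral (W k)) 2 P := by
  unfold StepFn.integral
  exact memLp_finsetSum _ fun i _ => ((hW.memLp k _).sub (hW.memLp k _)).const_mul _

lemma memLp_indicator_Ioc (a b : ℝ) (c : ℂ) :
    MemLp ((Set.Ioc a b).indicator fun _ => c) 2 (volume : Measure ℝ) :=
  memLp_indicator_const 2 measurableSet_Ioc c (Or.inr (by simp))

lemma StepFn.memLp_toFun (S : StepFn) : MemLp S.toFun 2 (volume : Measure ℝ) := by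
  have : S.toFun = fun s => ∑ i, (Set.Ioc (S.left i : ℝ) (S.right i : ℝ)).indicator
    (fun _ => S.coef i) s := rfl
  rw [this]
  exact memLp_finsetSum _ fun i _ => memLp_indicator_Ioc _ _ _

/-- The isometry property of the integral of step functions. -/
lemma StepFn.integral_mul_conj [IsProbabilityMeasure P] (hW : IsCylindricalBM P W)
    (S S' : StepFn) (k l : ℤ) :
    ∫ ω, S.integral (W k) ω * starRingEnd ℂ (S'.integral (W l) ω) ∂P =
      if k = l then ∫ s, S.toFun s * starRingEnd ℂ (S'.toFun s) else 0 := by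
  have hint : ∀ (a b : ℂ) (s t s' t' : ℝ≥0), Integrable (fun ω =>
      a * (W k s ω - W k t ω) * starRingEnd ℂ (b * (W l s' ω - W l t' ω))) P :=
    fun a b s t s' t' => (((hW.memLp k s).sub (hW.memLp k t)).const_mul a).integrable_mul
      (((hW.memLp l s').sub (hW.memLp l t')).const_mul b).star
  have hWW : ∀ s t : ℝ≥0, Integrable (fun ω => W k s ω * starRingEnd ℂ (W l t ω)) P :=
    fun s t => (hW.memLp k s).integrable_mul (hW.memLp l t).star
  have hval : ∀ (a b : ℂ) (s t s' t' : ℝ≥0), ∫ ω,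
      a * (W k s ω - W k t ω) * starRingEnd ℂ (b * (W l s' ω - W l t' ω)) ∂P =
      if k = l then a * starRingEnd ℂ b *
        ((min s s' - min s t' - min t s' + min t t' : ℝ) : ℂ) else 0 := fun a b s t s' t' => by
    have he : ∀ ω, a * (W k s ω - W k t ω) * starRingEnd ℂ (b * (W l s' ω - W l t' ω)) =
        a * starRingEnd ℂ b * ((W k s ω * starRingEnd ℂ (W l s' ω) -
          W k s ω * starRingEnd ℂ (W l t' ω)) - (W k t ω * starRingEnd ℂ (W l s' ω) -
          W k t ω * starRingEnd ℂ (W l t' ω))) := fun ω => by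
      simp only [map_mul, map_sub]
      ring
    simp_rw [he]
    have hI : ∀ s t t' : ℝ≥0, Integrable (fun ω => W k s ω * starRingEnd ℂ (W l t ω) -
        W k s ω * starRingEnd ℂ (W l t' ω)) P := fun s t t' => (hWW s t).sub (hWW s t')
    rw [integral_const_mul, integral_sub (hI _ _ _) (hI _ _ _), integral_sub (hWW _ _) (hWW _ _),
      integral_sub (hWW _ _) (hWW _ _)]
    simp only [hW.integral_mul_conj]
    split_ifs
    · push_cast; ring
    · simp
  simp only [StepFn.integral, map_sum, Finset.sum_mul_sum]
  rw [integral_finsetSum _ fun i _ => integrable_finsetSum _ fun j _ => hint _ _ _ _ _ _]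
  simp_rw [integral_finsetSum _ fun j _ => hint _ _ _ _ _ _, hval]
  split_ifs with hkl
  · simp only [StepFn.toFun, map_sum, Finset.sum_mul_sum]
    have hint2 : ∀ i j, Integrable (fun s => (Set.Ioc (S.left i : ℝ) (S.right i : ℝ)).indicator
        (fun _ => S.coef i) s * starRingEnd ℂ ((Set.Ioc (S'.left j : ℝ)
          (S'.right j : ℝ)).indicator (fun _ => S'.coef j) s)) volume := fun i j =>
      (memLp_indicator_Ioc _ _ _).integrable_mul (memLp_indicator_Ioc _ _ _).star
    rw [integral_finsetSum _ fun i _ => integrable_finsetSum _ fun j _ => hint2 i j]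
    simp_rw [integral_finsetSum _ fun j _ => hint2 _ j]
    refine Finset.sum_congr rfl fun i _ => Finset.sum_congr rfl fun j _ => ?_
    rw [integral_indicator_Ioc_mul (by exact_mod_cast S.left_le_right i)
      (by exact_mod_cast S'.left_le_right j)]
    push_cast
    rfl
  · simp

lemma eLpNorm_two_eq_of_integral {α β : Type*} [MeasurableSpace α] [MeasurableSpace β]
    {μ : Measure α} {ν : Measure β} {f : α → ℂ} {g : β → ℂ} (hf : MemLp f 2 μ) (hg : MemLp g 2 ν)
    (h : ∫ x, f x * starRingEnd ℂ (f x) ∂μ = ∫ x, g x * starRingEnd ℂ (g x) ∂ν) :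
    eLpNorm f 2 μ = eLpNorm g 2 ν := by
  have hnorm : ∀ z : ℂ, z * starRingEnd ℂ z = ((‖z‖ ^ 2 : ℝ) : ℂ) := fun z => by
    rw [Complex.mul_conj, Complex.normSq_eq_norm_sq]
  simp_rw [hnorm, integral_complex_ofReal, Complex.ofReal_inj] at h
  rw [eLpNorm_eq_lintegral_rpow_enorm_toReal (by norm_num) (by norm_num),
    eLpNorm_eq_lintegral_rpow_enorm_toReal (by norm_num) (by norm_num)]
  simp only [ENNReal.toReal_ofNat, ENNReal.rpow_ofNat]
  rw [lintegral_enorm_sq_eq_ofReal hf, lintegral_enorm_sq_eq_ofReal hg, h]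

lemma StepFn.eLpNorm_integral [IsProbabilityMeasure P] (hW : IsCylindricalBM P W) (S : StepFn)
    (k : ℤ) {t : ℝ≥0} (ht : ∀ i, S.right i ≤ t) :
    eLpNorm (S.integral (W k)) 2 P =
      eLpNorm S.toFun 2 (volume.restrict (Set.Ioc 0 (t : ℝ))) := by
  have hsupp : Function.support S.toFun ⊆ Set.Ioc 0 (t : ℝ) := by
    intro s hs
    by_contra hn
    refine hs (Finset.sum_eq_zero fun i _ => Set.indicator_of_notMem (fun hi => hn ?_) _)
    exact ⟨(S.left i).coe_nonneg.trans_lt hi.1, hi.2.trans (by exact_mod_cast ht i)⟩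
  rw [eLpNorm_restrict_eq_of_support_subset hsupp]
  exact eLpNorm_two_eq_of_integral (S.memLp_integral hW k) S.memLp_toFun
    (by simpa using S.integral_mul_conj hW S k k)

/-- The difference of two step functions. -/
def StepFn.sub (S S' : StepFn) : StepFn where
  size := S.size + S'.size
  coef := Fin.append S.coef (fun i => -S'.coef i)
  left := Fin.append S.left S'.left
  right := Fin.append S.right S'.right
  left_le_right := fun i => by
    refine Fin.addCases (fun i => ?_) (fun i => ?_) i
    · simpa using S.left_le_right i
    · simpa using S'.left_le_right i

omit [MeasurableSpace Ω] in
lemma StepFn.sub_integral (S S' : StepFn) (B : ℝ≥0 → Ω → ℂ) (ω : Ω) :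
    (S.sub S').integral B ω = S.integral B ω - S'.integral B ω := by
  simp only [StepFn.integral]
  refine (Fin.sum_univ_add _).trans ?_
  simp [StepFn.sub, sub_eq_add_neg]

lemma StepFn.sub_toFun (S S' : StepFn) (s : ℝ) :
    (S.sub S').toFun s = S.toFun s - S'.toFun s := by
  simp only [StepFn.toFun]
  refine (Fin.sum_univ_add _).trans ?_
  rw [sub_eq_add_neg, ← Finset.sum_neg_distrib]
  congr 1
  · simp [StepFn.sub]
  · refine Finset.sum_congr rfl fun i _ => ?_
    simp [StepFn.sub, Set.indicator_apply]
    split_ifs <;> simp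

lemma StepFn.sub_right_le {S S' : StepFn} {t : ℝ≥0} (h : ∀ i, S.right i ≤ t)
    (h' : ∀ i, S'.right i ≤ t) : ∀ i, (S.sub S').right i ≤ t := fun i => by
  refine Fin.addCases (fun i => ?_) (fun i => ?_) i
  · simpa [StepFn.sub] using h i
  · simpa [StepFn.sub] using h' i

/-- The isometry for step functions passes to the limit through the triangle inequality on both
sides. Only the upper bound is needed later. -/
lemma eLpNorm_le_of_tendsto_stepFn [IsProbabilityMeasure P] (hW : IsCylindricalBM P W) {k : ℤ}
    {t : ℝ≥0} {S : ℕ → StepFn} (hS : ∀ n i, (S n).right i ≤ t) {f : ℝ → ℂ}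
    (hf : AEStronglyMeasurable f (volume.restrict (Set.Ioc 0 (t : ℝ)))) {X : Ω → ℂ}
    (hX : AEStronglyMeasurable X P)
    (h1 : Tendsto (fun n => eLpNorm (fun s => (S n).toFun s - f s) 2
      (volume.restrict (Set.Ioc 0 (t : ℝ)))) atTop (𝓝 0))
    (h2 : Tendsto (fun n => eLpNorm (fun ω => (S n).integral (W k) ω - X ω) 2 P) atTop (𝓝 0)) :
    eLpNorm X 2 P ≤ eLpNorm f 2 (volume.restrict (Set.Ioc 0 (t : ℝ))) := by
  have hb : ∀ n, eLpNorm X 2 P ≤ eLpNorm (fun ω => (S n).integral (W k) ω - X ω) 2 P +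
      (eLpNorm (fun s => (S n).toFun s - f s) 2 (volume.restrict (Set.Ioc 0 (t : ℝ))) +
        eLpNorm f 2 (volume.restrict (Set.Ioc 0 (t : ℝ)))) := fun n => by
    have hI := ((S n).memLp_integral hW k).aestronglyMeasurable
    have hT := ((S n).memLp_toFun).aestronglyMeasurable.restrict (s := Set.Ioc 0 (t : ℝ))
    have e1 : X = fun ω => (S n).integral (W k) ω - ((S n).integral (W k) ω - X ω) := by
      ext ω; ring
    have e2 : (S n).toFun = fun s => ((S n).toFun s - f s) + f s := by
      ext ω; ring
    calc eLpNorm X 2 P ≤ eLpNorm ((S n).integral (W k)) 2 P +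
          eLpNorm (fun ω => (S n).integral (W k) ω - X ω) 2 P := by
          conv_lhs => rw [e1]
          exact eLpNorm_sub_le hI (hI.sub hX) (by norm_num)
      _ ≤ _ := by
          rw [add_comm, (S n).eLpNorm_integral hW k (hS n)]
          gcongr
          conv_lhs => rw [e2]
          exact eLpNorm_add_le (hT.sub hf) hf (by norm_num)
  have hlim := h2.add (h1.add_const (eLpNorm f 2 (volume.restrict (Set.Ioc 0 (t : ℝ)))))
  simp only [zero_add] at hlim
  exact ge_of_tendsto' hlim hb

lemma IsItoIntegral.eLpNorm_le [IsProbabilityMeasure P] (hW : IsCylindricalBM P W) {k : ℤ}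
    {t : ℝ≥0} {f : ℝ → ℂ} {X : Ω → ℂ} (hX : IsItoIntegral P (W k) t f X)
    (hf : AEStronglyMeasurable f (volume.restrict (Set.Ioc 0 (t : ℝ)))) :
    eLpNorm X 2 P ≤ eLpNorm f 2 (volume.restrict (Set.Ioc 0 (t : ℝ))) := by
  obtain ⟨h0, S, hS, h1, h2⟩ := hX
  exact eLpNorm_le_of_tendsto_stepFn hW hS hf h0.aestronglyMeasurable h1 h2

/-- Step functions for the earlier time vanish on `(s, t]`, so they also approximate `g` extended by
zero on `(0, t]`. The increment is thus a limit of integrals of differences of step functions,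
although the integrand itself depends on time. -/
lemma IsItoIntegral.eLpNorm_increment_le [IsProbabilityMeasure P] (hW : IsCylindricalBM P W) {k : ℤ}
    {s t : ℝ≥0} (hst : s ≤ t) {f g : ℝ → ℂ} {X Y : Ω → ℂ} (hX : IsItoIntegral P (W k) t f X)
    (hY : IsItoIntegral P (W k) s g Y) (hf : Measurable f) (hg : Measurable g) :
    eLpNorm (fun ω => X ω - Y ω) 2 P ≤
      eLpNorm (fun r => f r - (Set.Ioc 0 (s : ℝ)).indicator g r) 2
        (volume.restrict (Set.Ioc 0 (t : ℝ))) := by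
  obtain ⟨h0, S, hS, h1, h2⟩ := hX
  obtain ⟨h0', S', hS', h1', h2'⟩ := hY
  have hgm : Measurable ((Set.Ioc 0 (s : ℝ)).indicator g) := hg.indicator measurableSet_Ioc
  refine eLpNorm_le_of_tendsto_stepFn hW (k := k) (S := fun n => (S n).sub (S' n))
    (fun n => StepFn.sub_right_le (hS n) fun i => (hS' n i).trans hst)
    (hf.sub hgm).aestronglyMeasurable (h0.sub h0').aestronglyMeasurable ?_ ?_
  · have hind : ∀ n, eLpNorm (fun r => (S' n).toFun r - (Set.Ioc 0 (s : ℝ)).indicator g r) 2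
        (volume.restrict (Set.Ioc 0 (t : ℝ))) = eLpNorm (fun r => (S' n).toFun r - g r) 2
        (volume.restrict (Set.Ioc 0 (s : ℝ))) := fun n => by
      have hz : (fun r => (S' n).toFun r - (Set.Ioc 0 (s : ℝ)).indicator g r) =
          (Set.Ioc 0 (s : ℝ)).indicator (fun r => (S' n).toFun r - g r) := by
        ext r
        by_cases hr : r ∈ Set.Ioc 0 (s : ℝ)
        · simp [hr]
        · have : (S' n).toFun r = 0 :=
            Finset.sum_eq_zero fun i _ => Set.indicator_of_notMem (fun hi => hr
              ⟨((S' n).left i).coe_nonneg.trans_lt hi.1,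
                hi.2.trans (by exact_mod_cast hS' n i)⟩) _
          simp [hr, this]
      rw [hz, eLpNorm_indicator_eq_eLpNorm_restrict measurableSet_Ioc,
        Measure.restrict_restrict measurableSet_Ioc,
        Set.inter_eq_left.2 (Set.Ioc_subset_Ioc_right (by exact_mod_cast hst))]
    refine tendsto_of_tendsto_of_tendsto_of_le_of_le tendsto_const_nhds
      (by simpa using h1.add h1') (fun _ => zero_le) fun n => ?_
    dsimp only
    rw [← hind n]
    refine le_trans (le_of_eq ?_) (eLpNorm_sub_le
      ((((S n).memLp_toFun).aestronglyMeasurable.restrict).sub hf.aestronglyMeasurable)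
      ((((S' n).memLp_toFun).aestronglyMeasurable.restrict).sub hgm.aestronglyMeasurable)
      (by norm_num))
    congr 1
    ext r
    simp only [StepFn.sub_toFun, Pi.sub_apply]
    ring
  · refine tendsto_of_tendsto_of_tendsto_of_le_of_le tendsto_const_nhds
      (by simpa using h2.add h2') (fun _ => zero_le) fun n => ?_
    refine le_trans (le_of_eq ?_) (eLpNorm_sub_le
      (((S n).memLp_integral hW k).sub h0).aestronglyMeasurable
      (((S' n).memLp_integral hW k).sub h0').aestronglyMeasurable (by norm_num))
    congr 1
    ext ω
    simp only [StepFn.sub_integral, Pi.sub_apply]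
    ring

/-- The approximating step integrals are orthogonal, and the inner product of `L²` is continuous. -/
lemma IsItoIntegral.integral_mul_conj_eq_zero [IsProbabilityMeasure P] (hW : IsCylindricalBM P W)
    {k l : ℤ} (hkl : k ≠ l) {s t : ℝ≥0} {f g : ℝ → ℂ} {X Y : Ω → ℂ}
    (hX : IsItoIntegral P (W k) t f X) (hY : IsItoIntegral P (W l) s g Y) :
    ∫ ω, X ω * starRingEnd ℂ (Y ω) ∂P = 0 := by
  obtain ⟨h0, S, hS, h1, h2⟩ := hX
  obtain ⟨h0', S', hS', h1', h2'⟩ := hY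
  have hinner : ∀ {X Y : Ω → ℂ} (hX : MemLp X 2 P) (hY : MemLp Y 2 P),
      inner ℂ (hY.toLp Y) (hX.toLp X) = ∫ ω, X ω * starRingEnd ℂ (Y ω) ∂P := fun hX hY => by
    rw [L2.inner_def]
    refine integral_congr_ae ?_
    filter_upwards [hX.coeFn_toLp, hY.coeFn_toLp] with ω h1 h2
    rw [h1, h2, RCLike.inner_apply]
  have hT : Tendsto (fun n => ((S n).memLp_integral hW k).toLp) atTop (𝓝 (h0.toLp X)) :=
    (Lp.tendsto_Lp_iff_tendsto_eLpNorm'' _ _ _ _).2 h2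
  have hT' : Tendsto (fun n => ((S' n).memLp_integral hW l).toLp) atTop (𝓝 (h0'.toLp Y)) :=
    (Lp.tendsto_Lp_iff_tendsto_eLpNorm'' _ _ _ _).2 h2'
  have hlim := hT'.inner hT (𝕜 := ℂ)
  simp only [hinner, StepFn.integral_mul_conj hW, hkl, if_false] at hlim
  exact tendsto_nhds_unique hlim tendsto_const_nhds

lemma coordProcess_re_im_mem_span (hW : IsCylindricalBM P W) (k : ℤ) (t : ℝ≥0) (c : ℂ) :
    (fun ω => (c * W k t ω).re) ∈ Submodule.span ℝ (Set.range (coordProcess W)) ∧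
    (fun ω => (c * W k t ω).im) ∈ Submodule.span ℝ (Set.range (coordProcess W)) := by
  have hB : ∀ p, coordProcess W p ∈ Submodule.span ℝ (Set.range (coordProcess W)) := fun p =>
    Submodule.subset_span ⟨p, rfl⟩
  constructor
  · have : (fun ω => (c * W k t ω).re) = (c * coordRe k).re • coordProcess W (|k|, t) +
        (c * coordIm k).re • coordProcess W (-|k|, t) := by
      ext ω
      rw [hW.eq_coord, mul_add, ← mul_assoc, ← mul_assoc, Complex.add_re, Complex.re_mul_ofReal,
        Complex.re_mul_ofReal]
      rfl
    rw [this]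
    exact Submodule.add_mem _ (Submodule.smul_mem _ _ (hB _)) (Submodule.smul_mem _ _ (hB _))
  · have : (fun ω => (c * W k t ω).im) = (c * coordRe k).im • coordProcess W (|k|, t) +
        (c * coordIm k).im • coordProcess W (-|k|, t) := by
      ext ω
      rw [hW.eq_coord, mul_add, ← mul_assoc, ← mul_assoc, Complex.add_im, Complex.im_mul_ofReal,
        Complex.im_mul_ofReal]
      rfl
    rw [this]
    exact Submodule.add_mem _ (Submodule.smul_mem _ _ (hB _)) (Submodule.smul_mem _ _ (hB _))

lemma StepFn.integral_mem_span (hW : IsCylindricalBM P W) (S : StepFn) (k : ℤ) :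
    (fun ω => (S.integral (W k) ω).re) ∈ Submodule.span ℝ (Set.range (coordProcess W)) ∧
    (fun ω => (S.integral (W k) ω).im) ∈ Submodule.span ℝ (Set.range (coordProcess W)) := by
  have hre : (fun ω => (S.integral (W k) ω).re) = ∑ i, ((fun ω =>
      (S.coef i * W k (S.right i) ω).re) - fun ω => (S.coef i * W k (S.left i) ω).re) := by
    ext ω
    simp only [StepFn.integral, Complex.re_sum, Finset.sum_apply, Pi.sub_apply, mul_sub,
      Complex.sub_re]
  have him : (fun ω => (S.integral (W k) ω).im) = ∑ i, ((fun ω =>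
      (S.coef i * W k (S.right i) ω).im) - fun ω => (S.coef i * W k (S.left i) ω).im) := by
    ext ω
    simp only [StepFn.integral, Complex.im_sum, Finset.sum_apply, Pi.sub_apply, mul_sub,
      Complex.sub_im]
  rw [hre, him]
  exact ⟨Submodule.sum_mem _ fun i _ => Submodule.sub_mem _
    (coordProcess_re_im_mem_span hW _ _ _).1 (coordProcess_re_im_mem_span hW _ _ _).1,
    Submodule.sum_mem _ fun i _ => Submodule.sub_mem _
    (coordProcess_re_im_mem_span hW _ _ _).2 (coordProcess_re_im_mem_span hW _ _ _).2⟩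

lemma IsItoIntegral.isComplexGaussian (hW : IsCylindricalBM P W) {k : ℤ} {t : ℝ≥0} {f : ℝ → ℂ}
    {X : Ω → ℂ} (hX : IsItoIntegral P (W k) t f X) : IsComplexGaussian P (coordProcess W) X := by
  obtain ⟨h0, S, hS, h1, h2⟩ := hX
  refine ⟨⟨h0.re, fun n ω => ((S n).integral (W k) ω).re, fun n =>
    ⟨((S n).memLp_integral hW k).re, ((S n).integral_mem_span hW k).1⟩, ?_⟩,
    ⟨h0.im, fun n ω => ((S n).integral (W k) ω).im, fun n =>
    ⟨((S n).memLp_integral hW k).im, ((S n).integral_mem_span hW k).2⟩, ?_⟩⟩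
  · refine tendsto_of_tendsto_of_tendsto_of_le_of_le tendsto_const_nhds h2
      (fun _ => zero_le) fun n => eLpNorm_mono fun ω => ?_
    rw [← Complex.sub_re, Real.norm_eq_abs]
    exact Complex.abs_re_le_norm _
  · refine tendsto_of_tendsto_of_tendsto_of_le_of_le tendsto_const_nhds h2
      (fun _ => zero_le) fun n => eLpNorm_mono fun ω => ?_
    rw [← Complex.sub_im, Real.norm_eq_abs]
    exact Complex.abs_im_le_norm _

end Wiener

/-! ### The Ornstein–Uhlenbeck process -/

lemma lintegral_exp_Ioc {c u v : ℝ} (hc : 0 < c) (h : u ≤ v) :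
    ∫⁻ r in Set.Ioc u v, ENNReal.ofReal (Real.exp (-c * (v - r))) =
      ENNReal.ofReal ((1 - Real.exp (-c * (v - u))) / c) := by
  have hd : ∀ r ∈ Set.uIcc u v, HasDerivAt (fun r => Real.exp (-c * (v - r)) / c)
      (Real.exp (-c * (v - r))) r := fun r _ => by
    have h1 : HasDerivAt (fun r => -c * (v - r)) c r := by
      have := ((hasDerivAt_id r).const_sub v).const_mul (-c)
      simpa using this
    have := h1.exp.div_const c
    rwa [mul_div_assoc, div_self hc.ne', mul_one] at this
  have hcont : Continuous fun r => Real.exp (-c * (v - r)) := by fun_prop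
  have hI := intervalIntegral.integral_eq_sub_of_hasDerivAt hd (hcont.intervalIntegrable _ _)
  rw [intervalIntegral.integral_of_le h] at hI
  rw [← ofReal_integral_eq_lintegral_ofReal (hcont.integrableOn_Ioc) (ae_of_all _ fun r =>
    (Real.exp_pos _).le), hI]
  congr 1
  simp
  ring

/-- Interpolation between the bounds `1` and `x`. With `x = k²(t - s)` it trades regularity in time
for powers of the frequency. -/
lemma one_sub_exp_neg_le_rpow {x κ : ℝ} (hx : 0 ≤ x) (hκ : 0 ≤ κ) (hκ1 : κ ≤ 1) :
    1 - Real.exp (-x) ≤ x ^ κ := by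
  rcases hx.eq_or_lt with rfl | hx
  · simpa using Real.zero_rpow_nonneg κ
  rcases le_total x 1 with h | h
  · have h1 := Real.add_one_le_exp (-x)
    have h2 := Real.rpow_le_rpow_of_exponent_ge hx h hκ1
    rw [Real.rpow_one] at h2
    linarith
  · have h1 := Real.one_le_rpow h hκ
    have h2 := Real.exp_pos (-x)
    linarith

/-- The integrand defining the `k`-th mode of the Ornstein–Uhlenbeck process at time `t`. -/
def ouKernel (q : ℤ → ℂ) (k : ℤ) (t : ℝ≥0) (s : ℝ) : ℂ :=
  (Real.exp (-((k : ℝ) ^ 2) * ((t : ℝ) - s)) : ℂ) * q k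

lemma measurable_ouKernel (q : ℤ → ℂ) (k : ℤ) (t : ℝ≥0) : Measurable (ouKernel q k t) := by
  unfold ouKernel
  exact Continuous.measurable (by fun_prop)

/-- On `(0, s]` the difference of kernels is the old kernel times `e^{-k²(t-s)} - 1`, by the
semigroup property; on `(s, t]` only the new kernel is left. Both integrals are explicit. -/
lemma lintegral_ouKernel_increment_le (q : ℤ → ℂ) {k : ℤ} (hk : k ≠ 0) {s t : ℝ≥0} (hst : s ≤ t)
    {κ : ℝ} (hκ : 0 ≤ κ) (hκ1 : κ ≤ 1) :
    ∫⁻ r in Set.Ioc 0 (t : ℝ),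
      ‖ouKernel q k t r - (Set.Ioc 0 (s : ℝ)).indicator (ouKernel q k s) r‖ₑ ^ 2 ≤
      ENNReal.ofReal (‖q k‖ ^ 2 * (2 / (k : ℝ) ^ 2) * ((k : ℝ) ^ 2 * (t - s)) ^ κ) := by
  have hst' : (s : ℝ) ≤ t := by exact_mod_cast hst
  set a : ℝ := (k : ℝ) ^ 2 with ha
  have ha0 : 0 < a := by positivity
  set x : ℝ := a * (t - s) with hx
  have hx0 : 0 ≤ x := mul_nonneg ha0.le (sub_nonneg.2 hst')
  have hxκ := one_sub_exp_neg_le_rpow hx0 hκ hκ1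
  have hy0 := Real.exp_pos (-x)
  have hy1 : Real.exp (-x) ≤ 1 := Real.exp_le_one_iff.2 (by linarith)
  set y : ℝ := Real.exp (-x) with hy
  have hsplit : Set.Ioc 0 (t : ℝ) = Set.Ioc 0 (s : ℝ) ∪ Set.Ioc (s : ℝ) t :=
    (Set.Ioc_union_Ioc_eq_Ioc s.coe_nonneg hst').symm
  have hdisj : Disjoint (Set.Ioc 0 (s : ℝ)) (Set.Ioc (s : ℝ) t) :=
    Set.disjoint_left.2 fun r h1 h2 => absurd h2.1 (not_lt.2 h1.2)
  rw [hsplit, lintegral_union measurableSet_Ioc hdisj]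
  have e1 : ∫⁻ r in Set.Ioc 0 (s : ℝ),
      ‖ouKernel q k t r - (Set.Ioc 0 (s : ℝ)).indicator (ouKernel q k s) r‖ₑ ^ 2 =
      ENNReal.ofReal (‖q k‖ ^ 2 * (1 - y) ^ 2) *
        ENNReal.ofReal ((1 - Real.exp (-(2 * a) * (s - 0))) / (2 * a)) := by
    rw [← lintegral_exp_Ioc (by positivity) s.coe_nonneg, ← lintegral_const_mul _ (by fun_prop)]
    refine setLIntegral_congr_fun measurableSet_Ioc fun r hr => ?_
    rw [Set.indicator_of_mem hr, ← ENNReal.ofReal_mul (by positivity), ouKernel, ouKernel,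
      ← sub_mul, ← ofReal_norm, ← ENNReal.ofReal_pow (norm_nonneg _), norm_mul,
      ← Complex.ofReal_sub, Complex.norm_real, Real.norm_eq_abs, mul_pow, sq_abs]
    congr 1
    have h1 : Real.exp (-a * (t - r)) = y * Real.exp (-a * (s - r)) := by
      rw [hy, ← Real.exp_add]; congr 1; rw [hx]; ring
    have h2 : Real.exp (-(2 * a) * (s - r)) = Real.exp (-a * (s - r)) ^ 2 := by
      rw [← Real.exp_nat_mul]; congr 1; push_cast; ring
    rw [h1, h2]
    ring
  have e2 : ∫⁻ r in Set.Ioc (s : ℝ) t,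
      ‖ouKernel q k t r - (Set.Ioc 0 (s : ℝ)).indicator (ouKernel q k s) r‖ₑ ^ 2 =
      ENNReal.ofReal (‖q k‖ ^ 2) *
        ENNReal.ofReal ((1 - Real.exp (-(2 * a) * (t - s))) / (2 * a)) := by
    rw [← lintegral_exp_Ioc (by positivity) hst', ← lintegral_const_mul _ (by fun_prop)]
    refine setLIntegral_congr_fun measurableSet_Ioc fun r hr => ?_
    rw [Set.indicator_of_notMem (fun h => absurd hr.1 (not_lt.2 h.2)), sub_zero,
      ← ENNReal.ofReal_mul (by positivity), ouKernel,
      ← ofReal_norm, ← ENNReal.ofReal_pow (norm_nonneg _), norm_mul,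
      Complex.norm_real, Real.norm_eq_abs, mul_pow, sq_abs]
    congr 1
    have h2 : Real.exp (-(2 * a) * (t - r)) = Real.exp (-a * (t - r)) ^ 2 := by
      rw [← Real.exp_nat_mul]; congr 1; push_cast; ring
    rw [h2]
    ring
  rw [e1, e2, ← ENNReal.ofReal_mul (by positivity), ← ENNReal.ofReal_mul (by positivity)]
  have h3 : Real.exp (-(2 * a) * (t - s)) = y ^ 2 := by
    rw [hy, ← Real.exp_nat_mul]; congr 1; push_cast; rw [hx]; ring
  have h4 : Real.exp (-(2 * a) * (s - 0)) ≤ 1 :=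
    Real.exp_le_one_iff.2 (by have := s.coe_nonneg; nlinarith)
  have h5 := Real.exp_pos (-(2 * a) * (s - 0))
  rw [h3, ← ENNReal.ofReal_add (by have : 0 ≤ 1 - Real.exp (-(2 * a) * (s - 0)) := by linarith
                                   positivity)
    (by have : 0 ≤ 1 - y ^ 2 := by nlinarith
        positivity)]
  refine ENNReal.ofReal_le_ofReal ?_
  -- The two pieces contribute at most `x^κ` and `2 x^κ`; their sum is rounded up to `4 x^κ`, and
  -- division by `2a` gives the constant `2 / k²`.
  have h6 : (1 - y) ^ 2 * (1 - Real.exp (-(2 * a) * (s - 0))) ≤ x ^ κ := by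
    have h7 : (1 - y) ^ 2 ≤ 1 - y := by nlinarith
    nlinarith [sq_nonneg (1 - y)]
  have h8 : 1 - y ^ 2 ≤ 2 * x ^ κ := by nlinarith
  have hq := sq_nonneg ‖q k‖
  have hxk : 0 ≤ x ^ κ := Real.rpow_nonneg hx0 κ
  calc ‖q k‖ ^ 2 * (1 - y) ^ 2 * ((1 - Real.exp (-(2 * a) * (s - 0))) / (2 * a)) +
        ‖q k‖ ^ 2 * ((1 - y ^ 2) / (2 * a)) = ‖q k‖ ^ 2 / (2 * a) *
        ((1 - y) ^ 2 * (1 - Real.exp (-(2 * a) * (s - 0))) + (1 - y ^ 2)) := by ring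
    _ ≤ ‖q k‖ ^ 2 / (2 * a) * (4 * x ^ κ) := by gcongr; linarith
    _ = _ := by field_simp; ring

section OU

variable {Ω : Type*} [MeasurableSpace Ω] {P : Measure Ω} [IsProbabilityMeasure P]
  {W : ℤ → ℝ≥0 → Ω → ℂ} {T : ℝ≥0} {q : ℤ → ℂ} {z : ℤ → ℝ≥0 → Ω → ℂ}

lemma lintegral_sq_eq_eLpNorm {α : Type*} [MeasurableSpace α] (μ : Measure α) (f : α → ℂ) :
    ∫⁻ x, ‖f x‖ₑ ^ 2 ∂μ = eLpNorm f 2 μ ^ 2 := by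
  rw [eLpNorm_eq_lintegral_rpow_enorm_toReal (by norm_num) (by norm_num), ← ENNReal.rpow_natCast,
    ← ENNReal.rpow_mul]
  simp

lemma IsOrnsteinUhlenbeck.lintegral_increment_le (hW : IsCylindricalBM P W)
    (hz : IsOrnsteinUhlenbeck P T q W z) {k : ℤ} (hk : k ≠ 0) {s t : ℝ≥0} (hst : s ≤ t)
    (ht : t ≤ T) {κ : ℝ} (hκ : 0 ≤ κ) (hκ1 : κ ≤ 1) :
    ∫⁻ ω, ‖z k t ω - z k s ω‖ₑ ^ 2 ∂P ≤
      ENNReal.ofReal (‖q k‖ ^ 2 * (2 / (k : ℝ) ^ 2) * ((k : ℝ) ^ 2 * (t - s)) ^ κ) := by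
  refine le_trans ?_ (lintegral_ouKernel_increment_le q hk hst hκ hκ1)
  rw [lintegral_sq_eq_eLpNorm, lintegral_sq_eq_eLpNorm]
  exact pow_le_pow_left' (IsItoIntegral.eLpNorm_increment_le hW hst (hz.eq_integral k t ht)
    (hz.eq_integral k s (hst.trans ht)) (measurable_ouKernel q k t) (measurable_ouKernel q k s)) 2

lemma IsOrnsteinUhlenbeck.lintegral_initial (hW : IsCylindricalBM P W)
    (hz : IsOrnsteinUhlenbeck P T q W z) (k : ℤ) : ∫⁻ ω, ‖z k 0 ω‖ₑ ^ 2 ∂P = 0 := by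
  have := (hz.eq_integral k 0 zero_le).eLpNorm_le hW (measurable_ouKernel q k 0).aestronglyMeasurable
  simp only [NNReal.coe_zero, Set.Ioc_self, Measure.restrict_empty, eLpNorm_measure_zero] at this
  rw [lintegral_sq_eq_eLpNorm, le_zero_iff.1 this]
  simp

/-- Chaining in time starts from this vanishing, and bounds at a fixed time follow from bounds on
increments. -/
lemma IsOrnsteinUhlenbeck.ae_initial (hW : IsCylindricalBM P W)
    (hz : IsOrnsteinUhlenbeck P T q W z) (k : ℤ) : ∀ᵐ ω ∂P, z k 0 ω = 0 := by
  have h := hz.lintegral_initial hW k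
  have hm := hz.measurable k 0 zero_le
  rw [lintegral_eq_zero_iff (by fun_prop)] at h
  filter_upwards [h] with ω hω
  simpa using hω

lemma IsOrnsteinUhlenbeck.lintegral_zero_mode (hW : IsCylindricalBM P W)
    (hz : IsOrnsteinUhlenbeck P T q W z) (hq : q 0 = 0) {t : ℝ≥0} (ht : t ≤ T) :
    ∫⁻ ω, ‖z 0 t ω‖ₑ ^ 2 ∂P = 0 := by
  have := (hz.eq_integral 0 t ht).eLpNorm_le hW (measurable_ouKernel q 0 t).aestronglyMeasurable
  simp only [hq, mul_zero, eLpNorm_zero'] at this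
  rw [lintegral_sq_eq_eLpNorm, le_zero_iff.1 this]
  simp

omit [IsProbabilityMeasure P] in
lemma IsOrnsteinUhlenbeck.isComplexGaussian (hW : IsCylindricalBM P W)
    (hz : IsOrnsteinUhlenbeck P T q W z) (k : ℤ) {t : ℝ≥0} (ht : t ≤ T) :
    IsComplexGaussian P (coordProcess W) (z k t) :=
  (hz.eq_integral k t ht).isComplexGaussian hW

omit [IsProbabilityMeasure P] in
lemma IsOrnsteinUhlenbeck.memLp (hz : IsOrnsteinUhlenbeck P T q W z) (k : ℤ) {t : ℝ≥0}
    (ht : t ≤ T) : MemLp (z k t) 2 P :=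
  (hz.eq_integral k t ht).1

lemma IsOrnsteinUhlenbeck.integral_mul_conj (hW : IsCylindricalBM P W)
    (hz : IsOrnsteinUhlenbeck P T q W z) {k l : ℤ} (hkl : k ≠ l) {s t : ℝ≥0} (hs : s ≤ T)
    (ht : t ≤ T) : ∫ ω, z k t ω * starRingEnd ℂ (z l s ω) ∂P = 0 :=
  (hz.eq_integral k t ht).integral_mul_conj_eq_zero hW hkl (hz.eq_integral l s hs)

lemma IsOrnsteinUhlenbeck.integral_increment_mul_conj (hW : IsCylindricalBM P W)
    (hz : IsOrnsteinUhlenbeck P T q W z) {k l : ℤ} (hkl : k ≠ l) {s t : ℝ≥0} (hs : s ≤ T)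
    (ht : t ≤ T) :
    ∫ ω, (z k t ω - z k s ω) * starRingEnd ℂ (z l t ω - z l s ω) ∂P = 0 := by
  have hI : ∀ {s t : ℝ≥0}, s ≤ T → t ≤ T →
      Integrable (fun ω => z k t ω * starRingEnd ℂ (z l s ω)) P := fun hs ht =>
    (hz.memLp k ht).integrable_mul (hz.memLp l hs).star
  have he : ∀ ω, (z k t ω - z k s ω) * starRingEnd ℂ (z l t ω - z l s ω) =
      (z k t ω * starRingEnd ℂ (z l t ω) - z k t ω * starRingEnd ℂ (z l s ω)) -
      (z k s ω * starRingEnd ℂ (z l t ω) - z k s ω * starRingEnd ℂ (z l s ω)) := fun ω => by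
    rw [map_sub]; ring
  have hI2 : ∀ {s : ℝ≥0}, s ≤ T → ∀ {t t' : ℝ≥0}, t ≤ T → t' ≤ T → Integrable (fun ω =>
      z k s ω * starRingEnd ℂ (z l t ω) - z k s ω * starRingEnd ℂ (z l t' ω)) P :=
    fun h1 _ _ h2 h3 => (hI h2 h1).sub (hI h3 h1)
  simp_rw [he]
  rw [integral_sub (hI2 ht ht hs) (hI2 hs ht hs), integral_sub (hI ht ht) (hI hs ht),
    integral_sub (hI ht hs) (hI hs hs)]
  simp only [hz.integral_mul_conj hW hkl ht ht, hz.integral_mul_conj hW hkl hs ht,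
    hz.integral_mul_conj hW hkl ht hs, hz.integral_mul_conj hW hkl hs hs, sub_zero]

end OU

/-! ### Trigonometric polynomials and Littlewood–Paley blocks -/

lemma integral_fourier_mul_fourier (k l : ℤ) :
    ∫ x : Torus, fourier (-k) x * fourier l x ∂AddCircle.haarAddCircle = if k = l then 1 else 0 := by
  have h := orthonormal_iff_ite.1 (orthonormal_fourier (T := 2 * Real.pi)) k l
  rw [ContinuousMap.inner_toLp (AddCircle.haarAddCircle) (fourier k) (fourier l)] at h
  rw [← h]
  refine integral_congr_ae (ae_of_all _ fun x => ?_)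
  simp only [fourier_neg]
  ring

lemma fourierCoeff_sum_fourier {ι : Type*} (s : Finset ι) (c : ι → ℂ) (n : ι → ℤ) (k : ℤ) :
    fourierCoeff (fun x : Torus => ∑ i ∈ s, c i * fourier (n i) x) k =
      ∑ i ∈ s, if n i = k then c i else 0 := by
  have hint : ∀ i, Integrable (fun x : Torus => fourier (-k) x * (c i * fourier (n i) x))
      AddCircle.haarAddCircle := fun i =>
    Continuous.integrable_of_hasCompactSupport (by fun_prop)
      (HasCompactSupport.of_compactSpace _)
  simp only [fourierCoeff, smul_eq_mul, Finset.mul_sum]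
  rw [integral_finsetSum _ fun i _ => hint i]
  refine Finset.sum_congr rfl fun i _ => ?_
  have : ∀ x : Torus, fourier (-k) x * (c i * fourier (n i) x) =
      c i * (fourier (-k) x * fourier (n i) x) := fun x => by ring
  simp_rw [this]
  rw [integral_const_mul, integral_fourier_mul_fourier]
  simp [eq_comm]

lemma norm_fourierCoeff_le (f : C(Torus, ℂ)) (k : ℤ) : ‖fourierCoeff f k‖ ≤ ‖f‖ := by
  unfold fourierCoeff
  refine (norm_integral_le_of_norm_le_const (C := ‖f‖) (ae_of_all _ fun x => ?_)).trans (by simp)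
  rw [norm_smul, fourier_apply, Circle.norm_coe, one_mul]
  exact f.norm_coe_le_norm x

lemma fourier_coe (k : ℤ) (x : ℝ) :
    fourier k (x : Torus) = Complex.exp (Complex.I * ((k * x : ℝ) : ℂ)) := by
  rw [fourier_coe_apply]
  congr 1
  have : (Real.pi : ℂ) ≠ 0 := by exact_mod_cast Real.pi_ne_zero
  push_cast
  field_simp

lemma norm_fourier_sub_le (k : ℤ) (x y : ℝ) :
    ‖(fourier k (x : Torus) : ℂ) - fourier k (y : Torus)‖ ≤ |(k : ℝ)| * |x - y| := by
  rw [fourier_coe, fourier_coe]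
  have h : Complex.exp (Complex.I * ((k * x : ℝ) : ℂ)) - Complex.exp (Complex.I * ((k * y : ℝ) : ℂ))
      = Complex.exp (Complex.I * ((k * y : ℝ) : ℂ)) *
        (Complex.exp (Complex.I * ((k * (x - y) : ℝ) : ℂ)) - 1) := by
    rw [mul_sub, ← Complex.exp_add, mul_one]
    congr 2
    push_cast
    ring
  rw [h, norm_mul, mul_comm Complex.I, Complex.norm_exp_ofReal_mul_I, one_mul]
  refine Real.norm_exp_I_mul_ofReal_sub_one_le.trans ?_
  rw [Real.norm_eq_abs, abs_mul]

/-- The points of a regular grid of the torus. -/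
def gridPoint (G i : ℕ) : Torus := ((2 * Real.pi * i / G : ℝ) : Torus)

/-- A trigonometric polynomial of degree at most `M` is controlled by its values on a grid of
`48 M²` points. -/
lemma exists_norm_le_two_mul_grid {M : ℕ} (hM : 1 ≤ M) (c : ℤ → ℂ) (f : C(Torus, ℂ))
    (hf : ∀ x, f x = ∑ k ∈ Finset.Icc (-(M : ℤ)) M, c k * fourier k x) :
    ∃ i < 48 * M ^ 2, ‖f‖ ≤ 2 * ‖f (gridPoint (48 * M ^ 2) i)‖ := by
  set G : ℕ := 48 * M ^ 2 with hG
  have hM' : (1 : ℝ) ≤ M := by exact_mod_cast hM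
  have hG0 : 0 < G := by positivity
  have hGr : (G : ℝ) = 48 * (M : ℝ) ^ 2 := by rw [hG]; push_cast; ring
  have hGr0 : (0 : ℝ) < G := by exact_mod_cast hG0
  obtain ⟨i, hi, hmax⟩ := Finset.exists_max_image (Finset.range G)
    (fun i => ‖f (gridPoint G i)‖) ⟨0, by simpa using hG0⟩
  refine ⟨i, Finset.mem_range.1 hi, ?_⟩
  have hc : ∀ k ∈ Finset.Icc (-(M : ℤ)) M, ‖c k‖ ≤ ‖f‖ := fun k hk => by
    have h1 := norm_fourierCoeff_le f k
    rw [show (f : Torus → ℂ) = fun x => ∑ k ∈ Finset.Icc (-(M : ℤ)) M, c k * fourier k x from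
      funext hf, fourierCoeff_sum_fourier _ c (fun k => k)] at h1
    simpa [Finset.sum_ite_eq', hk, -Finset.mem_Icc] using h1
  -- A crude Bernstein inequality: `2M + 1` coefficients, each at most `‖f‖`, with frequencies at
  -- most `M`. On a mesh of size `2π/(48M²)` the oscillation is `(π/8)‖f‖ ≤ ‖f‖/2`, which is
  -- absorbed on the left.
  have hlip : ∀ x y : ℝ, ‖f (x : Torus) - f (y : Torus)‖ ≤ 3 * M ^ 2 * ‖f‖ * |x - y| := by
    intro x y
    rw [hf, hf, ← Finset.sum_sub_distrib]
    calc _ ≤ ∑ k ∈ Finset.Icc (-(M : ℤ)) M,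
          ‖c k * fourier k (x : Torus) - c k * fourier k (y : Torus)‖ := norm_sum_le _ _
      _ ≤ ∑ k ∈ Finset.Icc (-(M : ℤ)) M, ‖f‖ * (M * |x - y|) := by
          refine Finset.sum_le_sum fun k hk => ?_
          rw [← mul_sub, norm_mul]
          refine mul_le_mul (hc k hk) ((norm_fourier_sub_le k x y).trans ?_) (norm_nonneg _)
            (norm_nonneg _)
          gcongr
          rw [Finset.mem_Icc] at hk
          rw [abs_le]
          exact ⟨by exact_mod_cast hk.1, by exact_mod_cast hk.2⟩
      _ = (2 * M + 1) * (‖f‖ * (M * |x - y|)) := by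
          rw [Finset.sum_const, nsmul_eq_mul, Int.card_Icc]
          congr 1
          rw [show ((M : ℤ) + 1 - -(M : ℤ)).toNat = 2 * M + 1 by lia]
          push_cast
          ring
      _ ≤ _ := by
          have h1 : 0 ≤ ‖f‖ * |x - y| := by positivity
          calc (2 * M + 1) * (‖f‖ * (M * |x - y|)) = (2 * M + 1) * M * (‖f‖ * |x - y|) := by ring
            _ ≤ 3 * M ^ 2 * (‖f‖ * |x - y|) := mul_le_mul_of_nonneg_right (by nlinarith) h1
            _ = _ := by ring
  have hpt : ∀ x : Torus, ‖f x‖ ≤ ‖f (gridPoint G i)‖ + ‖f‖ / 2 := by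
    intro x
    obtain ⟨y, hy, rfl⟩ : ∃ y ∈ Set.Ico (0 : ℝ) (0 + 2 * Real.pi), (y : Torus) = x := by
      have := AddCircle.coe_image_Ico_eq (2 * Real.pi) 0
      have hx : x ∈ (Set.univ : Set Torus) := Set.mem_univ x
      rw [← this] at hx
      exact hx
    rw [zero_add] at hy
    have hpi := Real.pi_pos
    set j : ℕ := ⌊y * G / (2 * Real.pi)⌋₊ with hj
    have hj0 : 0 ≤ y * G / (2 * Real.pi) := by have := hy.1; positivity
    have hj1 : (j : ℝ) ≤ y * G / (2 * Real.pi) := Nat.floor_le hj0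
    have hj2 : y * G / (2 * Real.pi) < j + 1 := Nat.lt_floor_add_one _
    rw [le_div_iff₀ (by positivity)] at hj1
    rw [div_lt_iff₀ (by positivity)] at hj2
    have hjG : j < G := by
      have : (j : ℝ) < G := by
        by_contra hcon
        push Not at hcon
        have := hy.2
        nlinarith
      exact_mod_cast this
    have hdist : |y - 2 * Real.pi * j / G| ≤ 2 * Real.pi / G := by
      rw [abs_le]
      constructor
      · have : 2 * Real.pi * j / G ≤ y := by
          rw [div_le_iff₀ hGr0]; linarith
        have : 0 ≤ 2 * Real.pi / G := by positivity
        linarith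
      · have : y ≤ 2 * Real.pi * (j + 1) / G := by
          rw [le_div_iff₀ hGr0]; linarith
        have h0 : 2 * Real.pi * (j + 1) / G = 2 * Real.pi * j / G + 2 * Real.pi / G := by ring
        linarith
    have h1 := hlip y (2 * Real.pi * j / G)
    have h2 : 3 * M ^ 2 * ‖f‖ * |y - 2 * Real.pi * j / G| ≤ ‖f‖ / 2 := by
      calc _ ≤ 3 * M ^ 2 * ‖f‖ * (2 * Real.pi / G) := by gcongr
        _ = ‖f‖ * (Real.pi / 8) := by rw [hGr]; field_simp; ring
        _ ≤ ‖f‖ * (4 / 8) := by gcongr; exact Real.pi_le_four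
        _ = _ := by ring
    have h3 := hmax j (Finset.mem_range.2 hjG)
    have h4 := norm_sub_norm_le (f (y : Torus)) (f (gridPoint G j))
    have h5 : ‖f (y : Torus) - f (gridPoint G j)‖ ≤ ‖f‖ / 2 := h1.trans h2
    linarith
  have := (ContinuousMap.norm_le f (by positivity)).2 hpt
  linarith

lemma enorm_pow_le_sum_grid {M : ℕ} (hM : 1 ≤ M) (c : ℤ → ℂ) (f : C(Torus, ℂ))
    (hf : ∀ x, f x = ∑ k ∈ Finset.Icc (-(M : ℤ)) M, c k * fourier k x) (p : ℕ) :
    ‖f‖ₑ ^ p ≤ 2 ^ p * ∑ i ∈ Finset.range (48 * M ^ 2), ‖f (gridPoint (48 * M ^ 2) i)‖ₑ ^ p := by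
  obtain ⟨i, hi, h⟩ := exists_norm_le_two_mul_grid hM c f hf
  have h2 : ‖f‖ₑ ≤ 2 * ‖f (gridPoint (48 * M ^ 2) i)‖ₑ := by
    have := ENNReal.ofReal_le_ofReal h
    rwa [ENNReal.ofReal_mul (by norm_num), ofReal_norm, ofReal_norm, ENNReal.ofReal_ofNat] at this
  calc ‖f‖ₑ ^ p ≤ (2 * ‖f (gridPoint (48 * M ^ 2) i)‖ₑ) ^ p := by gcongr
    _ = 2 ^ p * ‖f (gridPoint (48 * M ^ 2) i)‖ₑ ^ p := mul_pow _ _ _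
    _ ≤ _ := by
      gcongr
      exact Finset.single_le_sum (f := fun i => ‖f (gridPoint (48 * M ^ 2) i)‖ₑ ^ p)
        (fun _ _ => zero_le) (Finset.mem_range.2 hi)

lemma mode_sub (u v : TorusDistribution) (k : ℤ) : mode (u - v) k = mode u k - mode v k := rfl

lemma mode_add (u v : TorusDistribution) (k : ℤ) : mode (u + v) k = mode u k + mode v k := rfl

lemma mode_zero (k : ℤ) : mode 0 k = 0 := rfl

lemma ext_mode {u v : TorusDistribution} (h : ∀ k, mode u k = mode v k) : u = v :=
  Subtype.ext (funext h)

/-! ### Littlewood–Paley blocks and the Besov norm -/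

section Dyadic

variable {χ φ : ℝ → ℝ} (hχφ : IsDyadicPartition χ φ)
include hχφ

lemma IsDyadicPartition.exists_le_two_pow :
    ∃ R : ℕ, 1 ≤ R ∧ ∀ n ξ, lpSymbol χ φ n ξ ≠ 0 → |ξ| ≤ R * 2 ^ n := by
  obtain ⟨R₁, hR₁, h1⟩ := hχφ.supp_low
  obtain ⟨r, R₂, hr, hrR, h2⟩ := hχφ.supp_high
  refine ⟨⌈R₁ + R₂⌉₊, Nat.one_le_ceil_iff.2 (by linarith), fun n ξ h => ?_⟩
  have hle := Nat.le_ceil (R₁ + R₂)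
  rcases n with _ | n
  · have := h1 (subset_tsupport _ h)
    simp only [Set.mem_ofPred_eq] at this
    simp
    linarith
  · have := (h2 (subset_tsupport _ h)).2
    rw [abs_div, abs_of_pos (by positivity : (0 : ℝ) < 2 ^ n), div_le_iff₀ (by positivity)] at this
    have h2n : (0 : ℝ) < 2 ^ n := by positivity
    rw [pow_succ]
    nlinarith

/-- The form `1 + |ξ|` covers the low-frequency block, whose symbol may be nonzero at the origin.
The factor `r / 2` comes from the index shift: index `n + 1` carries the scale `2^n`. -/
lemma IsDyadicPartition.exists_two_pow_le :
    ∃ c : ℝ, 0 < c ∧ ∀ n ξ, lpSymbol χ φ n ξ ≠ 0 → c * 2 ^ n ≤ 1 + |ξ| := by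
  obtain ⟨r, R₂, hr, hrR, h2⟩ := hχφ.supp_high
  refine ⟨min 1 (r / 2), by positivity, fun n ξ h => ?_⟩
  rcases n with _ | n
  · have := min_le_left 1 (r / 2)
    have := abs_nonneg ξ
    rw [pow_zero, mul_one]
    linarith
  · have := (h2 (subset_tsupport _ h)).1
    have h2n : (0 : ℝ) < 2 ^ n := by positivity
    rw [abs_div, abs_of_pos h2n, le_div_iff₀ h2n] at this
    calc min 1 (r / 2) * 2 ^ (n + 1) ≤ r / 2 * 2 ^ (n + 1) := by
          gcongr; exact min_le_right _ _
      _ = r * 2 ^ n := by rw [pow_succ]; ring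
      _ ≤ _ := by linarith

lemma IsDyadicPartition.lpSymbol_mem (n : ℕ) (ξ : ℝ) :
    0 ≤ lpSymbol χ φ n ξ ∧ lpSymbol χ φ n ξ ≤ 1 := by
  rcases n with _ | n
  · exact hχφ.range_low ξ
  · exact hχφ.range_high _

lemma IsDyadicPartition.hasSum_lpSymbol (ξ : ℝ) : HasSum (fun n => lpSymbol χ φ n ξ) 1 := by
  have := (hasSum_nat_add_iff (f := fun n => lpSymbol χ φ n ξ) 1).1
    (show HasSum (fun n => lpSymbol χ φ (n + 1) ξ) (1 - χ ξ) from hχφ.sum_eq_one ξ)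
  simpa [lpSymbol] using this

omit hχφ in
lemma lpBlock_eq_sum (n : ℕ) (u : TorusDistribution) {s : Finset ℤ}
    (hs : ∀ k : ℤ, lpSymbol χ φ n k ≠ 0 → mode u k ≠ 0 → k ∈ s) :
    lpBlock χ φ n u = ∑ k ∈ s, ((lpSymbol χ φ n (k : ℝ) : ℂ) * mode u k) • fourier k := by
  refine finsum_eq_sum_of_support_subset _ fun k hk => ?_
  rw [Function.mem_support] at hk
  refine hs k (fun h => hk ?_) (fun h => hk ?_)
  · simp [h]
  · simp [h]

lemma IsDyadicPartition.exists_finset (n : ℕ) :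
    ∃ M : ℕ, 1 ≤ M ∧ ∀ k : ℤ, lpSymbol χ φ n k ≠ 0 → k ∈ Finset.Icc (-(M : ℤ)) M := by
  obtain ⟨R, hR, h⟩ := hχφ.exists_le_two_pow
  refine ⟨R * 2 ^ n, Nat.one_le_iff_ne_zero.2 (by positivity), fun k hk => ?_⟩
  have := h n k hk
  rw [Finset.mem_Icc, ← abs_le]
  exact_mod_cast this

lemma IsDyadicPartition.lpBlock_add (n : ℕ) (u v : TorusDistribution) :
    lpBlock χ φ n (u + v) = lpBlock χ φ n u + lpBlock χ φ n v := by
  obtain ⟨M, -, hM⟩ := hχφ.exists_finset n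
  rw [lpBlock_eq_sum n _ fun k hk _ => hM k hk, lpBlock_eq_sum n _ fun k hk _ => hM k hk,
    lpBlock_eq_sum n _ fun k hk _ => hM k hk, ← Finset.sum_add_distrib]
  refine Finset.sum_congr rfl fun k _ => ?_
  rw [mode_add, mul_add, add_smul]

lemma IsDyadicPartition.lpBlock_sub (n : ℕ) (u v : TorusDistribution) :
    lpBlock χ φ n (u - v) = lpBlock χ φ n u - lpBlock χ φ n v := by
  rw [eq_sub_iff_add_eq, ← hχφ.lpBlock_add, sub_add_cancel]

lemma IsDyadicPartition.tendsto_lpBlock {ι : Type*} {l : Filter ι} (n : ℕ)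
    {u : ι → TorusDistribution} {v : TorusDistribution}
    (h : ∀ k, Tendsto (fun i => mode (u i) k) l (𝓝 (mode v k))) :
    Tendsto (fun i => lpBlock χ φ n (u i)) l (𝓝 (lpBlock χ φ n v)) := by
  obtain ⟨M, -, hM⟩ := hχφ.exists_finset n
  simp_rw [fun i => lpBlock_eq_sum n (u i) fun k hk _ => hM k hk,
    lpBlock_eq_sum n v fun k hk _ => hM k hk]
  exact tendsto_finsetSum _ fun k _ => ((h k).const_mul _).smul_const _

lemma IsDyadicPartition.besovNorm_add_le (β : ℝ) (u v : TorusDistribution) :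
    besovNorm χ φ β (u + v) ≤ besovNorm χ φ β u + besovNorm χ φ β v := by
  refine iSup_le fun n => ?_
  rw [hχφ.lpBlock_add]
  refine (mul_le_mul_right (enorm_add_le _ _) _).trans ?_
  rw [mul_add]
  exact add_le_add (le_iSup (fun n : ℕ => ENNReal.ofReal ((2 : ℝ) ^ (((n : ℝ) - 1) * β)) *
    ‖lpBlock χ φ n u‖ₑ) n) (le_iSup (fun n : ℕ => ENNReal.ofReal ((2 : ℝ) ^ (((n : ℝ) - 1) * β)) *
    ‖lpBlock χ φ n v‖ₑ) n)

lemma IsDyadicPartition.besovNorm_sub_comm (β : ℝ) (u v : TorusDistribution) :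
    besovNorm χ φ β (u - v) = besovNorm χ φ β (v - u) := by
  unfold besovNorm
  simp_rw [hχφ.lpBlock_sub, enorm_sub_rev]

lemma IsDyadicPartition.besovNorm_sub_le (β : ℝ) (u v w : TorusDistribution) :
    besovNorm χ φ β (u - w) ≤ besovNorm χ φ β (u - v) + besovNorm χ φ β (v - w) := by
  rw [← sub_add_sub_cancel u v w]
  exact hχφ.besovNorm_add_le β _ _

/-- Lower semicontinuity of the Besov norm for the convergence of the modes. -/
lemma IsDyadicPartition.besovNorm_le_liminf {ι : Type*} {l : Filter ι} [l.NeBot] (β : ℝ)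
    {u : ι → TorusDistribution} {v : TorusDistribution}
    (h : ∀ k, Tendsto (fun i => mode (u i) k) l (𝓝 (mode v k))) :
    besovNorm χ φ β v ≤ liminf (fun i => besovNorm χ φ β (u i)) l := by
  refine iSup_le fun n => ?_
  have h1 : Tendsto (fun i => ENNReal.ofReal ((2 : ℝ) ^ (((n : ℝ) - 1) * β)) *
      ‖lpBlock χ φ n (u i)‖ₑ) l (𝓝 (ENNReal.ofReal ((2 : ℝ) ^ (((n : ℝ) - 1) * β)) *
      ‖lpBlock χ φ n v‖ₑ)) :=
    ENNReal.Tendsto.const_mul (hχφ.tendsto_lpBlock n h).enorm (Or.inr ENNReal.ofReal_ne_top)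
  rw [← h1.liminf_eq]
  exact liminf_le_liminf (Eventually.of_forall fun i => le_iSup (fun n : ℕ =>
    ENNReal.ofReal ((2 : ℝ) ^ (((n : ℝ) - 1) * β)) * ‖lpBlock χ φ n (u i)‖ₑ) n)

lemma IsDyadicPartition.enorm_mode_le_lpBlock (n : ℕ) (u : TorusDistribution) (k : ℤ) :
    ENNReal.ofReal (lpSymbol χ φ n k) * ‖mode u k‖ₑ ≤ ‖lpBlock χ φ n u‖ₑ := by
  by_cases hk : lpSymbol χ φ n (k : ℝ) = 0
  · simp [hk]
  obtain ⟨M, -, hM⟩ := hχφ.exists_finset n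
  have h1 := norm_fourierCoeff_le (lpBlock χ φ n u) k
  have h2 : (lpBlock χ φ n u : Torus → ℂ) = fun x => ∑ k ∈ Finset.Icc (-(M : ℤ)) M,
      ((lpSymbol χ φ n (k : ℝ) : ℂ) * mode u k) * fourier k x := by
    ext x
    rw [lpBlock_eq_sum n u fun k hk _ => hM k hk]
    simp
  rw [h2, fourierCoeff_sum_fourier _ _ (fun k => k), Finset.sum_ite_eq', if_pos (hM k hk),
    norm_mul, Complex.norm_real, Real.norm_eq_abs, abs_of_nonneg (hχφ.lpSymbol_mem n k).1] at h1
  have := ENNReal.ofReal_le_ofReal h1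
  rwa [ENNReal.ofReal_mul (hχφ.lpSymbol_mem n k).1, ofReal_norm, ofReal_norm] at this

/-- The modes of an element of `B^{-1}_{∞,∞}` grow at most polynomially. -/
lemma IsDyadicPartition.exists_enorm_mode_le :
    ∃ C : ℝ, 0 ≤ C ∧ ∀ (u : TorusDistribution) (k : ℤ),
      ‖mode u k‖ₑ ≤ ENNReal.ofReal (C * (1 + |(k : ℝ)|) ^ 2) * besovNorm χ φ (-1) u := by
  obtain ⟨c, hc, h⟩ := hχφ.exists_two_pow_le
  refine ⟨(c⁻¹) ^ 2, by positivity, fun u k => ?_⟩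
  -- The symbols sum to one, so summing over `n` recovers the mode. One factor `1 + |k|` pays for
  -- the weight `2^{n-1}` of the norm; the second one buys the geometric factor `2^{-n}`, so the
  -- blocks that see `k` need not be counted.
  have hterm : ∀ n, ENNReal.ofReal (lpSymbol χ φ n k) * ‖mode u k‖ₑ ≤
      ENNReal.ofReal ((1 / 2) / 2 ^ n) *
        (ENNReal.ofReal ((c⁻¹) ^ 2 * (1 + |(k : ℝ)|) ^ 2) * besovNorm χ φ (-1) u) := fun n => by
    by_cases hk : lpSymbol χ φ n (k : ℝ) = 0
    · simp [hk]
    refine (hχφ.enorm_mode_le_lpBlock n u k).trans ?_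
    have h1 := le_iSup (fun n : ℕ => ENNReal.ofReal ((2 : ℝ) ^ (((n : ℝ) - 1) * (-1))) *
      ‖lpBlock χ φ n u‖ₑ) n
    have h2 : ENNReal.ofReal ((2 : ℝ) ^ ((n : ℝ) - 1)) *
        ENNReal.ofReal ((2 : ℝ) ^ (((n : ℝ) - 1) * (-1))) = 1 := by
      rw [← ENNReal.ofReal_mul (by positivity), ← Real.rpow_add (by norm_num)]
      simp
    have h3 : (2 : ℝ) ^ ((n : ℝ) - 1) ≤ (1 / 2) / 2 ^ n * ((c⁻¹) ^ 2 * (1 + |(k : ℝ)|) ^ 2) := by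
      rw [Real.rpow_sub (by norm_num), Real.rpow_natCast, Real.rpow_one]
      have h4 : 2 ^ n ≤ c⁻¹ * (1 + |(k : ℝ)|) := by
        rw [inv_mul_eq_div, le_div_iff₀ hc, mul_comm]
        exact h n k hk
      have h5 : (2 ^ n : ℝ) ^ 2 ≤ (c⁻¹) ^ 2 * (1 + |(k : ℝ)|) ^ 2 := by
        rw [← mul_pow]; gcongr
      calc (2 : ℝ) ^ n / 2 = (1 / 2) / 2 ^ n * (2 ^ n) ^ 2 := by field_simp
        _ ≤ _ := by gcongr
    calc ‖lpBlock χ φ n u‖ₑ = ENNReal.ofReal ((2 : ℝ) ^ ((n : ℝ) - 1)) *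
          (ENNReal.ofReal ((2 : ℝ) ^ (((n : ℝ) - 1) * (-1))) * ‖lpBlock χ φ n u‖ₑ) := by
          rw [← mul_assoc, h2, one_mul]
      _ ≤ ENNReal.ofReal ((1 / 2) / 2 ^ n * ((c⁻¹) ^ 2 * (1 + |(k : ℝ)|) ^ 2)) *
          besovNorm χ φ (-1) u := mul_le_mul' (ENNReal.ofReal_le_ofReal h3) h1
      _ = _ := by rw [ENNReal.ofReal_mul (by positivity), mul_assoc]
  have hs := ENNReal.tsum_le_tsum hterm
  rw [ENNReal.tsum_mul_right, ENNReal.tsum_mul_right,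
    ← ENNReal.ofReal_tsum_of_nonneg (fun n => (hχφ.lpSymbol_mem n k).1)
      (hχφ.hasSum_lpSymbol k).summable, (hχφ.hasSum_lpSymbol k).tsum_eq,
    ← ENNReal.ofReal_tsum_of_nonneg (fun n => by positivity) (hasSum_geometric_two' 1).summable,
    (hasSum_geometric_two' 1).tsum_eq] at hs
  simpa using hs

end Dyadic

/-! ### Trigonometric polynomials and uniform limits in time -/

section Trigonometric

/-- The distribution is a trigonometric polynomial of degree at most `N`. -/
def IsTrigPoly (N : ℕ) (u : TorusDistribution) : Prop :=
  ∀ k : ℤ, k ∉ Finset.Icc (-(N : ℤ)) N → mode u k = 0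

lemma IsTrigPoly.sub {N : ℕ} {u v : TorusDistribution} (hu : IsTrigPoly N u)
    (hv : IsTrigPoly N v) : IsTrigPoly N (u - v) := fun k hk => by
  rw [mode_sub, hu k hk, hv k hk, sub_zero]

lemma IsTrigPoly.isSmoothDistribution {N : ℕ} {u : TorusDistribution} (hu : IsTrigPoly N u) :
    IsSmoothDistribution u := by
  refine ⟨fun x => ∑ k ∈ Finset.Icc (-(N : ℤ)) N, mode u k * fourier k x, ?_, ext_mode fun k => ?_⟩
  · simp_rw [fourier_coe]
    have h : ContDiff ℝ (⊤ : ℕ∞) (fun x : ℝ => (x : ℂ)) := Complex.ofRealCLM.contDiff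
    refine ContDiff.sum fun k _ => contDiff_const.mul (ContDiff.cexp (contDiff_const.mul ?_))
    push_cast
    exact contDiff_const.mul h
  · change mode u k = fourierCoeff _ k
    rw [fourierCoeff_sum_fourier _ _ fun k => k, Finset.sum_ite_eq']
    split_ifs with h
    · rfl
    · exact hu k h

lemma enorm_sum_smul_fourier_le (s : Finset ℤ) (c : ℤ → ℂ) :
    ‖∑ k ∈ s, c k • (fourier k : C(Torus, ℂ))‖ₑ ≤ ∑ k ∈ s, ‖c k‖ₑ := by
  refine (enorm_sum_le _ _).trans (le_of_eq (Finset.sum_congr rfl fun k _ => ?_))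
  rw [enorm_smul, ← ofReal_norm (fourier k), fourier_norm, ENNReal.ofReal_one, mul_one]

variable {χ φ : ℝ → ℝ} (hχφ : IsDyadicPartition χ φ)
include hχφ

/-- Blocks with `2^n > (1 + N)/c` do not meet frequencies up to `N`, so for fixed degree the Besov
norm is controlled by finitely many modes. This turns continuity of modes into continuity in norm.
-/
lemma IsDyadicPartition.exists_besovNorm_le (β : ℝ) (N : ℕ) :
    ∃ D : ℝ≥0∞, D ≠ ∞ ∧ ∀ u, IsTrigPoly N u →
      besovNorm χ φ β u ≤ D * ∑ k ∈ Finset.Icc (-(N : ℤ)) N, ‖mode u k‖ₑ := by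
  obtain ⟨c, hc, h⟩ := hχφ.exists_two_pow_le
  obtain ⟨n₀, hn₀⟩ := pow_unbounded_of_one_lt ((1 + N) / c) (one_lt_two (α := ℝ))
  refine ⟨∑ n ∈ Finset.range n₀, ENNReal.ofReal ((2 : ℝ) ^ (((n : ℝ) - 1) * β)),
    (ENNReal.sum_lt_top.2 fun n _ => ENNReal.ofReal_lt_top).ne, fun u hu => iSup_le fun n => ?_⟩
  have hblock : lpBlock χ φ n u = ∑ k ∈ Finset.Icc (-(N : ℤ)) N,
      ((lpSymbol χ φ n (k : ℝ) : ℂ) * mode u k) • fourier k :=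
    lpBlock_eq_sum n u fun k _ hk => by_contra fun h => hk (hu k h)
  rcases lt_or_ge n n₀ with hn | hn
  · refine mul_le_mul' (Finset.single_le_sum (f := fun n : ℕ =>
      ENNReal.ofReal ((2 : ℝ) ^ (((n : ℝ) - 1) * β))) (fun _ _ => zero_le)
      (Finset.mem_range.2 hn)) ?_
    rw [hblock]
    refine (enorm_sum_smul_fourier_le _ _).trans (Finset.sum_le_sum fun k _ => ?_)
    rw [enorm_mul]
    refine mul_le_of_le_one_left' ?_
    rw [← ofReal_norm, Complex.norm_real, Real.norm_eq_abs,
      abs_of_nonneg (hχφ.lpSymbol_mem n k).1]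
    exact ENNReal.ofReal_le_one.2 (hχφ.lpSymbol_mem n k).2
  · have : lpBlock χ φ n u = 0 := by
      rw [hblock]
      refine Finset.sum_eq_zero fun k hk => ?_
      have hz : lpSymbol χ φ n (k : ℝ) = 0 := by
        by_contra hne
        have h1 := h n k hne
        rw [div_lt_iff₀ hc] at hn₀
        have h2 : (2 : ℝ) ^ n₀ ≤ 2 ^ n := pow_le_pow_right₀ one_le_two hn
        rw [Finset.mem_Icc, ← abs_le] at hk
        have h3 : |(k : ℝ)| ≤ N := by exact_mod_cast hk
        nlinarith
      simp [hz]
    simp [this]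

lemma IsDyadicPartition.besovNorm_lt_top {N : ℕ} {u : TorusDistribution} (hu : IsTrigPoly N u)
    (β : ℝ) : besovNorm χ φ β u < ∞ := by
  obtain ⟨D, hD, h⟩ := hχφ.exists_besovNorm_le β N
  exact (h u hu).trans_lt (ENNReal.mul_lt_top hD.lt_top (ENNReal.sum_lt_top.2 fun k _ => by simp))

omit hχφ in
lemma le_ctNorm {T : ℝ≥0} {β : ℝ} (u : ℝ≥0 → TorusDistribution) {t : ℝ≥0} (ht : t ≤ T) :
    besovNorm χ φ β (u t) ≤ ctNorm χ φ T β u :=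
  le_iSup (fun t : Set.Iic T => besovNorm χ φ β (u t)) ⟨t, ht⟩

lemma IsDyadicPartition.ctNorm_sub_comm (T : ℝ≥0) (β : ℝ) (u v : ℝ≥0 → TorusDistribution) :
    ctNorm χ φ T β (fun t => u t - v t) = ctNorm χ φ T β fun t => v t - u t := by
  unfold ctNorm
  simp_rw [hχφ.besovNorm_sub_comm β (u _)]

lemma IsDyadicPartition.ctNorm_le_add (T : ℝ≥0) (β : ℝ) (u v : ℝ≥0 → TorusDistribution) :
    ctNorm χ φ T β u ≤ ctNorm χ φ T β (fun t => v t - u t) + ctNorm χ φ T β v := by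
  rw [hχφ.ctNorm_sub_comm]
  refine iSup_le fun t => ?_
  have := hχφ.besovNorm_add_le β (u t - v t) (v t)
  rw [sub_add_cancel] at this
  exact this.trans (add_le_add (le_ctNorm (fun t => u t - v t) t.2) (le_ctNorm v t.2))

/-- Uniform limits of continuous paths of trigonometric polynomials belong to `C_T 𝓒^β`. -/
lemma IsDyadicPartition.memCTHolder_of_tendsto {T : ℝ≥0} {β : ℝ}
    {X : ℕ → ℝ≥0 → TorusDistribution} {Y : ℝ≥0 → TorusDistribution} {N : ℕ → ℕ}
    (hN : ∀ n, ∀ t ≤ T, IsTrigPoly (N n) (X n t))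
    (hcont : ∀ n k, ContinuousOn (fun t => mode (X n t) k) (Set.Iic T))
    (hlim : Tendsto (fun n => ctNorm χ φ T β fun t => X n t - Y t) atTop (𝓝 0)) :
    MemCTHolder χ φ T β Y := by
  have hex : ∀ δ : ℝ≥0∞, 0 < δ → ∃ n, ∀ t ≤ T, besovNorm χ φ β (Y t - X n t) < δ := fun δ hδ => by
    obtain ⟨n, hn⟩ := ((tendsto_order.1 hlim).2 δ hδ).exists
    refine ⟨n, fun t ht => ?_⟩
    rw [hχφ.besovNorm_sub_comm]
    exact (le_ctNorm (fun t => X n t - Y t) ht).trans_lt hn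
  refine ⟨fun t ht => ⟨?_, fun δ hδ => ?_⟩, fun t ht => ?_⟩
  · obtain ⟨n, hn⟩ := hex 1 one_pos
    have := hχφ.besovNorm_add_le β (Y t - X n t) (X n t)
    rw [sub_add_cancel] at this
    exact this.trans_lt (ENNReal.add_lt_top.2 ⟨(hn t ht).trans ENNReal.one_lt_top,
      hχφ.besovNorm_lt_top (hN n t ht) β⟩)
  · obtain ⟨n, hn⟩ := hex δ hδ
    exact ⟨X n t, (hN n t ht).isSmoothDistribution, hn t ht⟩
  · rw [ENNReal.tendsto_nhds_zero]
    intro ε hε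
    have hε3 : 0 < ε / 3 := ENNReal.div_pos hε.ne' (by norm_num)
    obtain ⟨n, hn⟩ := hex _ hε3
    obtain ⟨D, hD, hDu⟩ := hχφ.exists_besovNorm_le β (N n)
    have hX : Tendsto (fun s => D * ∑ k ∈ Finset.Icc (-(N n : ℤ)) (N n),
        ‖mode (X n s - X n t) k‖ₑ) (𝓝[Set.Iic T] t) (𝓝 0) := by
      have h1 : Tendsto (fun s => ∑ k ∈ Finset.Icc (-(N n : ℤ)) (N n),
          ‖mode (X n s - X n t) k‖ₑ) (𝓝[Set.Iic T] t) (𝓝 0) := by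
        rw [← Finset.sum_const_zero (s := Finset.Icc (-(N n : ℤ)) (N n))]
        refine tendsto_finsetSum _ fun k _ => ?_
        have h2 := ((hcont n k) t ht).sub_const (mode (X n t) k)
        rw [sub_self] at h2
        have := h2.enorm
        simpa [mode_sub] using this
      simpa using ENNReal.Tendsto.const_mul h1 (Or.inr hD)
    filter_upwards [(tendsto_order.1 hX).2 _ hε3, self_mem_nhdsWithin] with s hs hsT
    -- Three-epsilon argument: the outer terms are small uniformly in time, the middle one by
    -- continuity of the modes of `X n`.
    calc besovNorm χ φ β (Y s - Y t) ≤ besovNorm χ φ β (Y s - X n s) +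
          (besovNorm χ φ β (X n s - X n t) + besovNorm χ φ β (X n t - Y t)) :=
          (hχφ.besovNorm_sub_le β _ (X n s) _).trans
            (add_le_add le_rfl (hχφ.besovNorm_sub_le β _ (X n t) _))
      _ ≤ ε / 3 + (ε / 3 + ε / 3) := by
          refine add_le_add (hn s hsT).le (add_le_add ?_ ?_)
          · exact (hDu _ ((hN n s hsT).sub (hN n t ht))).trans hs.le
          · rw [hχφ.besovNorm_sub_comm]
            exact (hn t ht).le
      _ = ε := by rw [← add_assoc, ENNReal.add_thirds]

end Trigonometric

/-! ### Wick polynomials -/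

section Wick

variable {Ω : Type*} [MeasurableSpace Ω] (P : Measure Ω) (z : ℤ → ℝ≥0 → Ω → ℂ)

/-- The Wick product of two modes. -/
def wickMode (l m : ℤ) (t : ℝ≥0) (ω : Ω) : ℂ :=
  z l t ω * z m t ω - ∫ ω', z l t ω' * z m t ω' ∂P

/-- The symmetric window of frequencies. -/
abbrev window (N : ℕ) : Finset ℤ := Finset.Icc (-(N : ℤ)) N

/-- A linear combination of Wick products. -/
def wickForm (c : ℤ → ℤ → ℂ) (N : ℕ) (t : ℝ≥0) (ω : Ω) : ℂ :=
  ∑ l ∈ window N, ∑ m ∈ window N, c l m * wickMode P z l m t ω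

/-- The distribution `∑ l m, d l m :z(l) z(m): e_{l+m}`. -/
def wickPoly (d : ℤ → ℤ → ℂ) (N : ℕ) (t : ℝ≥0) (ω : Ω) : TorusDistribution :=
  ⟨fun k => wickForm P z (fun l m => if l + m = k then d l m else 0) N t ω,
    ∑ l ∈ window N, ∑ m ∈ window N, ‖d l m * wickMode P z l m t ω‖, 0, fun k => by
      rw [pow_zero, mul_one]
      refine (norm_sum_le _ _).trans (Finset.sum_le_sum fun l _ => ?_)
      refine (norm_sum_le _ _).trans (Finset.sum_le_sum fun m _ => ?_)
      dsimp only
      split_ifs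
      · exact le_rfl
      · simpa using mul_nonneg (norm_nonneg _) (norm_nonneg _)⟩

lemma mode_wickPoly (d : ℤ → ℤ → ℂ) (N : ℕ) (t : ℝ≥0) (ω : Ω) (k : ℤ) :
    mode (wickPoly P z d N t ω) k =
      wickForm P z (fun l m => if l + m = k then d l m else 0) N t ω := rfl

lemma isTrigPoly_wickPoly (d : ℤ → ℤ → ℂ) (N : ℕ) (t : ℝ≥0) (ω : Ω) :
    IsTrigPoly (2 * N) (wickPoly P z d N t ω) := fun k hk => by
  rw [mode_wickPoly]
  refine Finset.sum_eq_zero fun l hl => Finset.sum_eq_zero fun m hm => ?_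
  dsimp only
  rw [if_neg, zero_mul]
  rintro rfl
  simp only [window, Finset.mem_Icc] at hl hm hk
  push_cast at hk
  lia

lemma wickPoly_sub (d d' : ℤ → ℤ → ℂ) (N : ℕ) (t : ℝ≥0) (ω : Ω) :
    wickPoly P z d N t ω - wickPoly P z d' N t ω =
      wickPoly P z (fun l m => d l m - d' l m) N t ω := by
  refine ext_mode fun k => ?_
  rw [mode_sub]
  simp only [mode_wickPoly, wickForm, ← Finset.sum_sub_distrib]
  refine Finset.sum_congr rfl fun l _ => Finset.sum_congr rfl fun m _ => ?_
  split_ifs <;> ring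

/-- A block at a point is again a scalar Wick form, with the block symbol and the exponential moved
into the coefficients, so the moment bound for quadratic forms applies to it. -/
lemma lpBlock_wickPoly (χ φ : ℝ → ℝ) (n : ℕ) (d : ℤ → ℤ → ℂ) (N : ℕ) (t : ℝ≥0) (ω : Ω)
    (x : Torus) : lpBlock χ φ n (wickPoly P z d N t ω) x = wickForm P z
      (fun l m => lpSymbol χ φ n ((l + m : ℤ) : ℝ) * d l m * fourier (l + m) x) N t ω := by
  rw [lpBlock_eq_sum n _ (s := window (2 * N)) fun k _ hk =>
    by_contra fun h => hk (isTrigPoly_wickPoly P z d N t ω k h)]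
  rw [ContinuousMap.coe_sum, Finset.sum_apply]
  simp only [ContinuousMap.coe_smul, Pi.smul_apply, smul_eq_mul, mode_wickPoly, wickForm,
    Finset.mul_sum, Finset.sum_mul]
  rw [Finset.sum_comm]
  refine Finset.sum_congr rfl fun l hl => ?_
  rw [Finset.sum_comm]
  refine Finset.sum_congr rfl fun m hm => ?_
  rw [Finset.sum_eq_single (l + m)]
  · simp only [if_true]; ring
  · intro k _ hk
    rw [if_neg (Ne.symm hk)]; ring
  · intro h
    simp only [window, Finset.mem_Icc] at hl hm h
    push_cast at h
    lia

/-- The Wick square of the regularised process is a Wick polynomial. -/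
lemma wickSquare_eq_wickPoly {T t : ℝ≥0} {q : ℤ → ℂ} {W : ℤ → ℝ≥0 → Ω → ℂ}
    (hz : IsOrnsteinUhlenbeck P T q W z) (ht : t ≤ T) (ψ : ℝ → ℝ) (ε : ℝ) {N : ℕ}
    (hN : ∀ k : ℤ, ψ (ε * k) ≠ 0 → k ∈ window N) (ω : Ω) :
    wickSquare P ψ z ε t ω =
      wickPoly P z (fun l m => (ψ (ε * l) : ℂ) * (ψ (ε * m) : ℂ)) N t ω := by
  have hreg : ∀ ω x, regularise ψ z ε t ω x =
      ∑ k ∈ window N, (ψ (ε * k) : ℂ) * z k t ω * fourier k x := fun ω x => by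
    rw [regularise, finsum_eq_sum_of_support_subset (s := window N)]
    · simp
    · intro k hk
      refine hN k fun h => hk ?_
      simp [h]
  have hsq : ∀ ω x, regularise ψ z ε t ω x ^ 2 = ∑ l ∈ window N, ∑ m ∈ window N,
      (ψ (ε * l) : ℂ) * (ψ (ε * m) : ℂ) * fourier (l + m) x * (z l t ω * z m t ω) := fun ω x => by
    rw [hreg, sq, Finset.sum_mul_sum]
    refine Finset.sum_congr rfl fun l _ => Finset.sum_congr rfl fun m _ => ?_
    rw [fourier_add]; ring
  have hint : ∀ (l m : ℤ) (x : Torus), Integrable (fun ω =>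
      (ψ (ε * l) : ℂ) * (ψ (ε * m) : ℂ) * fourier (l + m) x * (z l t ω * z m t ω)) P :=
    fun l m x => ((hz.memLp l ht).integrable_mul (hz.memLp m ht)).const_mul _
  have hE : ∀ x, ∫ ω, regularise ψ z ε t ω x ^ 2 ∂P = ∑ l ∈ window N, ∑ m ∈ window N,
      (ψ (ε * l) : ℂ) * (ψ (ε * m) : ℂ) * fourier (l + m) x * ∫ ω, z l t ω * z m t ω ∂P :=
    fun x => by
      simp_rw [hsq]
      rw [integral_finsetSum _ fun l _ => integrable_finsetSum _ fun m _ => hint l m x]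
      refine Finset.sum_congr rfl fun l _ => ?_
      rw [integral_finsetSum _ fun m _ => hint l m x]
      exact Finset.sum_congr rfl fun m _ => integral_const_mul _ _
  refine ext_mode fun k => ?_
  have hf : (fun x => regularise ψ z ε t ω x ^ 2 - ∫ ω', regularise ψ z ε t ω' x ^ 2 ∂P) =
      fun x => ∑ p ∈ window N ×ˢ window N, ((ψ (ε * p.1) : ℂ) * (ψ (ε * p.2) : ℂ) *
        wickMode P z p.1 p.2 t ω) * fourier (p.1 + p.2) x := by
    ext x
    rw [hsq, hE, ← Finset.sum_sub_distrib, Finset.sum_product]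
    refine Finset.sum_congr rfl fun l _ => ?_
    rw [← Finset.sum_sub_distrib]
    refine Finset.sum_congr rfl fun m _ => ?_
    rw [wickMode]; ring
  change fourierCoeff _ k = _
  rw [hf, fourierCoeff_sum_fourier, Finset.sum_product, mode_wickPoly, wickForm]
  refine Finset.sum_congr rfl fun l _ => Finset.sum_congr rfl fun m _ => ?_
  dsimp only
  split_ifs <;> ring

end Wick

/-! ### Moments of Wick polynomials -/

/-- The weight `|l|^{-a}` on nonzero frequencies, extended by zero. -/
def freqWeight (a : ℝ) (l : ℤ) : ℝ := if l = 0 then 0 else |(l : ℝ)| ^ (-a)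

lemma freqWeight_nonneg (a : ℝ) (l : ℤ) : 0 ≤ freqWeight a l := by
  unfold freqWeight
  split_ifs
  · exact le_rfl
  · positivity

lemma one_le_abs_intCast {l : ℤ} (hl : l ≠ 0) : (1 : ℝ) ≤ |(l : ℝ)| := by
  exact_mod_cast Int.one_le_abs hl

lemma summable_freqWeight {a : ℝ} (ha : 1 < a) : Summable (freqWeight a) := by
  refine Summable.of_nonneg_of_le (freqWeight_nonneg a) (fun l => ?_)
    (Real.summable_abs_int_rpow ha)
  unfold freqWeight
  split_ifs
  · positivity
  · exact le_rfl

/-- Since `1 + K ≤ 3y`, the larger frequency gives up `b` of its `a` powers to produce decay in `K`.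
The remaining `a - b ≥ 0` powers are transferred to the smaller frequency, which leaves a weight in
one variable, summable when `2a - b > 1`. -/
lemma freqWeight_mul_le_aux {a b x y K : ℝ} (hb : 0 ≤ b) (hba : b ≤ a) (hx : 1 ≤ x) (hxy : x ≤ y)
    (hK : 0 ≤ K) (hKxy : K ≤ x + y) :
    x ^ (-a) * y ^ (-a) * (1 + K) ^ b ≤ 3 ^ b * x ^ (-(2 * a - b)) := by
  have hx0 : 0 < x := by linarith
  have hy0 : 0 < y := by linarith
  calc x ^ (-a) * y ^ (-a) * (1 + K) ^ b ≤ x ^ (-a) * y ^ (-a) * (3 * y) ^ b := by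
        gcongr; linarith
    _ = 3 ^ b * (x ^ (-a) * y ^ (b - a)) := by
        rw [Real.mul_rpow (by norm_num) hy0.le, sub_eq_add_neg, Real.rpow_add hy0]; ring
    _ ≤ 3 ^ b * (x ^ (-a) * x ^ (b - a)) := by
        have := Real.rpow_le_rpow_of_nonpos hx0 hxy (by linarith : b - a ≤ 0)
        gcongr
    _ = 3 ^ b * x ^ (-(2 * a - b)) := by
        rw [← Real.rpow_add hx0]; ring_nf

lemma freqWeight_mul_le {a b : ℝ} (hb : 0 ≤ b) (hba : b ≤ a) (l m : ℤ) :
    freqWeight a l * freqWeight a m ≤ 3 ^ b * (1 + |((l + m : ℤ) : ℝ)|) ^ (-b) *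
      (freqWeight (2 * a - b) l + freqWeight (2 * a - b) m) := by
  have hl0 := freqWeight_nonneg (2 * a - b) l
  have hm0 := freqWeight_nonneg (2 * a - b) m
  by_cases hl : l = 0
  · rw [freqWeight, if_pos hl, zero_mul]; positivity
  by_cases hm : m = 0
  · rw [freqWeight, freqWeight, if_pos hm, mul_zero]; positivity
  have hK : |((l + m : ℤ) : ℝ)| ≤ |(l : ℝ)| + |(m : ℝ)| := by
    push_cast; exact abs_add_le _ _
  have h1K : (0 : ℝ) < 1 + |((l + m : ℤ) : ℝ)| := by positivity
  have key : freqWeight a l * freqWeight a m * (1 + |((l + m : ℤ) : ℝ)|) ^ b ≤ 3 ^ b *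
      (freqWeight (2 * a - b) l + freqWeight (2 * a - b) m) := by
    rcases le_total |(l : ℝ)| |(m : ℝ)| with h | h
    · have := freqWeight_mul_le_aux hb hba (one_le_abs_intCast hl) h (abs_nonneg _) hK
      have h3 : (0 : ℝ) ≤ 3 ^ b * freqWeight (2 * a - b) m := by positivity
      rw [mul_add]
      refine le_trans ?_ (le_add_of_nonneg_right h3)
      simpa only [freqWeight, if_neg hl, if_neg hm] using this
    · have := freqWeight_mul_le_aux hb hba (one_le_abs_intCast hm) h (abs_nonneg _)
        (hK.trans_eq (add_comm _ _))
      have h3 : (0 : ℝ) ≤ 3 ^ b * freqWeight (2 * a - b) l := by positivity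
      rw [mul_add]
      refine le_trans ?_ (le_add_of_nonneg_left h3)
      rw [mul_comm (freqWeight a l)]
      simpa only [freqWeight, if_neg hl, if_neg hm] using this
  rw [Real.rpow_neg h1K.le, mul_assoc, mul_comm (_ ⁻¹), ← mul_assoc, ← div_eq_mul_inv,
    le_div_iff₀ (by positivity)]
  exact key

/-- Discrete convolution estimate. -/
lemma exists_sum_freqWeight_le {a b : ℝ} (hb : 0 ≤ b) (hba : b ≤ a) (hab : b < 2 * a - 1) :
    ∃ C : ℝ, 0 ≤ C ∧ ∀ (N : ℕ) (k : ℤ), ∑ l ∈ window N, ∑ m ∈ window N,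
      (if l + m = k then freqWeight a l * freqWeight a m else 0) ≤
        C * (1 + |(k : ℝ)|) ^ (-b) := by
  have hs := summable_freqWeight (a := 2 * a - b) (by linarith)
  set S := ∑' l, freqWeight (2 * a - b) l
  have hS : ∀ N, ∑ l ∈ window N, freqWeight (2 * a - b) l ≤ S := fun N =>
    hs.sum_le_tsum _ fun _ _ => freqWeight_nonneg _ _
  have hS0 : 0 ≤ S := tsum_nonneg (freqWeight_nonneg _)
  refine ⟨3 ^ b * (S + S), by positivity, fun N k => ?_⟩
  calc ∑ l ∈ window N, ∑ m ∈ window N,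
      (if l + m = k then freqWeight a l * freqWeight a m else 0)
      ≤ ∑ l ∈ window N, ∑ m ∈ window N, 3 ^ b * (1 + |(k : ℝ)|) ^ (-b) *
        ((if m = k - l then freqWeight (2 * a - b) l else 0) +
          (if l = k - m then freqWeight (2 * a - b) m else 0)) := by
        refine Finset.sum_le_sum fun l _ => Finset.sum_le_sum fun m _ => ?_
        by_cases h : l + m = k
        · rw [if_pos h, if_pos (by lia), if_pos (by lia), ← h]
          exact freqWeight_mul_le hb hba l m
        · rw [if_neg h, if_neg (by lia), if_neg (by lia)]; simp
    _ = 3 ^ b * (1 + |(k : ℝ)|) ^ (-b) *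
        ((∑ l ∈ window N, if k - l ∈ window N then freqWeight (2 * a - b) l else 0) +
          ∑ m ∈ window N, if k - m ∈ window N then freqWeight (2 * a - b) m else 0) := by
        simp_rw [← Finset.mul_sum, Finset.sum_add_distrib]
        congr 2
        · exact Finset.sum_congr rfl fun l _ => Finset.sum_ite_eq' _ _ _
        · rw [Finset.sum_comm]
          exact Finset.sum_congr rfl fun m _ => Finset.sum_ite_eq' _ _ _
    _ ≤ 3 ^ b * (1 + |(k : ℝ)|) ^ (-b) * (S + S) := by
        have : (∑ l ∈ window N, if k - l ∈ window N then freqWeight (2 * a - b) l else 0) ≤ S := by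
          refine le_trans (Finset.sum_le_sum fun l _ => ?_) (hS N)
          split_ifs
          · exact le_rfl
          · exact freqWeight_nonneg _ _
        gcongr
    _ = _ := by ring

/-- A block meets at most `3R 2^n` output frequencies `k = l + m`, and each contributes order
`(2^n)^{-b}` by the convolution estimate. -/
lemma IsDyadicPartition.exists_sum_lpSymbol_le {χ φ : ℝ → ℝ} (hχφ : IsDyadicPartition χ φ)
    {a b : ℝ} (hb : 0 ≤ b) (hba : b ≤ a) (hab : b < 2 * a - 1) :
    ∃ C : ℝ, 0 ≤ C ∧ ∀ N n : ℕ, ∑ l ∈ window N, ∑ m ∈ window N,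
      (if lpSymbol χ φ n ((l + m : ℤ) : ℝ) ≠ 0 then freqWeight a l * freqWeight a m else 0) ≤
        C * ((2 : ℝ) ^ n) ^ (1 - b) := by
  obtain ⟨C, hC, hconv⟩ := exists_sum_freqWeight_le hb hba hab
  obtain ⟨R, hR, hup⟩ := hχφ.exists_le_two_pow
  obtain ⟨c, hc, hlow⟩ := hχφ.exists_two_pow_le
  refine ⟨3 * R * (C * c ^ (-b)), by positivity, fun N n => ?_⟩
  have h2 : (1 : ℝ) ≤ 2 ^ n := one_le_pow₀ one_le_two
  have hR' : (1 : ℝ) ≤ R := by exact_mod_cast hR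
  calc ∑ l ∈ window N, ∑ m ∈ window N,
      (if lpSymbol χ φ n ((l + m : ℤ) : ℝ) ≠ 0 then freqWeight a l * freqWeight a m else 0)
      = ∑ l ∈ window N, ∑ m ∈ window N, ∑ k ∈ window (R * 2 ^ n),
        if lpSymbol χ φ n (k : ℝ) ≠ 0 then
          (if l + m = k then freqWeight a l * freqWeight a m else 0) else 0 := by
        refine Finset.sum_congr rfl fun l _ => Finset.sum_congr rfl fun m _ => ?_
        rw [Finset.sum_eq_single (l + m)]
        · simp
        · intro k _ hk
          rw [if_neg (Ne.symm hk)]; simp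
        · intro hk
          rw [if_neg]
          refine not_not.2 (by_contra fun h => hk ?_)
          have := hup n _ h
          rw [Finset.mem_Icc, ← abs_le]
          exact_mod_cast this
    _ = ∑ k ∈ window (R * 2 ^ n), if lpSymbol χ φ n (k : ℝ) ≠ 0 then
          (∑ l ∈ window N, ∑ m ∈ window N,
            if l + m = k then freqWeight a l * freqWeight a m else 0) else 0 := by
        simp_rw [Finset.sum_comm (s := window N) (t := window (R * 2 ^ n))]
        refine Finset.sum_congr rfl fun k _ => ?_
        split_ifs
        · rfl
        · simp
    _ ≤ ∑ k ∈ window (R * 2 ^ n), C * (c * 2 ^ n) ^ (-b) := by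
        refine Finset.sum_le_sum fun k _ => ?_
        split_ifs with h
        · refine (hconv N k).trans (mul_le_mul_of_nonneg_left ?_ hC)
          exact Real.rpow_le_rpow_of_nonpos (by positivity) (hlow n k h) (by linarith)
        · positivity
    _ = (2 * (R * 2 ^ n) + 1) * (C * (c * 2 ^ n) ^ (-b)) := by
        rw [Finset.sum_const, nsmul_eq_mul, Int.card_Icc]
        congr 1
        have : ((R * 2 ^ n : ℕ) : ℤ) + 1 - -((R * 2 ^ n : ℕ) : ℤ) = ((2 * (R * 2 ^ n) + 1 : ℕ) : ℤ) := by
          push_cast; ring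
        rw [this, Int.toNat_natCast]
        push_cast; ring
    _ ≤ (3 * R * 2 ^ n) * (C * (c * 2 ^ n) ^ (-b)) := by
        gcongr
        nlinarith
    _ = 3 * R * (C * c ^ (-b)) * ((2 : ℝ) ^ n) ^ (1 - b) := by
        rw [Real.mul_rpow hc.le (by positivity), sub_eq_add_neg, Real.rpow_add (by positivity),
          Real.rpow_one]
        ring

/-! ### Second moments of modes and moments of increments of Wick forms -/

section Moments

variable {Ω : Type*} [MeasurableSpace Ω] {P : Measure Ω} [IsProbabilityMeasure P]
  {T : ℝ≥0} {q : ℤ → ℂ} {W : ℤ → ℝ≥0 → Ω → ℂ} {z : ℤ → ℝ≥0 → Ω → ℂ}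

lemma IsOrnsteinUhlenbeck.ae_zero_mode (hW : IsCylindricalBM P W)
    (hz : IsOrnsteinUhlenbeck P T q W z) (hq0 : q 0 = 0) {t : ℝ≥0} (ht : t ≤ T) :
    ∀ᵐ ω ∂P, z 0 t ω = 0 := by
  have h := hz.lintegral_zero_mode hW hq0 ht
  have hm := hz.measurable 0 t ht
  rw [lintegral_eq_zero_iff (by fun_prop)] at h
  filter_upwards [h] with ω hω
  simpa using hω

/-- Exponent count: `|q_k|²` gives `2γ`, the Itô isometry `-2`, and the time regularity `2κ`. At
frequency zero both sides vanish because `q 0 = 0`. -/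
lemma IsOrnsteinUhlenbeck.lintegral_increment_le_weight (hW : IsCylindricalBM P W)
    (hz : IsOrnsteinUhlenbeck P T q W z) {γ C : ℝ} (hq0 : q 0 = 0)
    (hq : ∀ k : ℤ, k ≠ 0 → ‖q k‖ ≤ C * |(k : ℝ)| ^ γ) {κ : ℝ} (hκ : 0 ≤ κ) (hκ1 : κ ≤ 1) (k : ℤ)
    {s t : ℝ≥0} (hst : s ≤ t) (ht : t ≤ T) :
    ∫⁻ ω, ‖z k t ω - z k s ω‖ₑ ^ 2 ∂P ≤
      ENNReal.ofReal (2 * C ^ 2 * (t - s) ^ κ * freqWeight (2 - 2 * γ - 2 * κ) k) := by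
  by_cases hk : k = 0
  · subst hk
    rw [lintegral_congr_ae (g := 0)]
    · simp
    · filter_upwards [hz.ae_zero_mode hW hq0 ht, hz.ae_zero_mode hW hq0 (hst.trans ht)] with ω h1 h2
      simp [h1, h2]
  · refine (hz.lintegral_increment_le hW hk hst ht hκ hκ1).trans (ENNReal.ofReal_le_ofReal ?_)
    have hk0 : (0 : ℝ) < |(k : ℝ)| := by positivity
    have hts : (0 : ℝ) ≤ t - s := sub_nonneg.2 (by exact_mod_cast hst)
    rw [freqWeight, if_neg hk, Real.mul_rpow (by positivity) hts, ← sq_abs (k : ℝ)]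
    set x := |(k : ℝ)|
    calc ‖q k‖ ^ 2 * (2 / x ^ 2) * ((x ^ 2) ^ κ * (t - s : ℝ) ^ κ)
        ≤ (C * x ^ γ) ^ 2 * (2 / x ^ 2) * ((x ^ 2) ^ κ * (t - s : ℝ) ^ κ) := by
          gcongr; exact hq k hk
      _ = 2 * C ^ 2 * (t - s : ℝ) ^ κ * (x ^ γ * x ^ γ * (x ^ (2 : ℝ))⁻¹ * x ^ (2 * κ)) := by
          rw [← Real.rpow_natCast x 2, ← Real.rpow_mul hk0.le]; push_cast; ring
      _ = _ := by
          rw [← Real.rpow_neg hk0.le, ← Real.rpow_add hk0, ← Real.rpow_add hk0,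
            ← Real.rpow_add hk0]
          congr 2; ring

lemma IsOrnsteinUhlenbeck.lintegral_le_weight (hW : IsCylindricalBM P W)
    (hz : IsOrnsteinUhlenbeck P T q W z) {γ C : ℝ} (hq0 : q 0 = 0)
    (hq : ∀ k : ℤ, k ≠ 0 → ‖q k‖ ≤ C * |(k : ℝ)| ^ γ) {κ : ℝ} (hκ : 0 ≤ κ) (k : ℤ)
    {t : ℝ≥0} (ht : t ≤ T) :
    ∫⁻ ω, ‖z k t ω‖ₑ ^ 2 ∂P ≤ ENNReal.ofReal (2 * C ^ 2 * freqWeight (2 - 2 * γ - 2 * κ) k) := by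
  -- The increment from time zero with exponent `0` gives a bound uniform in `t`. Its weight is then
  -- relaxed so that both factors of a Wick product carry the same one.
  have h := hz.lintegral_increment_le_weight hW hq0 hq le_rfl zero_le_one k zero_le ht
  rw [Real.rpow_zero, mul_one] at h
  have h1 : ∫⁻ ω, ‖z k t ω‖ₑ ^ 2 ∂P = ∫⁻ ω, ‖z k t ω - z k 0 ω‖ₑ ^ 2 ∂P := by
    refine lintegral_congr_ae ?_
    filter_upwards [hz.ae_initial hW k] with ω hω
    rw [hω, sub_zero]
  rw [h1]
  refine h.trans (ENNReal.ofReal_le_ofReal (mul_le_mul_of_nonneg_left ?_ (by positivity)))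
  unfold freqWeight
  split_ifs with hk
  · exact le_rfl
  · exact Real.rpow_le_rpow_of_exponent_le (one_le_abs_intCast hk) (by linarith)

omit [IsProbabilityMeasure P] in
lemma IsOrnsteinUhlenbeck.measurable_wickForm (hz : IsOrnsteinUhlenbeck P T q W z)
    (c : ℤ → ℤ → ℂ) (N : ℕ) {t : ℝ≥0} (ht : t ≤ T) : Measurable (wickForm P z c N t) := by
  unfold wickForm wickMode
  exact Finset.measurable_sum _ fun l _ => Finset.measurable_sum _ fun m _ =>
    (((hz.measurable l t ht).mul (hz.measurable m t ht)).sub_const _).const_mul _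

omit [IsProbabilityMeasure P] in
-- The product rule for increments, compatible with Wick ordering. Each of the two forms has one
-- factor that is small in `t - s`.
lemma wickForm_sub {c : ℤ → ℤ → ℂ} {N : ℕ} (hz : IsOrnsteinUhlenbeck P T q W z) {s t : ℝ≥0}
    (hs : s ≤ T) (ht : t ≤ T) (ω : Ω) :
    wickForm P z c N t ω - wickForm P z c N s ω =
      (∑ l ∈ window N, ∑ m ∈ window N, c l m * ((z l t ω - z l s ω) * z m t ω -
        ∫ ω', (z l t ω' - z l s ω') * z m t ω' ∂P)) +
      ∑ l ∈ window N, ∑ m ∈ window N, c l m * (z l s ω * (z m t ω - z m s ω) -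
        ∫ ω', z l s ω' * (z m t ω' - z m s ω') ∂P) := by
  unfold wickForm
  rw [← Finset.sum_sub_distrib, ← Finset.sum_add_distrib]
  refine Finset.sum_congr rfl fun l _ => ?_
  rw [← Finset.sum_sub_distrib, ← Finset.sum_add_distrib]
  refine Finset.sum_congr rfl fun m _ => ?_
  have hI : ∀ {s t : ℝ≥0}, s ≤ T → t ≤ T → Integrable (fun ω => z l s ω * z m t ω) P :=
    fun hs ht => (hz.memLp l hs).integrable_mul (hz.memLp m ht)
  have h1 : ∫ ω', (z l t ω' - z l s ω') * z m t ω' ∂P =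
      ∫ ω', z l t ω' * z m t ω' ∂P - ∫ ω', z l s ω' * z m t ω' ∂P := by
    simp_rw [sub_mul]
    exact integral_sub (hI ht ht) (hI hs ht)
  have h2 : ∫ ω', z l s ω' * (z m t ω' - z m s ω') ∂P =
      ∫ ω', z l s ω' * z m t ω' ∂P - ∫ ω', z l s ω' * z m s ω' ∂P := by
    simp_rw [mul_sub]
    exact integral_sub (hI hs ht) (hI hs hs)
  rw [h1, h2, wickMode, wickMode]
  ring

/-- Two families are allowed because the increment formula pairs increments with values. Each has to
be orthogonal only within itself. -/
lemma lintegral_wick_window_le {W : ℤ → ℝ≥0 → Ω → ℂ} (hW : IsCylindricalBM P W) (A B : ℤ → Ω → ℂ)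
    (hA : ∀ i, IsComplexGaussian P (coordProcess W) (A i))
    (hB : ∀ i, IsComplexGaussian P (coordProcess W) (B i))
    (hA' : ∀ i j, i ≠ j → ∫ ω, A i ω * starRingEnd ℂ (A j ω) ∂P = 0)
    (hB' : ∀ i j, i ≠ j → ∫ ω, B i ω * starRingEnd ℂ (B j ω) ∂P = 0)
    (a b : ℤ → ℝ) (ha0 : ∀ i, 0 ≤ a i) (hb0 : ∀ i, 0 ≤ b i)
    (ha : ∀ i, ∫⁻ ω, ‖A i ω‖ₑ ^ 2 ∂P ≤ ENNReal.ofReal (a i))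
    (hb : ∀ i, ∫⁻ ω, ‖B i ω‖ₑ ^ 2 ∂P ≤ ENNReal.ofReal (b i))
    (c : ℤ → ℤ → ℂ) (N : ℕ) {r : ℕ} (hr : 1 ≤ r) :
    ∫⁻ ω, ‖∑ l ∈ window N, ∑ m ∈ window N, c l m *
        (A l ω * B m ω - ∫ ω', A l ω' * B m ω' ∂P)‖ₑ ^ (2 * r) ∂P ≤
      chaosMoment r * ENNReal.ofReal
        (∑ l ∈ window N, ∑ m ∈ window N, ‖c l m‖ ^ 2 * (a l * b m)) ^ r := by
  have hg := hW.isGaussianProcess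
  have h := lintegral_wick_pow_le (P := P) (fun i : window N => A i) (fun i : window N => B i)
    (IsComplexGaussian.hasGaussianLaw_pair hg hW.integral_coord (fun i => hA i) fun i => hB i)
    (fun i => (hA i).integral_eq_zero hg hW.integral_coord)
    (fun i => (hB i).integral_eq_zero hg hW.integral_coord)
    (fun i j hij => hA' i j fun h => hij (Subtype.ext h))
    (fun i j hij => hB' i j fun h => hij (Subtype.ext h)) (fun i j => c i j) hr
  have hsum : ∀ {M : Type _} [AddCommMonoid M] (f : ℤ → ℤ → M),
      ∑ i : window N, ∑ j : window N, f i j = ∑ l ∈ window N, ∑ m ∈ window N, f l m := by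
    intro M _ f
    rw [← Finset.sum_coe_sort (window N)]
    exact Finset.sum_congr rfl fun i _ => Finset.sum_coe_sort (window N) (f i)
  rw [hsum fun l m => ‖c l m‖ₑ ^ 2 * ((∫⁻ ω, ‖A l ω‖ₑ ^ 2 ∂P) * ∫⁻ ω, ‖B m ω‖ₑ ^ 2 ∂P)] at h
  simp_rw [fun ω => hsum fun l m => c l m * (A l ω * B m ω - ∫ ω', A l ω' * B m ω' ∂P)] at h
  refine h.trans ?_
  gcongr
  rw [ENNReal.ofReal_sum_of_nonneg fun l _ => Finset.sum_nonneg fun m _ =>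
    mul_nonneg (by positivity) (mul_nonneg (ha0 l) (hb0 m))]
  refine Finset.sum_le_sum fun l _ => ?_
  rw [ENNReal.ofReal_sum_of_nonneg fun m _ => mul_nonneg (by positivity) (mul_nonneg (ha0 l) (hb0 m))]
  refine Finset.sum_le_sum fun m _ => ?_
  rw [ENNReal.ofReal_mul (by positivity), ENNReal.ofReal_mul (ha0 l),
    ENNReal.ofReal_pow (norm_nonneg _), ofReal_norm]
  gcongr
  · exact ha l
  · exact hb m

lemma IsOrnsteinUhlenbeck.lintegral_wickForm_increment_le (hW : IsCylindricalBM P W)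
    (hz : IsOrnsteinUhlenbeck P T q W z) {γ C : ℝ} (hq0 : q 0 = 0)
    (hq : ∀ k : ℤ, k ≠ 0 → ‖q k‖ ≤ C * |(k : ℝ)| ^ γ) {κ : ℝ} (hκ : 0 ≤ κ) (hκ1 : κ ≤ 1)
    (c : ℤ → ℤ → ℂ) (N : ℕ) {r : ℕ} (hr : 1 ≤ r) {s t : ℝ≥0} (hst : s ≤ t) (ht : t ≤ T) :
    ∫⁻ ω, ‖wickForm P z c N t ω - wickForm P z c N s ω‖ₑ ^ (2 * r) ∂P ≤
      2 ^ (2 * r) * 2 * chaosMoment r * ENNReal.ofReal (4 * C ^ 4 * (t - s) ^ κ *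
        ∑ l ∈ window N, ∑ m ∈ window N, ‖c l m‖ ^ 2 * (freqWeight (2 - 2 * γ - 2 * κ) l *
          freqWeight (2 - 2 * γ - 2 * κ) m)) ^ r := by
  have hs := hst.trans ht
  have hts : (0 : ℝ) ≤ t - s := sub_nonneg.2 (by exact_mod_cast hst)
  set g := freqWeight (2 - 2 * γ - 2 * κ) with hg
  have hg0 : ∀ i, 0 ≤ g i := freqWeight_nonneg _
  have hD := fun k => (hz.isComplexGaussian hW k ht).sub (hz.isComplexGaussian hW k hs)
  have hD' := fun i j (hij : i ≠ j) => hz.integral_increment_mul_conj hW hij hs ht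
  have hDw := fun k => hz.lintegral_increment_le_weight hW hq0 hq hκ hκ1 k hst ht
  have h1 := lintegral_wick_window_le hW (fun k ω => z k t ω - z k s ω) (fun k => z k t)
    hD (fun k => hz.isComplexGaussian hW k ht) hD'
    (fun i j hij => hz.integral_mul_conj hW hij ht ht) _ _
    (fun i => mul_nonneg (by positivity) (hg0 i)) (fun i => mul_nonneg (by positivity) (hg0 i))
    hDw (fun k => hz.lintegral_le_weight hW hq0 hq hκ k ht) c N hr
  have h2 := lintegral_wick_window_le hW (fun k => z k s) (fun k ω => z k t ω - z k s ω)
    (fun k => hz.isComplexGaussian hW k hs) hD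
    (fun i j hij => hz.integral_mul_conj hW hij hs hs) hD' _ _
    (fun i => mul_nonneg (by positivity) (hg0 i)) (fun i => mul_nonneg (by positivity) (hg0 i))
    (fun k => hz.lintegral_le_weight hW hq0 hq hκ k hs) hDw c N hr
  have e : ∀ f : ℤ → ℤ → ℝ, (∀ l m, f l m = 4 * C ^ 4 * (t - s : ℝ) ^ κ *
      (‖c l m‖ ^ 2 * (g l * g m))) → ∑ l ∈ window N, ∑ m ∈ window N, f l m =
      4 * C ^ 4 * (t - s : ℝ) ^ κ * ∑ l ∈ window N, ∑ m ∈ window N,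
        ‖c l m‖ ^ 2 * (g l * g m) := fun f hf => by
    simp_rw [hf, ← Finset.mul_sum]
  rw [e _ fun l m => by ring] at h1 h2
  have hm : Measurable fun ω => ‖∑ l ∈ window N, ∑ m ∈ window N, c l m *
      ((z l t ω - z l s ω) * z m t ω - ∫ ω', (z l t ω' - z l s ω') * z m t ω' ∂P)‖ₑ ^ (2 * r) := by
    refine ((Finset.measurable_sum _ fun l _ => Finset.measurable_sum _ fun m _ => ?_).enorm).pow_const _
    exact ((((hz.measurable l t ht).sub (hz.measurable l s hs)).mul
      (hz.measurable m t ht)).sub_const _).const_mul _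
  calc ∫⁻ ω, ‖wickForm P z c N t ω - wickForm P z c N s ω‖ₑ ^ (2 * r) ∂P
      ≤ ∫⁻ ω, 2 ^ (2 * r) * (‖∑ l ∈ window N, ∑ m ∈ window N, c l m *
      ((z l t ω - z l s ω) * z m t ω - ∫ ω', (z l t ω' - z l s ω') * z m t ω' ∂P)‖ₑ ^ (2 * r) +
      ‖∑ l ∈ window N, ∑ m ∈ window N, c l m * (z l s ω * (z m t ω - z m s ω) -
        ∫ ω', z l s ω' * (z m t ω' - z m s ω') ∂P)‖ₑ ^ (2 * r)) ∂P := by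
        refine lintegral_mono fun ω => ?_
        rw [wickForm_sub hz hs ht]
        exact (pow_le_pow_left' (enorm_add_le _ _) _).trans (add_pow_le_two_pow_mul _ _ _)
    _ ≤ 2 ^ (2 * r) * (chaosMoment r * _ + chaosMoment r * _) := by
        rw [lintegral_const_mul' _ _ (by simp), lintegral_add_left hm]
        exact mul_le_mul_right (add_le_add h1 h2) _
    _ = _ := by ring

lemma IsOrnsteinUhlenbeck.ae_wickForm_zero (hW : IsCylindricalBM P W)
    (hz : IsOrnsteinUhlenbeck P T q W z) (c : ℤ → ℤ → ℂ) (N : ℕ) :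
    ∀ᵐ ω ∂P, wickForm P z c N 0 ω = 0 := by
  have h := ae_all_iff.2 (hz.ae_initial hW)
  filter_upwards [h] with ω hω
  refine Finset.sum_eq_zero fun l _ => Finset.sum_eq_zero fun m _ => ?_
  have : ∫ ω', z l 0 ω' * z m 0 ω' ∂P = 0 := by
    refine integral_eq_zero_of_ae ?_
    filter_upwards [h] with ω' h'
    simp [h']
  rw [wickMode, this, hω l]
  simp

/-- The coefficients are bounded by `K |l|^κ |m|^κ`. -/
def HasSymbolBound (κ K : ℝ) (d : ℤ → ℤ → ℂ) : Prop :=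
  ∀ l m : ℤ, l ≠ 0 → m ≠ 0 → ‖d l m‖ ≤ K * (|(l : ℝ)| ^ κ * |(m : ℝ)| ^ κ)

/-- Growth `|l|^κ |m|^κ` of the coefficients costs `2κ` in the exponent of each weight. Zero
frequencies need no bound since the weight vanishes there. -/
lemma HasSymbolBound.sq_mul_freqWeight_le {κ K : ℝ} {d : ℤ → ℤ → ℂ} (hd : HasSymbolBound κ K d)
    (a : ℝ) (l m : ℤ) : ‖d l m‖ ^ 2 * (freqWeight a l * freqWeight a m) ≤
      K ^ 2 * (freqWeight (a - 2 * κ) l * freqWeight (a - 2 * κ) m) := by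
  by_cases hl : l = 0
  · simp [freqWeight, hl]
  by_cases hm : m = 0
  · simp [freqWeight, hm]
  simp only [freqWeight, if_neg hl, if_neg hm]
  have hl0 : (0 : ℝ) < |(l : ℝ)| := by positivity
  have hm0 : (0 : ℝ) < |(m : ℝ)| := by positivity
  have e : ∀ x : ℝ, 0 < x → x ^ (-(a - 2 * κ)) = x ^ κ * x ^ κ * x ^ (-a) := fun x hx => by
    rw [← Real.rpow_add hx, ← Real.rpow_add hx]; congr 1; ring
  calc ‖d l m‖ ^ 2 * (|(l : ℝ)| ^ (-a) * |(m : ℝ)| ^ (-a))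
      ≤ (K * (|(l : ℝ)| ^ κ * |(m : ℝ)| ^ κ)) ^ 2 * (|(l : ℝ)| ^ (-a) * |(m : ℝ)| ^ (-a)) := by
        gcongr; exact hd l m hl hm
    _ = _ := by rw [e _ hl0, e _ hm0]; ring

/-- The estimate that feeds the chaining: constants are uniform in the degree, the point and the
coefficients, and the coefficients enter only through `K`. -/
lemma IsOrnsteinUhlenbeck.exists_lintegral_lpBlock_le (hW : IsCylindricalBM P W)
    (hz : IsOrnsteinUhlenbeck P T q W z) {γ : ℝ} (hγ : 1 / 2 ≤ γ) (hq : IsComparableSymbol γ q)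
    {χ φ : ℝ → ℝ} (hχφ : IsDyadicPartition χ φ) {κ : ℝ} (hκ : 0 < κ)
    (hκγ : 9 * κ ≤ 3 - 4 * γ) {r : ℕ} (hr : 1 ≤ r) :
    ∃ C : ℝ≥0∞, C < ∞ ∧ ∀ (n N : ℕ) (x : Torus) (d : ℤ → ℤ → ℂ) (K : ℝ), 0 ≤ K →
      HasSymbolBound κ K d → ∀ s t : ℝ≥0, s ≤ t → t ≤ T →
      ∫⁻ ω, ‖lpBlock χ φ n (wickPoly P z d N t ω) x - lpBlock χ φ n (wickPoly P z d N s ω) x‖ₑ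
        ^ (2 * r) ∂P ≤
      C * ENNReal.ofReal (K ^ 2 * (t - s) ^ κ *
        ((2 : ℝ) ^ n) ^ (1 - (3 - 4 * γ - 9 * κ))) ^ r := by
  obtain ⟨hq0, c₀, C, -, hC, hqk⟩ := hq
  -- The weight `2 - 2γ - 2κ` loses another `2κ` to the coefficients. Then `2a - 1 = 3 - 4γ - 8κ`,
  -- and the ninth `κ` in `b` makes the inequality strict; `b ≤ a` amounts to `1 - 2γ ≤ 5κ`, which
  -- follows from `γ ≥ 1/2`.
  obtain ⟨S, hS, hsum⟩ := hχφ.exists_sum_lpSymbol_le (a := 2 - 2 * γ - 4 * κ)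
    (b := 3 - 4 * γ - 9 * κ) (by linarith) (by linarith) (by linarith)
  refine ⟨2 ^ (2 * r) * 2 * chaosMoment r * ENNReal.ofReal (4 * C ^ 4 * S) ^ r,
    ENNReal.mul_lt_top (ENNReal.mul_lt_top (by finiteness) (chaosMoment_lt_top r)) (by simp),
    fun n N x d K hK hd s t hst ht => ?_⟩
  have hts : (0 : ℝ) ≤ t - s := sub_nonneg.2 (by exact_mod_cast hst)
  simp_rw [lpBlock_wickPoly]
  refine (hz.lintegral_wickForm_increment_le hW hq0 (fun k hk => (hqk k hk).2) hκ.le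
    (by linarith) _ N hr hst ht).trans ?_
  rw [mul_assoc (2 ^ (2 * r) * 2 * chaosMoment r), ← mul_pow,
    ← ENNReal.ofReal_mul (by positivity)]
  refine mul_le_mul_right (pow_le_pow_left' (ENNReal.ofReal_le_ofReal ?_) _) _
  have : ∑ l ∈ window N, ∑ m ∈ window N,
      ‖(lpSymbol χ φ n ((l + m : ℤ) : ℝ) : ℂ) * d l m * fourier (l + m) x‖ ^ 2 *
        (freqWeight (2 - 2 * γ - 2 * κ) l * freqWeight (2 - 2 * γ - 2 * κ) m) ≤
      K ^ 2 * (S * ((2 : ℝ) ^ n) ^ (1 - (3 - 4 * γ - 9 * κ))) := by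
    refine le_trans ?_ (mul_le_mul_of_nonneg_left (hsum N n) (sq_nonneg K))
    simp_rw [Finset.mul_sum]
    refine Finset.sum_le_sum fun l _ => Finset.sum_le_sum fun m _ => ?_
    have h1 := hd.sq_mul_freqWeight_le (2 - 2 * γ - 2 * κ) l m
    rw [show 2 - 2 * γ - 2 * κ - 2 * κ = 2 - 2 * γ - 4 * κ by ring] at h1
    split_ifs with h
    · rw [norm_mul, norm_mul, fourier_apply, Circle.norm_coe, mul_one, Complex.norm_real,
        Real.norm_eq_abs, abs_of_nonneg (hχφ.lpSymbol_mem n _).1]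
      refine le_trans ?_ h1
      have h2 : lpSymbol χ φ n ((l + m : ℤ) : ℝ) * ‖d l m‖ ≤ ‖d l m‖ :=
        mul_le_of_le_one_left (norm_nonneg _) (hχφ.lpSymbol_mem n _).2
      have h3 := (hχφ.lpSymbol_mem n ((l + m : ℤ) : ℝ)).1
      have h4 := mul_nonneg (freqWeight_nonneg (2 - 2 * γ - 2 * κ) l)
        (freqWeight_nonneg (2 - 2 * γ - 2 * κ) m)
      gcongr
    · rw [not_not] at h
      rw [h]
      simp
  calc _ ≤ 4 * C ^ 4 * (t - s : ℝ) ^ κ * (K ^ 2 * (S * ((2 : ℝ) ^ n) ^ (1 - (3 - 4 * γ - 9 * κ)))) := by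
        gcongr
    _ = _ := by ring

/-- Case `r = 1` of the increment bound, started at time zero, where Wick forms vanish almost
surely; the convolution estimate for a single output frequency gives the decay. -/
lemma IsOrnsteinUhlenbeck.exists_lintegral_mode_le (hW : IsCylindricalBM P W)
    (hz : IsOrnsteinUhlenbeck P T q W z) {γ : ℝ} (hγ : 1 / 2 ≤ γ) (hq : IsComparableSymbol γ q)
    {κ : ℝ} (hκ : 0 < κ) (hκγ : 9 * κ ≤ 3 - 4 * γ) :
    ∃ C : ℝ, 0 ≤ C ∧ ∀ (N : ℕ) (k : ℤ) (d : ℤ → ℤ → ℂ) (K : ℝ), 0 ≤ K →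
      HasSymbolBound κ K d → ∀ t ≤ T, ∫⁻ ω, ‖mode (wickPoly P z d N t ω) k‖ₑ ^ 2 ∂P ≤
        ENNReal.ofReal (C * K ^ 2 * (1 + |(k : ℝ)|) ^ (-(3 - 4 * γ - 9 * κ))) := by
  obtain ⟨hq0, c₀, C, -, hC, hqk⟩ := hq
  obtain ⟨S, hS, hsum⟩ := exists_sum_freqWeight_le (a := 2 - 2 * γ - 4 * κ)
    (b := 3 - 4 * γ - 9 * κ) (by linarith) (by linarith) (by linarith)
  obtain ⟨M, hM0, hM⟩ : ∃ M : ℝ, 0 ≤ M ∧ 2 ^ (2 * 1) * 2 * chaosMoment 1 = ENNReal.ofReal M :=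
    ⟨_, ENNReal.toReal_nonneg, (ENNReal.ofReal_toReal
      (ENNReal.mul_lt_top (by finiteness) (chaosMoment_lt_top 1)).ne).symm⟩
  refine ⟨M * (4 * C ^ 4 * T ^ κ * S), by positivity,
    fun N k d K hK hd t ht => ?_⟩
  have h := hz.lintegral_wickForm_increment_le hW hq0 (fun k hk => (hqk k hk).2) hκ.le
    (by linarith) (fun l m => if l + m = k then d l m else 0) N le_rfl (zero_le (a := t)) ht
  have h0 : ∫⁻ ω, ‖mode (wickPoly P z d N t ω) k‖ₑ ^ 2 ∂P = ∫⁻ ω,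
      ‖wickForm P z (fun l m => if l + m = k then d l m else 0) N t ω -
        wickForm P z (fun l m => if l + m = k then d l m else 0) N 0 ω‖ₑ ^ (2 * 1) ∂P := by
    refine lintegral_congr_ae ?_
    filter_upwards [hz.ae_wickForm_zero hW (fun l m => if l + m = k then d l m else 0) N] with ω hω
    rw [hω, sub_zero, mode_wickPoly]
  rw [h0]
  refine h.trans ?_
  have hcoef : ∑ l ∈ window N, ∑ m ∈ window N, ‖if l + m = k then d l m else 0‖ ^ 2 *
        (freqWeight (2 - 2 * γ - 2 * κ) l * freqWeight (2 - 2 * γ - 2 * κ) m) ≤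
      K ^ 2 * (S * (1 + |(k : ℝ)|) ^ (-(3 - 4 * γ - 9 * κ))) := by
    refine le_trans ?_ (mul_le_mul_of_nonneg_left (hsum N k) (sq_nonneg K))
    simp_rw [Finset.mul_sum]
    refine Finset.sum_le_sum fun l _ => Finset.sum_le_sum fun m _ => ?_
    have h1 := hd.sq_mul_freqWeight_le (2 - 2 * γ - 2 * κ) l m
    rw [show 2 - 2 * γ - 2 * κ - 2 * κ = 2 - 2 * γ - 4 * κ by ring] at h1
    split_ifs with h
    · exact h1
    · simp
  have htT : (t : ℝ) ≤ T := by exact_mod_cast ht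
  rw [pow_one, hM, ← ENNReal.ofReal_mul hM0]
  refine ENNReal.ofReal_le_ofReal ?_
  rw [NNReal.coe_zero, sub_zero]
  calc _ ≤ M * (4 * C ^ 4 * (T : ℝ) ^ κ *
        (K ^ 2 * (S * (1 + |(k : ℝ)|) ^ (-(3 - 4 * γ - 9 * κ))))) := by
        have h5 := Finset.sum_nonneg fun l (_ : l ∈ window N) => Finset.sum_nonneg
          fun m (_ : m ∈ window N) => mul_nonneg (sq_nonneg ‖if l + m = k then d l m else 0‖)
            (mul_nonneg (freqWeight_nonneg (2 - 2 * γ - 2 * κ) l)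
              (freqWeight_nonneg (2 - 2 * γ - 2 * κ) m))
        gcongr
    _ = _ := by ring

end Moments

/-! ### Dyadic chaining -/

/-- The dyadic times of `[0, T]`. -/
def dyadicTime (T : ℝ≥0) (m i : ℕ) : ℝ≥0 := T * (i / 2 ^ m)

lemma dyadicTime_le (T : ℝ≥0) {m i : ℕ} (hi : i ≤ 2 ^ m) : dyadicTime T m i ≤ T := by
  refine mul_le_of_le_one_right' (div_le_one_of_le₀ ?_ zero_le)
  exact_mod_cast hi

lemma dyadicTime_zero (T : ℝ≥0) (m : ℕ) : dyadicTime T m 0 = 0 := by simp [dyadicTime]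

lemma dyadicTime_two_mul (T : ℝ≥0) (m i : ℕ) : dyadicTime T (m + 1) (2 * i) = dyadicTime T m i := by
  unfold dyadicTime
  congr 1
  push_cast
  rw [pow_succ']
  exact mul_div_mul_left _ _ two_ne_zero

lemma dyadicTime_mono (T : ℝ≥0) (m : ℕ) {i j : ℕ} (h : i ≤ j) :
    dyadicTime T m i ≤ dyadicTime T m j := by
  unfold dyadicTime
  gcongr

lemma dyadicTime_succ_sub (T : ℝ≥0) (m i : ℕ) :
    (dyadicTime T m (i + 1) : ℝ) - dyadicTime T m i = T / 2 ^ m := by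
  unfold dyadicTime
  push_cast
  ring

lemma exists_tendsto_dyadicTime {T t : ℝ≥0} (hT : 0 < T) (ht : t ≤ T) :
    ∃ i : ℕ → ℕ, (∀ m, i m ≤ 2 ^ m) ∧ Tendsto (fun m => dyadicTime T m (i m)) atTop (𝓝 t) := by
  have hT' : (0 : ℝ) < T := hT
  have htT : (t : ℝ) ≤ T := ht
  refine ⟨fun m => ⌊(t / T * 2 ^ m : ℝ)⌋₊, fun m => ?_, ?_⟩
  · refine Nat.floor_le_of_le ?_
    push_cast
    exact mul_le_of_le_one_left (by positivity) ((div_le_one hT').2 htT)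
  · rw [← NNReal.tendsto_coe]
    have h0 : Tendsto (fun m : ℕ => (t : ℝ) - T * (1 / 2) ^ m) atTop (𝓝 t) := by
      have := (tendsto_pow_atTop_nhds_zero_of_lt_one (r := (1 / 2 : ℝ)) (by norm_num)
        (by norm_num)).const_mul (T : ℝ)
      simpa using this.const_sub (t : ℝ)
    have e : ∀ m : ℕ, (t : ℝ) = T * (t / T * 2 ^ m) / 2 ^ m := fun m => by field_simp
    refine tendsto_of_tendsto_of_tendsto_of_le_of_le h0 tendsto_const_nhds (fun m => ?_) fun m => ?_
    · have := (Nat.lt_floor_add_one (t / T * 2 ^ m : ℝ)).le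
      simp only [dyadicTime, NNReal.coe_mul, NNReal.coe_div, NNReal.coe_natCast, NNReal.coe_pow,
        NNReal.coe_ofNat]
      calc (t : ℝ) - T * (1 / 2) ^ m = T * (t / T * 2 ^ m - 1) / 2 ^ m := by
            rw [one_div, inv_pow]; field_simp
        _ ≤ T * (⌊(t / T * 2 ^ m : ℝ)⌋₊) / 2 ^ m := by gcongr; linarith
        _ = _ := by ring
    · have := Nat.floor_le (a := (t / T * 2 ^ m : ℝ)) (by positivity)
      simp only [dyadicTime, NNReal.coe_mul, NNReal.coe_div, NNReal.coe_natCast, NNReal.coe_pow,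
        NNReal.coe_ofNat]
      calc (T : ℝ) * (⌊(t / T * 2 ^ m : ℝ)⌋₊ / 2 ^ m) = T * (⌊(t / T * 2 ^ m : ℝ)⌋₊) / 2 ^ m := by
            ring
        _ ≤ T * (t / T * 2 ^ m) / 2 ^ m := by gcongr
        _ = t := (e m).symm

/-- A continuous path started at zero is controlled by its weighted dyadic increments. -/
lemma enorm_pow_le_tsum_dyadic {E : Type*} [NormedAddCommGroup E] {T : ℝ≥0} (hT : 0 < T)
    {f : ℝ≥0 → E} (hf : ContinuousOn f (Set.Iic T)) (hf0 : f 0 = 0) (L : ℝ≥0∞) (hL0 : L ≠ 0)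
    (hL1 : L ≠ ∞) {p : ℕ} (hp : 1 ≤ p) {t : ℝ≥0} (ht : t ≤ T) :
    ‖f t‖ₑ ^ p ≤ (1 - L⁻¹)⁻¹ ^ p * ∑' m : ℕ, (L ^ m) ^ p * ∑ i ∈ Finset.range (2 ^ m),
      ‖f (dyadicTime T m (i + 1)) - f (dyadicTime T m i)‖ₑ ^ p := by
  have hp0 : (0 : ℝ) < p := by exact_mod_cast hp
  set S := ∑' m : ℕ, (L ^ m) ^ p * ∑ i ∈ Finset.range (2 ^ m),
      ‖f (dyadicTime T m (i + 1)) - f (dyadicTime T m i)‖ₑ ^ p with hS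
  set D := S ^ ((p : ℝ)⁻¹) with hD
  have hDp : D ^ p = S := by
    rw [hD, ← ENNReal.rpow_natCast, ← ENNReal.rpow_mul, inv_mul_cancel₀ hp0.ne', ENNReal.rpow_one]
  -- `D` is the `ℓ^p` norm of all weighted increments, so it dominates each of them, and undoing the
  -- weight gains `L^{-m}`.
  have hinc : ∀ m i, i < 2 ^ m →
      ‖f (dyadicTime T m (i + 1)) - f (dyadicTime T m i)‖ₑ ≤ L⁻¹ ^ m * D := fun m i hi => by
    have h1 : (L ^ m * ‖f (dyadicTime T m (i + 1)) - f (dyadicTime T m i)‖ₑ) ^ p ≤ S := by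
      rw [mul_pow]
      refine le_trans (mul_le_mul_right ?_ _) (ENNReal.le_tsum m)
      exact Finset.single_le_sum (f := fun i =>
        ‖f (dyadicTime T m (i + 1)) - f (dyadicTime T m i)‖ₑ ^ p) (fun _ _ => zero_le)
        (Finset.mem_range.2 hi)
    have h2 : L ^ m * ‖f (dyadicTime T m (i + 1)) - f (dyadicTime T m i)‖ₑ ≤ D := by
      rw [hD, ENNReal.le_rpow_inv_iff hp0, ENNReal.rpow_natCast]
      exact h1
    calc _ = L⁻¹ ^ m * (L ^ m * ‖f (dyadicTime T m (i + 1)) - f (dyadicTime T m i)‖ₑ) := by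
          rw [← mul_assoc, ← mul_pow, ENNReal.inv_mul_cancel hL0 hL1, one_pow, one_mul]
      _ ≤ _ := by gcongr
  -- An even point of level `M + 1` already belongs to level `M`; an odd one is a single increment
  -- away from such a point. One increment per level is spent, and the geometric series in `L⁻¹`
  -- bounds the total.
  have hind : ∀ M i, i ≤ 2 ^ M →
      ‖f (dyadicTime T M i)‖ₑ ≤ ∑ m ∈ Finset.range (M + 1), L⁻¹ ^ m * D := by
    intro M
    induction M with
    | zero =>
      intro i hi
      rcases Nat.le_one_iff_eq_zero_or_eq_one.1 (by simpa using hi) with rfl | rfl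
      · rw [dyadicTime_zero, hf0]; simp
      · have := hinc 0 0 (by simp)
        rw [dyadicTime_zero, hf0, sub_zero] at this
        simpa using this
    | succ M ih =>
      intro i hi
      rw [Finset.sum_range_succ]
      rcases Nat.even_or_odd' i with ⟨j, rfl | rfl⟩
      · rw [dyadicTime_two_mul]
        refine (ih j ?_).trans le_self_add
        rw [pow_succ'] at hi; lia
      · have h1 := hinc (M + 1) (2 * j) (by lia)
        have h2 := ih j (by rw [pow_succ'] at hi; lia)
        rw [← sub_add_cancel (f (dyadicTime T (M + 1) (2 * j + 1))) (f (dyadicTime T (M + 1) (2 * j)))]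
        refine (enorm_add_le _ _).trans ?_
        rw [add_comm]
        refine add_le_add ?_ h1
        rwa [dyadicTime_two_mul]
  obtain ⟨i, hi, hlim⟩ := exists_tendsto_dyadicTime hT ht
  have hfl : Tendsto (fun m => ‖f (dyadicTime T m (i m))‖ₑ) atTop (𝓝 ‖f t‖ₑ) := by
    refine ((hf t ht).tendsto.comp (tendsto_nhdsWithin_iff.2 ⟨hlim, ?_⟩)).enorm
    exact Eventually.of_forall fun m => dyadicTime_le T (hi m)
  have hle : ‖f t‖ₑ ≤ (1 - L⁻¹)⁻¹ * D := by
    refine le_of_tendsto' hfl fun m => (hind m (i m) (hi m)).trans ?_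
    rw [← ENNReal.tsum_geometric, ← ENNReal.tsum_mul_right]
    exact ENNReal.sum_le_tsum _
  calc ‖f t‖ₑ ^ p ≤ ((1 - L⁻¹)⁻¹ * D) ^ p := pow_le_pow_left' hle p
    _ = _ := by rw [mul_pow, hDp]

/-! ### Continuity in time -/

section Continuity

variable {Ω : Type*} [MeasurableSpace Ω] {P : Measure Ω} [IsProbabilityMeasure P]
  {T : ℝ≥0} {q : ℤ → ℂ} {W : ℤ → ℝ≥0 → Ω → ℂ} {z : ℤ → ℝ≥0 → Ω → ℂ}

omit [IsProbabilityMeasure P] in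
lemma enorm_integral_mul_le {f g : Ω → ℂ} (hf : AEMeasurable f P) (hg : AEMeasurable g P) :
    ‖∫ ω, f ω * g ω ∂P‖ₑ ≤
      (∫⁻ ω, ‖f ω‖ₑ ^ 2 ∂P) ^ (1 / 2 : ℝ) * (∫⁻ ω, ‖g ω‖ₑ ^ 2 ∂P) ^ (1 / 2 : ℝ) := by
  refine (enorm_integral_le_lintegral_enorm _).trans ?_
  have := ENNReal.lintegral_mul_le_Lp_mul_Lq P Real.HolderConjugate.two_two hf.enorm hg.enorm
  simp only [Pi.mul_apply, ENNReal.rpow_ofNat] at this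
  simpa only [enorm_mul] using this

/-- The increment bound with exponent `1`. Dependence of its constant on `k` is harmless because the
mode is fixed. -/
lemma IsOrnsteinUhlenbeck.tendsto_lintegral_increment (hW : IsCylindricalBM P W)
    (hz : IsOrnsteinUhlenbeck P T q W z) (hq0 : q 0 = 0) (k : ℤ) {t : ℝ≥0} (ht : t ≤ T) :
    Tendsto (fun s => ∫⁻ ω, ‖z k s ω - z k t ω‖ₑ ^ 2 ∂P) (𝓝[Set.Iic T] t) (𝓝 0) := by
  have hb : ∀ s ≤ T, ∫⁻ ω, ‖z k s ω - z k t ω‖ₑ ^ 2 ∂P ≤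
      ENNReal.ofReal (‖q k‖ ^ 2 * 2 * |(s : ℝ) - t|) := by
    have key : ∀ {s t : ℝ≥0}, s ≤ t → t ≤ T → ∫⁻ ω, ‖z k t ω - z k s ω‖ₑ ^ 2 ∂P ≤
        ENNReal.ofReal (‖q k‖ ^ 2 * 2 * |(t : ℝ) - s|) := fun {s t} hst ht => by
      by_cases hk : k = 0
      · subst hk
        rw [lintegral_congr_ae (g := 0)]
        · simp
        · filter_upwards [hz.ae_zero_mode hW hq0 ht, hz.ae_zero_mode hW hq0 (hst.trans ht)]
            with ω h1 h2
          simp [h1, h2]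
      · refine (hz.lintegral_increment_le hW hk hst ht zero_le_one le_rfl).trans (le_of_eq ?_)
        have : (0 : ℝ) ≤ t - s := sub_nonneg.2 (by exact_mod_cast hst)
        rw [Real.rpow_one, abs_of_nonneg this]
        congr 1
        field_simp
    intro s hs
    rcases le_total s t with h | h
    · simp_rw [enorm_sub_rev (z k s _), abs_sub_comm (s : ℝ)]
      exact key h ht
    · exact key h hs
  refine tendsto_of_tendsto_of_tendsto_of_le_of_le' tendsto_const_nhds ?_
    (Eventually.of_forall fun _ => zero_le)
    (eventually_nhdsWithin_of_forall (s := Set.Iic T) fun s hs => hb s hs)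
  rw [← ENNReal.ofReal_zero]
  refine ENNReal.tendsto_ofReal (tendsto_nhdsWithin_of_tendsto_nhds ?_)
  have : Continuous fun s : ℝ≥0 => ‖q k‖ ^ 2 * 2 * |(s : ℝ) - t| := by fun_prop
  simpa using this.tendsto t

/-- The subtracted expectation must be continuous in time for Wick modes to have continuous paths.
Expand the product around time `t` and apply the Cauchy–Schwarz inequality to each term. -/
lemma IsOrnsteinUhlenbeck.continuousOn_integral_mul (hW : IsCylindricalBM P W)
    (hz : IsOrnsteinUhlenbeck P T q W z) (hq0 : q 0 = 0) (l m : ℤ) :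
    ContinuousOn (fun t => ∫ ω, z l t ω * z m t ω ∂P) (Set.Iic T) := by
  intro t ht
  have hI : ∀ {s t : ℝ≥0}, s ≤ T → t ≤ T → Integrable (fun ω => z l s ω * z m t ω) P :=
    fun hs ht => (hz.memLp l hs).integrable_mul (hz.memLp m ht)
  set a := fun s => ∫⁻ ω, ‖z l s ω - z l t ω‖ₑ ^ 2 ∂P
  set b := fun s => ∫⁻ ω, ‖z m s ω - z m t ω‖ₑ ^ 2 ∂P
  set A := ∫⁻ ω, ‖z l t ω‖ₑ ^ 2 ∂P
  set B := ∫⁻ ω, ‖z m t ω‖ₑ ^ 2 ∂P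
  have hA : A ≠ ∞ := by
    simp only [A]
    rw [lintegral_sq_eq_eLpNorm]
    exact ENNReal.pow_ne_top (hz.memLp l ht).2.ne
  have hB : B ≠ ∞ := by
    simp only [B]
    rw [lintegral_sq_eq_eLpNorm]
    exact ENNReal.pow_ne_top (hz.memLp m ht).2.ne
  have ha : Tendsto (fun s => a s ^ (1 / 2 : ℝ)) (𝓝[Set.Iic T] t) (𝓝 0) := by
    have := (hz.tendsto_lintegral_increment hW hq0 l ht).ennrpow_const (1 / 2 : ℝ)
    simpa using this
  have hb : Tendsto (fun s => b s ^ (1 / 2 : ℝ)) (𝓝[Set.Iic T] t) (𝓝 0) := by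
    have := (hz.tendsto_lintegral_increment hW hq0 m ht).ennrpow_const (1 / 2 : ℝ)
    simpa using this
  have hA' : A ^ (1 / 2 : ℝ) ≠ ∞ := by simp [hA]
  have hB' : B ^ (1 / 2 : ℝ) ≠ ∞ := by simp [hB]
  have hlim : Tendsto (fun s => a s ^ (1 / 2 : ℝ) * b s ^ (1 / 2 : ℝ) +
      a s ^ (1 / 2 : ℝ) * B ^ (1 / 2 : ℝ) + A ^ (1 / 2 : ℝ) * b s ^ (1 / 2 : ℝ))
      (𝓝[Set.Iic T] t) (𝓝 0) := by
    have h1 := ENNReal.Tendsto.mul ha (Or.inr ENNReal.zero_ne_top) hb (Or.inr ENNReal.zero_ne_top)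
    have h2 := ENNReal.Tendsto.mul_const ha (b := B ^ (1 / 2 : ℝ)) (Or.inr hB')
    have h3 := ENNReal.Tendsto.const_mul hb (a := A ^ (1 / 2 : ℝ)) (Or.inr hA')
    simpa using (h1.add h2).add h3
  rw [ContinuousWithinAt, tendsto_iff_edist_tendsto_0]
  refine tendsto_of_tendsto_of_tendsto_of_le_of_le' tendsto_const_nhds hlim
    (Eventually.of_forall fun _ => zero_le)
    (eventually_nhdsWithin_of_forall (s := Set.Iic T) fun s hs => ?_)
  rw [edist_eq_enorm_sub]
  have hm : ∀ (k : ℤ) {s : ℝ≥0}, s ≤ T → AEMeasurable (z k s) P := fun k s hs =>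
    (hz.measurable k s hs).aemeasurable
  have e : ∫ ω, z l s ω * z m s ω ∂P - ∫ ω, z l t ω * z m t ω ∂P =
      ∫ ω, (z l s ω - z l t ω) * (z m s ω - z m t ω) ∂P +
      ∫ ω, (z l s ω - z l t ω) * z m t ω ∂P + ∫ ω, z l t ω * (z m s ω - z m t ω) ∂P := by
    simp_rw [sub_mul, mul_sub]
    rw [integral_sub (show Integrable (fun ω => z l s ω * z m s ω - z l s ω * z m t ω) P from
        (hI hs hs).sub (hI hs ht)) (show Integrable (fun ω => z l t ω * z m s ω - z l t ω * z m t ω) P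
        from (hI ht hs).sub (hI ht ht)), integral_sub (hI hs hs) (hI hs ht), integral_sub (hI ht hs) (hI ht ht),
      integral_sub (hI hs ht) (hI ht ht)]
    ring
  rw [e]
  refine (enorm_add_le _ _).trans (add_le_add ((enorm_add_le _ _).trans (add_le_add ?_ ?_)) ?_)
  · exact enorm_integral_mul_le ((hm l hs).sub (hm l ht)) ((hm m hs).sub (hm m ht))
  · exact enorm_integral_mul_le ((hm l hs).sub (hm l ht)) (hm m ht)
  · exact enorm_integral_mul_le (hm l ht) ((hm m hs).sub (hm m ht))

lemma IsOrnsteinUhlenbeck.ae_continuousOn_mode (hW : IsCylindricalBM P W)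
    (hz : IsOrnsteinUhlenbeck P T q W z) (hq0 : q 0 = 0) :
    ∀ᵐ ω ∂P, ∀ d N k, ContinuousOn (fun t => mode (wickPoly P z d N t ω) k) (Set.Iic T) := by
  filter_upwards [hz.continuous] with ω hω d N k
  simp only [mode_wickPoly, wickForm, wickMode]
  exact continuousOn_finsetSum _ fun l _ => continuousOn_finsetSum _ fun m _ =>
    continuousOn_const.mul (((hω l).mul (hω m)).sub (hz.continuousOn_integral_mul hW hq0 l m))

lemma IsOrnsteinUhlenbeck.ae_wickPoly_zero (hW : IsCylindricalBM P W)
    (hz : IsOrnsteinUhlenbeck P T q W z) (d : ℤ → ℤ → ℂ) (N : ℕ) :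
    ∀ᵐ ω ∂P, wickPoly P z d N 0 ω = 0 := by
  have h := ae_all_iff.2 fun k => hz.ae_wickForm_zero hW (fun l m => if l + m = k then d l m else 0) N
  filter_upwards [h] with ω hω
  exact ext_mode hω

end Continuity

/-! ### Moments of the norm of `C_T 𝓒^β` -/

/-- A countable sum of increments over dyadic times and regular grids that dominates a power of the
norm of `C_T 𝓒^β`. -/
def chainBound (χ φ : ℝ → ℝ) (T : ℝ≥0) (β : ℝ) (L : ℝ≥0∞) (R p : ℕ)
    (F : ℝ≥0 → TorusDistribution) : ℝ≥0∞ :=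
  ∑' n : ℕ, ∑' m : ℕ, ENNReal.ofReal ((2 : ℝ) ^ (((n : ℝ) - 1) * β)) ^ p *
    (1 - L⁻¹)⁻¹ ^ p * (L ^ m) ^ p * 2 ^ p * ∑ i ∈ Finset.range (2 ^ m),
      ∑ j ∈ Finset.range (48 * (R * 2 ^ n) ^ 2),
        ‖lpBlock χ φ n (F (dyadicTime T m (i + 1))) (gridPoint (48 * (R * 2 ^ n) ^ 2) j) -
          lpBlock χ φ n (F (dyadicTime T m i)) (gridPoint (48 * (R * 2 ^ n) ^ 2) j)‖ₑ ^ p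

lemma le_rpow_natCast_inv_iff {p : ℕ} (hp : 1 ≤ p) {x S : ℝ≥0∞} :
    x ≤ S ^ (p : ℝ)⁻¹ ↔ x ^ p ≤ S := by
  rw [ENNReal.le_rpow_inv_iff (by exact_mod_cast hp), ENNReal.rpow_natCast]

/-- All three suprema are removed at once: blocks by summation, times by chaining each block as a
path in `C(Torus, ℂ)`, space by the grid. For Wick polynomials the resulting countable sum is
measurable in `ω` and can be integrated term by term. -/
lemma IsDyadicPartition.ctNorm_pow_le_chainBound {χ φ : ℝ → ℝ} (hχφ : IsDyadicPartition χ φ)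
    {R : ℕ} (hR : 1 ≤ R) (hsupp : ∀ n ξ, lpSymbol χ φ n ξ ≠ 0 → |ξ| ≤ R * 2 ^ n)
    {T : ℝ≥0} (hT : 0 < T) (β : ℝ) {L : ℝ≥0∞} (hL0 : L ≠ 0) (hL : L ≠ ∞) {p : ℕ} (hp : 1 ≤ p)
    {F : ℝ≥0 → TorusDistribution} (hF0 : F 0 = 0)
    (hF : ∀ k, ContinuousOn (fun t => mode (F t) k) (Set.Iic T)) :
    ctNorm χ φ T β F ^ p ≤ chainBound χ φ T β L R p F := by
  rw [← le_rpow_natCast_inv_iff hp]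
  refine iSup_le fun t => iSup_le fun n => ?_
  rw [le_rpow_natCast_inv_iff hp, mul_pow]
  have hgrid : ∀ u : TorusDistribution, ‖lpBlock χ φ n u‖ₑ ^ p ≤
      2 ^ p * ∑ j ∈ Finset.range (48 * (R * 2 ^ n) ^ 2),
        ‖lpBlock χ φ n u (gridPoint (48 * (R * 2 ^ n) ^ 2) j)‖ₑ ^ p := fun u => by
    refine enorm_pow_le_sum_grid (M := R * 2 ^ n) (Nat.one_le_iff_ne_zero.2 (by positivity))
      (fun k => (lpSymbol χ φ n (k : ℝ) : ℂ) * mode u k) _ (fun x => ?_) p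
    rw [lpBlock_eq_sum n u (s := window (R * 2 ^ n)) fun k hk _ => ?_]
    · simp [window]
    · have := hsupp n k hk
      rw [Finset.mem_Icc, ← abs_le]
      exact_mod_cast this
  have hcont : ContinuousOn (fun t => lpBlock χ φ n (F t)) (Set.Iic T) := fun s hs =>
    hχφ.tendsto_lpBlock n fun k => hF k s hs
  have h0 : lpBlock χ φ n (F 0) = 0 := by
    have := hχφ.lpBlock_sub n 0 0
    rw [sub_zero, sub_self] at this
    rw [hF0, this]
  refine le_trans (mul_le_mul_right (enorm_pow_le_tsum_dyadic hT hcont h0 L hL0 hL hp t.2) _) ?_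
  refine le_trans ?_ (ENNReal.le_tsum n)
  rw [← mul_assoc, ← ENNReal.tsum_mul_left]
  refine ENNReal.tsum_le_tsum fun m => ?_
  rw [← mul_assoc, mul_assoc _ (2 ^ p)]
  refine mul_le_mul_right ?_ _
  rw [Finset.mul_sum]
  refine Finset.sum_le_sum fun i _ => ?_
  rw [← hχφ.lpBlock_sub]
  refine (hgrid _).trans (le_of_eq ?_)
  rw [hχφ.lpBlock_sub]
  rfl

section Moments

variable {Ω : Type*} [MeasurableSpace Ω] {P : Measure Ω}
  {T : ℝ≥0} {q : ℤ → ℂ} {W : ℤ → ℝ≥0 → Ω → ℂ} {z : ℤ → ℝ≥0 → Ω → ℂ}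

lemma IsOrnsteinUhlenbeck.measurable_lpBlock (hz : IsOrnsteinUhlenbeck P T q W z) (χ φ : ℝ → ℝ)
    (n : ℕ) (d : ℤ → ℤ → ℂ) (N : ℕ) (x : Torus) {t : ℝ≥0} (ht : t ≤ T) :
    Measurable fun ω => lpBlock χ φ n (wickPoly P z d N t ω) x := by
  simp_rw [lpBlock_wickPoly]
  exact hz.measurable_wickForm _ _ ht

lemma IsOrnsteinUhlenbeck.measurable_lpBlock_increment (hz : IsOrnsteinUhlenbeck P T q W z)
    (χ φ : ℝ → ℝ) (n : ℕ) (d : ℤ → ℤ → ℂ) (N : ℕ) (x : Torus) (p : ℕ) {m i : ℕ}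
    (hi : i ∈ Finset.range (2 ^ m)) :
    Measurable fun ω => ‖lpBlock χ φ n (wickPoly P z d N (dyadicTime T m (i + 1)) ω) x -
      lpBlock χ φ n (wickPoly P z d N (dyadicTime T m i) ω) x‖ₑ ^ p := by
  rw [Finset.mem_range] at hi
  exact (((hz.measurable_lpBlock χ φ n d N x (dyadicTime_le T hi)).sub
    (hz.measurable_lpBlock χ φ n d N x (dyadicTime_le T hi.le))).enorm).pow_const _

lemma IsOrnsteinUhlenbeck.measurable_chainBound (hz : IsOrnsteinUhlenbeck P T q W z)
    (χ φ : ℝ → ℝ) (β : ℝ) (L : ℝ≥0∞) (R p : ℕ) (d : ℤ → ℤ → ℂ) (N : ℕ) :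
    Measurable fun ω => chainBound χ φ T β L R p fun t => wickPoly P z d N t ω := by
  unfold chainBound
  exact Measurable.tsum fun n => Measurable.tsum fun m => Measurable.const_mul
    (Finset.measurable_sum _ fun i hi => Finset.measurable_sum _ fun j _ =>
      hz.measurable_lpBlock_increment χ φ n d N _ p hi) _

lemma lintegral_chainBound_le (hz : IsOrnsteinUhlenbeck P T q W z)
    (χ φ : ℝ → ℝ) (β : ℝ) (L : ℝ≥0∞) (R p : ℕ) (d : ℤ → ℤ → ℂ) (N : ℕ) (B : ℕ → ℕ → ℝ≥0∞)
    (hB : ∀ n m i x, i < 2 ^ m →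
      ∫⁻ ω, ‖lpBlock χ φ n (wickPoly P z d N (dyadicTime T m (i + 1)) ω) x -
        lpBlock χ φ n (wickPoly P z d N (dyadicTime T m i) ω) x‖ₑ ^ p ∂P ≤ B n m) :
    ∫⁻ ω, chainBound χ φ T β L R p (fun t => wickPoly P z d N t ω) ∂P ≤
      ∑' n : ℕ, ∑' m : ℕ, ENNReal.ofReal ((2 : ℝ) ^ (((n : ℝ) - 1) * β)) ^ p *
        (1 - L⁻¹)⁻¹ ^ p * (L ^ m) ^ p * 2 ^ p * (2 ^ m * (48 * (R * 2 ^ n) ^ 2 * B n m)) := by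
  unfold chainBound
  have hm : ∀ n m, Measurable fun ω => ∑ i ∈ Finset.range (2 ^ m),
      ∑ j ∈ Finset.range (48 * (R * 2 ^ n) ^ 2),
        ‖lpBlock χ φ n (wickPoly P z d N (dyadicTime T m (i + 1)) ω)
          (gridPoint (48 * (R * 2 ^ n) ^ 2) j) - lpBlock χ φ n
          (wickPoly P z d N (dyadicTime T m i) ω) (gridPoint (48 * (R * 2 ^ n) ^ 2) j)‖ₑ ^ p :=
    fun n m => Finset.measurable_sum _ fun i hi => Finset.measurable_sum _ fun j _ =>
      hz.measurable_lpBlock_increment χ φ n d N _ p hi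
  rw [lintegral_tsum fun n => (Measurable.tsum fun m => (hm n m).const_mul _).aemeasurable]
  refine ENNReal.tsum_le_tsum fun n => ?_
  rw [lintegral_tsum fun m => ((hm n m).const_mul _).aemeasurable]
  refine ENNReal.tsum_le_tsum fun m => ?_
  rw [lintegral_const_mul _ (hm n m)]
  refine mul_le_mul_right ?_ _
  rw [lintegral_finsetSum _ fun i hi => Finset.measurable_sum _ fun j _ =>
      hz.measurable_lpBlock_increment χ φ n d N _ p hi]
  calc _ ≤ ∑ i ∈ Finset.range (2 ^ m), (48 * (R * 2 ^ n) ^ 2 * B n m : ℝ≥0∞) := by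
        refine Finset.sum_le_sum fun i hi => ?_
        rw [lintegral_finsetSum _ fun j _ => hz.measurable_lpBlock_increment χ φ n d N _ p hi]
        refine (Finset.sum_le_card_nsmul _ _ (B n m) fun j _ =>
          hB n m i _ (Finset.mem_range.1 hi)).trans (le_of_eq ?_)
        rw [Finset.card_range, nsmul_eq_mul]
        push_cast
        rfl
    _ = _ := by
        rw [Finset.sum_const, Finset.card_range, nsmul_eq_mul]
        push_cast
        rfl

/-- Bookkeeping of powers of two: Besov weight, chaining weight, `2^m` time intervals, order
`2^{2n}` grid points and the moment of one increment. The total separates into a geometric term in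
`n` and one in `m`. -/
lemma chain_exponents (n m r : ℕ) (β κ b K T : ℝ) (hT : 0 ≤ T) :
    ((2 : ℝ) ^ (((n : ℝ) - 1) * β)) ^ (2 * r) * (((2 : ℝ) ^ (κ / 4)) ^ m) ^ (2 * r) * 2 ^ m *
      (2 ^ n) ^ 2 * (K ^ 2 * (T / 2 ^ m) ^ κ * ((2 : ℝ) ^ n) ^ (1 - b)) ^ r =
    (2 : ℝ) ^ (-(2 * r * β)) * (T ^ κ) ^ r * K ^ (2 * r) *
      ((2 : ℝ) ^ (2 + r * (2 * β + 1 - b))) ^ n * ((2 : ℝ) ^ (1 - r * κ / 2)) ^ m := by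
  have h2 : (0 : ℝ) ≤ 2 := by norm_num
  have h2' : (0 : ℝ) < 2 := by norm_num
  rw [mul_pow (K ^ 2 * _), mul_pow (K ^ 2), Real.div_rpow hT (by positivity), div_pow, ← pow_mul K]
  simp only [← Real.rpow_natCast (2 : ℝ), ← Real.rpow_mul_natCast h2, ← Real.rpow_mul h2]
  rw [div_eq_mul_inv ((T ^ κ) ^ r), ← Real.rpow_neg h2]
  have e : ∀ x1 x2 x3 x4 x5 x6 A B : ℝ, (2 : ℝ) ^ x1 * 2 ^ x2 * 2 ^ x3 * 2 ^ x4 *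
      (A * (B * 2 ^ x5) * 2 ^ x6) = A * B * 2 ^ (x1 + x2 + x3 + x4 + x5 + x6) :=
    fun x1 x2 x3 x4 x5 x6 A B => by simp only [Real.rpow_add h2']; ring
  have e' : ∀ x1 x2 x3 A B : ℝ, (2 : ℝ) ^ x1 * B * A * 2 ^ x2 * 2 ^ x3 =
      A * B * 2 ^ (x1 + x2 + x3) :=
    fun x1 x2 x3 A B => by simp only [Real.rpow_add h2']; ring
  rw [e, e']
  congr 2
  push_cast
  ring

/-- Moments of the norm of `C_T 𝓒^β` of a Wick polynomial, uniformly in its degree. -/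
theorem IsOrnsteinUhlenbeck.exists_ctNorm_moment_le [IsProbabilityMeasure P]
    (hW : IsCylindricalBM P W) (hz : IsOrnsteinUhlenbeck P T q W z) (hT : 0 < T)
    {γ : ℝ} (hγ : 1 / 2 ≤ γ) (hq : IsComparableSymbol γ q)
    {χ φ : ℝ → ℝ} (hχφ : IsDyadicPartition χ φ) {κ : ℝ} (hκ : 0 < κ)
    (hκγ : 9 * κ ≤ 3 - 4 * γ) {β : ℝ} {r : ℕ} (hr : 1 ≤ r) (hr2 : 2 < r * κ)
    (hrβ : 1 < r * (1 - 2 * γ - β - 9 * κ / 2)) :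
    ∃ C : ℝ≥0∞, C < ∞ ∧ ∀ (N : ℕ) (d : ℤ → ℤ → ℂ) (K : ℝ), 0 ≤ K → HasSymbolBound κ K d →
      ∃ Z : Ω → ℝ≥0∞, Measurable Z ∧
        (∀ᵐ ω ∂P, (ctNorm χ φ T β fun t => wickPoly P z d N t ω) ^ (2 * r) ≤ Z ω) ∧
        ∫⁻ ω, Z ω ∂P ≤ C * ENNReal.ofReal K ^ (2 * r) := by
  obtain ⟨C, hC, hblock⟩ := hz.exists_lintegral_lpBlock_le hW hγ hq hχφ hκ hκγ hr
  obtain ⟨R, hR, hsupp⟩ := hχφ.exists_le_two_pow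
  -- The weight exceeds `1`, as chaining requires, yet costs only `2^{rκm/2}`, half of the gain
  -- `2^{-rκm}` from the increments.
  set L : ℝ≥0∞ := ENNReal.ofReal ((2 : ℝ) ^ (κ / 4)) with hL
  have hL1 : 1 < L := by
    rw [hL, ← ENNReal.ofReal_one]
    exact (ENNReal.ofReal_lt_ofReal_iff (by positivity)).2
      (Real.one_lt_rpow one_lt_two (by positivity))
  have hLinv : (1 - L⁻¹)⁻¹ ≠ ∞ := by
    rw [Ne, ENNReal.inv_eq_top, tsub_eq_zero_iff_le, not_le]
    exact ENNReal.inv_lt_one.2 hL1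
  -- The exponent equals `2 - 2r(1 - 2γ - β - 9κ/2)`, negative by `hrβ`. The ratio `ρ₂` in the time
  -- levels is below one by `hr2`.
  set ρ₁ : ℝ≥0∞ := ENNReal.ofReal ((2 : ℝ) ^ (2 + r * (2 * β + 1 - (3 - 4 * γ - 9 * κ)))) with hρ₁
  set ρ₂ : ℝ≥0∞ := ENNReal.ofReal ((2 : ℝ) ^ (1 - r * κ / 2)) with hρ₂
  have h1 : ρ₁ < 1 := by
    rw [hρ₁, ENNReal.ofReal_lt_one]
    exact Real.rpow_lt_one_of_one_lt_of_neg one_lt_two (by nlinarith)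
  have h2 : ρ₂ < 1 := by
    rw [hρ₂, ENNReal.ofReal_lt_one]
    exact Real.rpow_lt_one_of_one_lt_of_neg one_lt_two (by linarith)
  have hgeo : ∀ {ρ : ℝ≥0∞}, ρ < 1 → (1 - ρ)⁻¹ ≠ ∞ := fun {ρ} h => by
    rw [Ne, ENNReal.inv_eq_top, tsub_eq_zero_iff_le, not_le]
    exact h
  set A : ℝ≥0∞ := (1 - L⁻¹)⁻¹ ^ (2 * r) * 2 ^ (2 * r) * (48 * R ^ 2) * C *
    ENNReal.ofReal ((2 : ℝ) ^ (-(2 * r * β)) * ((T : ℝ) ^ κ) ^ r) with hA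
  have hA' : A ≠ ∞ := by
    have := hC.ne
    rw [hA]
    finiteness
  refine ⟨A * ((1 - ρ₁)⁻¹ * (1 - ρ₂)⁻¹), (ENNReal.mul_ne_top hA'
    (ENNReal.mul_ne_top (hgeo h1) (hgeo h2))).lt_top, fun N d K hK hd => ?_⟩
  refine ⟨fun ω => chainBound χ φ T β L R (2 * r) fun t => wickPoly P z d N t ω,
    hz.measurable_chainBound χ φ β L R (2 * r) d N, ?_, ?_⟩
  · filter_upwards [hz.ae_continuousOn_mode hW hq.1, hz.ae_wickPoly_zero hW d N] with ω h1 h2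
    exact hχφ.ctNorm_pow_le_chainBound hR hsupp hT β (zero_lt_one.trans hL1).ne'
      ENNReal.ofReal_ne_top (by lia) h2 (h1 d N)
  · refine (lintegral_chainBound_le hz χ φ β L R (2 * r) d N
      (fun n m => C * ENNReal.ofReal (K ^ 2 * (T / 2 ^ m) ^ κ *
        ((2 : ℝ) ^ n) ^ (1 - (3 - 4 * γ - 9 * κ))) ^ r) fun n m i x hi => ?_).trans ?_
    · have := hblock n N x d K hK hd _ _ (dyadicTime_mono T m i.le_succ) (dyadicTime_le T hi)
      rwa [dyadicTime_succ_sub] at this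
    · calc _ = ∑' n : ℕ, ∑' m : ℕ, (A * ENNReal.ofReal K ^ (2 * r)) * ρ₁ ^ n * ρ₂ ^ m := by
            refine tsum_congr fun n => tsum_congr fun m => ?_
            have h := congrArg ENNReal.ofReal
              (chain_exponents n m r β κ (3 - 4 * γ - 9 * κ) K T T.2)
            have e2 : ∀ j : ℕ, ENNReal.ofReal ((2 : ℝ) ^ j) = 2 ^ j := fun j => by
              rw [ENNReal.ofReal_pow zero_le_two, ENNReal.ofReal_ofNat]
            have hl : ENNReal.ofReal ((2 : ℝ) ^ (((n : ℝ) - 1) * β)) ^ (2 * r) *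
                (L ^ m) ^ (2 * r) * 2 ^ m * (2 ^ n) ^ 2 * ENNReal.ofReal (K ^ 2 * (T / 2 ^ m) ^ κ *
                  ((2 : ℝ) ^ n) ^ (1 - (3 - 4 * γ - 9 * κ))) ^ r =
                ENNReal.ofReal ((2 : ℝ) ^ (-(2 * r * β)) * ((T : ℝ) ^ κ) ^ r) *
                  ENNReal.ofReal K ^ (2 * r) * ρ₁ ^ n * ρ₂ ^ m := by
              rw [hL, hρ₁, hρ₂, ← e2 m, ← e2 n]
              simp_rw [← ENNReal.ofReal_pow hK]
              rw [← ENNReal.ofReal_pow (by positivity), ← ENNReal.ofReal_pow (by positivity),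
                ← ENNReal.ofReal_pow (by positivity), ← ENNReal.ofReal_pow (by positivity),
                ← ENNReal.ofReal_pow (by positivity), ← ENNReal.ofReal_pow (by positivity),
                ← ENNReal.ofReal_pow (by positivity), ← ENNReal.ofReal_mul (by positivity),
                ← ENNReal.ofReal_mul (by positivity), ← ENNReal.ofReal_mul (by positivity),
                ← ENNReal.ofReal_mul (by positivity), ← ENNReal.ofReal_mul (by positivity),
                ← ENNReal.ofReal_mul (by positivity), ← ENNReal.ofReal_mul (by positivity)]
              exact h
            calc _ = (1 - L⁻¹)⁻¹ ^ (2 * r) * 2 ^ (2 * r) * (48 * R ^ 2) * C *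
                  (ENNReal.ofReal ((2 : ℝ) ^ (((n : ℝ) - 1) * β)) ^ (2 * r) *
                (L ^ m) ^ (2 * r) * 2 ^ m * (2 ^ n) ^ 2 * ENNReal.ofReal (K ^ 2 * (T / 2 ^ m) ^ κ *
                  ((2 : ℝ) ^ n) ^ (1 - (3 - 4 * γ - 9 * κ))) ^ r) := by ring
              _ = _ := by rw [hl, hA]; ring
        _ = _ := by
            simp_rw [ENNReal.tsum_mul_left, ENNReal.tsum_mul_right, ENNReal.tsum_mul_left,
              ENNReal.tsum_geometric]
            ring
        _ ≤ _ := le_rfl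

end Moments

/-! ### Cutoffs -/

/-- The symbol of the square of the regularised process. -/
def cutoffSymbol (ψ : ℝ → ℝ) (ε : ℝ) (l m : ℤ) : ℂ := (ψ (ε * l) : ℂ) * (ψ (ε * m) : ℂ)

section Cutoff

variable {ψ : ℝ → ℝ} (hψ : IsCutoff ψ)
include hψ

lemma IsCutoff.exists_window {ε : ℝ} (hε : 0 < ε) :
    ∃ N : ℕ, ∀ M, N ≤ M → ∀ k : ℤ, ψ (ε * k) ≠ 0 → k ∈ window M := by
  obtain ⟨S, hS⟩ := hψ.compact.isBounded.exists_norm_le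
  refine ⟨⌈S / ε⌉₊, fun M hM k hk => ?_⟩
  have h1 := hS _ (subset_tsupport _ hk)
  rw [Real.norm_eq_abs, abs_mul, abs_of_pos hε] at h1
  have h2 : |(k : ℝ)| ≤ M := by
    refine le_trans ?_ (Nat.ceil_le.1 hM)
    rw [le_div_iff₀ hε]; linarith
  rw [Finset.mem_Icc, ← abs_le]
  exact_mod_cast h2

lemma IsCutoff.exists_abs_le : ∃ B : ℝ, 1 ≤ B ∧ ∀ x, |ψ x| ≤ B := by
  obtain ⟨B, hB⟩ := hψ.compact.exists_bound_of_continuous hψ.smooth.continuous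
  refine ⟨B, ?_, hB⟩
  simpa [hψ.at_zero] using hB 0

/-- Lipschitz continuity for `|x| ≤ 1`, where `|x| ≤ |x|^κ`, and boundedness of `ψ` elsewhere, where
`1 ≤ |x|^κ`. -/
lemma IsCutoff.exists_abs_sub_one_le {κ : ℝ} (hκ : 0 ≤ κ) (hκ1 : κ ≤ 1) :
    ∃ C : ℝ, 0 ≤ C ∧ ∀ x, |ψ x - 1| ≤ C * |x| ^ κ := by
  obtain ⟨B, hB1, hB⟩ := hψ.exists_abs_le
  obtain ⟨L, hL⟩ := hψ.smooth.lipschitzWith_of_hasCompactSupport hψ.compact (by simp)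
  refine ⟨L + (B + 1), by positivity, fun x => ?_⟩
  rcases le_total |x| 1 with hx | hx
  · have h1 := hL.dist_le_mul x 0
    rw [Real.dist_eq, Real.dist_eq, hψ.at_zero, sub_zero] at h1
    have h2 : |x| ≤ |x| ^ κ := by
      rcases (abs_nonneg x).eq_or_lt with h0 | h0
      · rw [← h0]; positivity
      · simpa using Real.rpow_le_rpow_of_exponent_ge h0 hx hκ1
    have h3 : 0 ≤ (B + 1) * |x| ^ κ := by positivity
    have h4 : (L : ℝ) * |x| ≤ L * |x| ^ κ := by gcongr
    linarith
  · have h1 : |ψ x - 1| ≤ B + 1 := (abs_sub _ _).trans (by simpa using hB x)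
    have h2 : 1 ≤ |x| ^ κ := Real.one_le_rpow hx hκ
    have h3 : 0 ≤ (L : ℝ) := L.2
    nlinarith

lemma IsCutoff.exists_hasSymbolBound {κ : ℝ} (hκ : 0 ≤ κ) :
    ∃ K : ℝ, 0 ≤ K ∧ ∀ ε, HasSymbolBound κ K (cutoffSymbol ψ ε) := by
  obtain ⟨B, hB1, hB⟩ := hψ.exists_abs_le
  refine ⟨B * B, by positivity, fun ε l m hl hm => ?_⟩
  rw [cutoffSymbol, norm_mul, Complex.norm_real, Complex.norm_real]
  have h1 := Real.one_le_rpow (one_le_abs_intCast hl) hκ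
  have h2 := Real.one_le_rpow (one_le_abs_intCast hm) hκ
  calc ‖ψ (ε * l)‖ * ‖ψ (ε * m)‖ ≤ B * B := by gcongr <;> exact hB _
    _ ≤ B * B * (|(l : ℝ)| ^ κ * |(m : ℝ)| ^ κ) := by
        refine le_mul_of_one_le_right (by positivity) ?_
        nlinarith

/-- Both symbols are compared with the constant symbol `1`, each at a cost of `2CBρ^κ`. The rate is
paid for by growth in `l` and `m`, for which the moment bounds leave room. -/
lemma IsCutoff.exists_hasSymbolBound_sub {κ : ℝ} (hκ : 0 ≤ κ) (hκ1 : κ ≤ 1) :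
    ∃ K : ℝ, 0 ≤ K ∧ ∀ ρ ε δ, 0 < ε → ε ≤ ρ → 0 < δ → δ ≤ ρ →
      HasSymbolBound κ (K * ρ ^ κ) fun l m => cutoffSymbol ψ ε l m - cutoffSymbol ψ δ l m := by
  obtain ⟨B, hB1, hB⟩ := hψ.exists_abs_le
  obtain ⟨C, hC, h⟩ := hψ.exists_abs_sub_one_le hκ hκ1
  have key : ∀ ρ ε, 0 < ε → ε ≤ ρ → ∀ l m : ℤ, l ≠ 0 → m ≠ 0 →
      ‖cutoffSymbol ψ ε l m - 1‖ ≤ 2 * (C * B) * ρ ^ κ * (|(l : ℝ)| ^ κ * |(m : ℝ)| ^ κ) := by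
    intro ρ ε hε hερ l m hl hm
    have h1 := Real.one_le_rpow (one_le_abs_intCast hl) hκ
    have h2 := Real.one_le_rpow (one_le_abs_intCast hm) hκ
    have hk : ∀ k : ℤ, |ψ (ε * k) - 1| ≤ C * (ρ ^ κ * |(k : ℝ)| ^ κ) := fun k => by
      refine (h _).trans ?_
      rw [abs_mul, abs_of_pos hε, Real.mul_rpow hε.le (abs_nonneg _)]
      gcongr
    have hρ : 0 ≤ ρ ^ κ := Real.rpow_nonneg (hε.le.trans hερ) κ
    have e : cutoffSymbol ψ ε l m - 1 =
        (((ψ (ε * l) - 1) * ψ (ε * m) + (ψ (ε * m) - 1) : ℝ) : ℂ) := by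
      rw [cutoffSymbol]; push_cast; ring
    rw [e, Complex.norm_real, Real.norm_eq_abs]
    calc |(ψ (ε * l) - 1) * ψ (ε * m) + (ψ (ε * m) - 1)|
        ≤ |ψ (ε * l) - 1| * |ψ (ε * m)| + |ψ (ε * m) - 1| := by
          rw [← abs_mul]; exact abs_add_le _ _
      _ ≤ C * (ρ ^ κ * |(l : ℝ)| ^ κ) * B + C * (ρ ^ κ * |(m : ℝ)| ^ κ) := by
          gcongr
          · exact hk l
          · exact hB _
          · exact hk m
      _ ≤ C * (ρ ^ κ * (|(l : ℝ)| ^ κ * |(m : ℝ)| ^ κ)) * B +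
          C * (ρ ^ κ * (|(l : ℝ)| ^ κ * |(m : ℝ)| ^ κ)) * B := by
          refine add_le_add ?_ ?_
          · gcongr
            exact le_mul_of_one_le_right (by positivity) h2
          · refine le_trans ?_ (le_mul_of_one_le_right (by positivity) hB1)
            gcongr
            exact le_mul_of_one_le_left (by positivity) h1
      _ = _ := by ring
  refine ⟨4 * (C * B), by positivity, fun ρ ε δ hε hερ hδ hδρ l m hl hm => ?_⟩
  have h1 := key ρ ε hε hερ l m hl hm
  have h2 := key ρ δ hδ hδρ l m hl hm
  have h3 := norm_sub_le (cutoffSymbol ψ ε l m - 1) (cutoffSymbol ψ δ l m - 1)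
  rw [sub_sub_sub_cancel_right] at h3
  linarith

end Cutoff

/-! ### Domination of the renormalised squares -/

lemma ctNorm_congr (χ φ : ℝ → ℝ) {T : ℝ≥0} (β : ℝ) {u v : ℝ≥0 → TorusDistribution}
    (h : ∀ t ≤ T, u t = v t) : ctNorm χ φ T β u = ctNorm χ φ T β v :=
  iSup_congr fun t => by rw [h t t.2]

section Wick

variable {Ω : Type*} [MeasurableSpace Ω] {P : Measure Ω}
  {T : ℝ≥0} {q : ℤ → ℂ} {W : ℤ → ℝ≥0 → Ω → ℂ} {z : ℤ → ℝ≥0 → Ω → ℂ} {ψ : ℝ → ℝ}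

/-- For a common degree, the renormalised squares are Wick polynomials. -/
lemma IsOrnsteinUhlenbeck.exists_wickSquare_eq (hz : IsOrnsteinUhlenbeck P T q W z)
    (hψ : IsCutoff ψ) {ε : ℝ} (hε : 0 < ε) : ∃ N : ℕ, ∀ M, N ≤ M → ∀ t ≤ T, ∀ ω,
      wickSquare P ψ z ε t ω = wickPoly P z (cutoffSymbol ψ ε) M t ω := by
  obtain ⟨N, hN⟩ := hψ.exists_window hε
  exact ⟨N, fun M hM t ht ω => wickSquare_eq_wickPoly P z hz ht ψ ε (hN M hM) ω⟩

lemma IsOrnsteinUhlenbeck.measurable_mode_wickSquare (hz : IsOrnsteinUhlenbeck P T q W z)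
    (hψ : IsCutoff ψ) {ε : ℝ} (hε : 0 < ε) {t : ℝ≥0} (ht : t ≤ T) (k : ℤ) :
    Measurable fun ω => mode (wickSquare P ψ z ε t ω) k := by
  obtain ⟨N, hN⟩ := hz.exists_wickSquare_eq hψ hε
  simp_rw [hN N le_rfl t ht, mode_wickPoly]
  exact hz.measurable_wickForm _ _ ht

variable [IsProbabilityMeasure P] (hW : IsCylindricalBM P W) (hz : IsOrnsteinUhlenbeck P T q W z)
  (hT : 0 < T) {γ : ℝ} (hγ : 1 / 2 ≤ γ) (hq : IsComparableSymbol γ q)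
  {χ φ : ℝ → ℝ} (hχφ : IsDyadicPartition χ φ) (hψ : IsCutoff ψ)
include hW hz hT hγ hq hχφ hψ

lemma IsOrnsteinUhlenbeck.exists_wickSquare_bound {κ : ℝ} (hκ : 0 < κ)
    (hκγ : 9 * κ ≤ 3 - 4 * γ) {β : ℝ} {r : ℕ} (hr : 1 ≤ r) (hr2 : 2 < r * κ)
    (hrβ : 1 < r * (1 - 2 * γ - β - 9 * κ / 2)) {ε : ℝ} (hε : 0 < ε) :
    ∃ Z : Ω → ℝ≥0∞, Measurable Z ∧
      (∀ᵐ ω ∂P, (ctNorm χ φ T β fun t => wickSquare P ψ z ε t ω) ^ (2 * r) ≤ Z ω) ∧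
      ∫⁻ ω, Z ω ∂P < ∞ := by
  obtain ⟨C, hC, h⟩ := hz.exists_ctNorm_moment_le hW hT hγ hq hχφ hκ hκγ hr hr2 hrβ
  obtain ⟨K, hK, hd⟩ := hψ.exists_hasSymbolBound hκ.le
  obtain ⟨N, hN⟩ := hz.exists_wickSquare_eq hψ hε
  obtain ⟨Z, hZ, hle, hint⟩ := h N _ K hK (hd ε)
  refine ⟨Z, hZ, ?_, hint.trans_lt (ENNReal.mul_lt_top hC (by simp))⟩
  filter_upwards [hle] with ω hω
  rwa [ctNorm_congr χ φ β fun t ht => hN N le_rfl t ht ω]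

lemma IsOrnsteinUhlenbeck.exists_wickSquare_sub_bound {κ : ℝ} (hκ : 0 < κ)
    (hκγ : 9 * κ ≤ 3 - 4 * γ) {β : ℝ} {r : ℕ} (hr : 1 ≤ r) (hr2 : 2 < r * κ)
    (hrβ : 1 < r * (1 - 2 * γ - β - 9 * κ / 2)) :
    ∃ C : ℝ≥0∞, C < ∞ ∧ ∀ ρ ε δ : ℝ, 0 < ε → ε ≤ ρ → 0 < δ → δ ≤ ρ →
      ∃ Z : Ω → ℝ≥0∞, Measurable Z ∧
        (∀ᵐ ω ∂P, (ctNorm χ φ T β fun t => wickSquare P ψ z ε t ω - wickSquare P ψ z δ t ω)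
          ^ (2 * r) ≤ Z ω) ∧
        ∫⁻ ω, Z ω ∂P ≤ C * ENNReal.ofReal (ρ ^ κ) ^ (2 * r) := by
  obtain ⟨C, hC, h⟩ := hz.exists_ctNorm_moment_le hW hT hγ hq hχφ hκ hκγ hr hr2 hrβ
  obtain ⟨K, hK, hd⟩ := hψ.exists_hasSymbolBound_sub hκ.le (by linarith)
  refine ⟨C * ENNReal.ofReal K ^ (2 * r), ENNReal.mul_lt_top hC (by simp),
    fun ρ ε δ hε hερ hδ hδρ => ?_⟩
  have hρ : 0 ≤ ρ := hε.le.trans hερ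
  obtain ⟨N, hN⟩ := hz.exists_wickSquare_eq hψ hε
  obtain ⟨M, hM⟩ := hz.exists_wickSquare_eq hψ hδ
  -- With a common degree the difference of the two squares is a single Wick polynomial.
  obtain ⟨Z, hZ, hle, hint⟩ := h (max N M) _ (K * ρ ^ κ) (by positivity) (hd ρ ε δ hε hερ hδ hδρ)
  refine ⟨Z, hZ, ?_, hint.trans (le_of_eq ?_)⟩
  · filter_upwards [hle] with ω hω
    rwa [ctNorm_congr χ φ β fun t ht => by
      rw [hN _ (le_max_left N M) t ht ω, hM _ (le_max_right N M) t ht ω, wickPoly_sub]]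
  · rw [ENNReal.ofReal_mul hK, mul_pow, mul_assoc]

omit hT hχφ in
lemma IsOrnsteinUhlenbeck.exists_lintegral_mode_wickSquare_le {κ : ℝ} (hκ : 0 < κ)
    (hκγ : 9 * κ ≤ 3 - 4 * γ) :
    ∃ C : ℝ, 0 ≤ C ∧ ∀ ε, 0 < ε → ∀ k : ℤ, ∀ t ≤ T,
      ∫⁻ ω, ‖mode (wickSquare P ψ z ε t ω) k‖ₑ ^ 2 ∂P ≤
        ENNReal.ofReal (C * (1 + |(k : ℝ)|) ^ (-(3 - 4 * γ - 9 * κ))) := by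
  obtain ⟨C, hC, h⟩ := hz.exists_lintegral_mode_le hW hγ hq hκ hκγ
  obtain ⟨K, hK, hd⟩ := hψ.exists_hasSymbolBound hκ.le
  refine ⟨C * K ^ 2, by positivity, fun ε hε k t ht => ?_⟩
  obtain ⟨N, hN⟩ := hz.exists_wickSquare_eq hψ hε
  simp_rw [hN N le_rfl t ht]
  exact h N k _ K hK (hd ε) t ht

end Wick

/-! ### Construction of the limit -/

/-- Each mode is a Cauchy sequence with total variation `O((1 + |k|)²)`, so the limit differs from
`x 0` by a family of polynomial growth and is a distribution. -/
lemma IsDyadicPartition.exists_tendsto_mode {χ φ : ℝ → ℝ} (hχφ : IsDyadicPartition χ φ)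
    {x : ℕ → TorusDistribution} (hx : ∑' n, besovNorm χ φ (-1) (x n - x (n + 1)) ≠ ∞) :
    ∃ u : TorusDistribution, ∀ k, Tendsto (fun n => mode (x n) k) atTop (𝓝 (mode u k)) := by
  obtain ⟨C, hC, h⟩ := hχφ.exists_enorm_mode_le
  set S := ∑' n, besovNorm χ φ (-1) (x n - x (n + 1))
  have hd : ∀ (k : ℤ) (n : ℕ), edist (mode (x n) k) (mode (x n.succ) k) ≤
      ENNReal.ofReal (C * (1 + |(k : ℝ)|) ^ 2) * besovNorm χ φ (-1) (x n - x (n + 1)) :=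
    fun k n => by
      rw [edist_eq_enorm_sub, ← mode_sub]
      exact h _ k
  have hsum : ∀ k : ℤ, ∑' n, ENNReal.ofReal (C * (1 + |(k : ℝ)|) ^ 2) *
      besovNorm χ φ (-1) (x n - x (n + 1)) = ENNReal.ofReal (C * (1 + |(k : ℝ)|) ^ 2) * S :=
    fun k => ENNReal.tsum_mul_left
  have hlim : ∀ k, ∃ y, Tendsto (fun n => mode (x n) k) atTop (𝓝 y) := fun k =>
    cauchySeq_tendsto_of_complete (cauchySeq_of_edist_le_of_tsum_ne_top _ (hd k)
      (by rw [hsum]; exact ENNReal.mul_ne_top ENNReal.ofReal_ne_top hx))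
  choose y hy using hlim
  have hgrowth : ∀ k : ℤ, ‖y k - mode (x 0) k‖ ≤ C * S.toReal * (1 + |(k : ℝ)|) ^ 2 := fun k => by
    have h1 := edist_le_tsum_of_edist_le_of_tendsto₀ _ (hd k) (hy k)
    rw [hsum, edist_comm, edist_eq_enorm_sub, ← ENNReal.ofReal_toReal hx,
      ← ENNReal.ofReal_mul (by positivity), ← ofReal_norm,
      ENNReal.ofReal_le_ofReal_iff (by positivity)] at h1
    linarith
  let v : TorusDistribution := ⟨fun k => y k - mode (x 0) k, C * S.toReal, 2, hgrowth⟩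
  refine ⟨x 0 + v, fun k => ?_⟩
  have : mode (x 0 + v) k = y k := by
    rw [mode_add]
    exact add_sub_cancel _ _
  rw [this]
  exact hy k

/-- Jensen inequality for an exponent at most one. -/
lemma lintegral_rpow_le {Ω : Type*} [MeasurableSpace Ω] {P : Measure Ω} [IsProbabilityMeasure P]
    {Z : Ω → ℝ≥0∞} (hZ : Measurable Z) {s : ℝ} (hs : 0 < s) (hs1 : s ≤ 1) :
    ∫⁻ ω, Z ω ^ s ∂P ≤ (∫⁻ ω, Z ω ∂P) ^ s := by
  have h := lintegral_rpow_le_rpow P (hZ.pow_const s).aemeasurable ((one_le_inv₀ hs).2 hs1)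
  simp_rw [← ENNReal.rpow_mul, mul_inv_cancel₀ hs.ne', ENNReal.rpow_one] at h
  rwa [ENNReal.rpow_inv_le_iff hs] at h

/-- A Lyapunov inequality through the measurable majorant `Z`. No measurability of `X` is assumed,
which matters because the norm of `C_T 𝓒^β` is a supremum over uncountably many times. -/
lemma lintegral_rpow_le_of_pow_le {Ω : Type*} [MeasurableSpace Ω] {P : Measure Ω}
    [IsProbabilityMeasure P] {X Z : Ω → ℝ≥0∞} (hZ : Measurable Z) {n : ℕ}
    (h : ∀ᵐ ω ∂P, X ω ^ n ≤ Z ω) {p : ℝ} (hp : 0 < p) (hpn : p ≤ n) :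
    ∫⁻ ω, X ω ^ p ∂P ≤ (∫⁻ ω, Z ω ∂P) ^ (p / n) := by
  have hn : (0 : ℝ) < n := hp.trans_le hpn
  refine le_trans (lintegral_mono_ae ?_)
    (lintegral_rpow_le hZ (div_pos hp hn) ((div_le_one hn).2 hpn))
  filter_upwards [h] with ω hω
  calc X ω ^ p = (X ω ^ n) ^ (p / n) := by
        rw [← ENNReal.rpow_natCast, ← ENNReal.rpow_mul, mul_div_cancel₀ _ hn.ne']
    _ ≤ _ := ENNReal.rpow_le_rpow hω (by positivity)

/-- The `p`-th roots of the majorants have geometrically decaying means, so their sum has finite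
expectation. -/
lemma ae_tsum_ne_top_of_pow_le {Ω : Type*} [MeasurableSpace Ω] {P : Measure Ω}
    [IsProbabilityMeasure P] {X Z : ℕ → Ω → ℝ≥0∞} (hZ : ∀ n, Measurable (Z n)) {p : ℕ}
    (hp : 1 ≤ p) (h : ∀ n, ∀ᵐ ω ∂P, X n ω ^ p ≤ Z n ω) {C ρ : ℝ≥0∞} (hC : C < ∞) (hρ : ρ < 1)
    (hint : ∀ n, ∫⁻ ω, Z n ω ∂P ≤ C * (ρ ^ n) ^ p) : ∀ᵐ ω ∂P, ∑' n, X n ω ≠ ∞ := by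
  have hp0 : (0 : ℝ) < p := by exact_mod_cast hp
  have hroot : ∀ n, ∫⁻ ω, Z n ω ^ (p : ℝ)⁻¹ ∂P ≤ C ^ (p : ℝ)⁻¹ * ρ ^ n := fun n => by
    refine (lintegral_rpow_le (hZ n) (inv_pos.2 hp0) (inv_le_one_of_one_le₀
      (by exact_mod_cast hp))).trans ?_
    refine (ENNReal.rpow_le_rpow (hint n) (inv_nonneg.2 hp0.le)).trans (le_of_eq ?_)
    rw [ENNReal.mul_rpow_of_nonneg _ _ (inv_nonneg.2 hp0.le), ← ENNReal.rpow_natCast (ρ ^ n),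
      ← ENNReal.rpow_mul, mul_inv_cancel₀ hp0.ne', ENNReal.rpow_one]
  have hfin : ∫⁻ ω, ∑' n, Z n ω ^ (p : ℝ)⁻¹ ∂P ≠ ∞ := by
    rw [lintegral_tsum fun n => ((hZ n).pow_const _).aemeasurable]
    refine ne_top_of_le_ne_top ?_ (ENNReal.tsum_le_tsum hroot)
    rw [ENNReal.tsum_mul_left, ENNReal.tsum_geometric]
    refine ENNReal.mul_ne_top (ENNReal.rpow_ne_top_of_nonneg (inv_nonneg.2 hp0.le) hC.ne) ?_
    rw [Ne, ENNReal.inv_eq_top, tsub_eq_zero_iff_le, not_le]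
    exact hρ
  filter_upwards [ae_lt_top (Measurable.tsum fun n => (hZ n).pow_const _) hfin, ae_all_iff.2 h]
    with ω h1 h2
  refine ne_top_of_le_ne_top h1.ne (ENNReal.tsum_le_tsum fun n => ?_)
  rw [le_rpow_natCast_inv_iff hp]
  exact h2 n

lemma ofReal_half_pow_rpow {κ : ℝ} (n : ℕ) :
    ENNReal.ofReal (((1 / 2 : ℝ) ^ n) ^ κ) = ENNReal.ofReal ((1 / 2 : ℝ) ^ κ) ^ n := by
  rw [← ENNReal.ofReal_pow (by positivity), ← Real.rpow_natCast, ← Real.rpow_natCast,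
    ← Real.rpow_mul (by norm_num), ← Real.rpow_mul (by norm_num), mul_comm]

lemma ofReal_half_rpow_lt_one {κ : ℝ} (hκ : 0 < κ) : ENNReal.ofReal ((1 / 2 : ℝ) ^ κ) < 1 := by
  rw [ENNReal.ofReal_lt_one]
  exact Real.rpow_lt_one (by norm_num) (by norm_num) hκ

/-- The parameters of the chaining estimate. -/
lemma exists_chaining_parameters {γ β : ℝ} (hγ : γ < 3 / 4) (hβ : β < 1 - 2 * γ) (p : ℝ) :
    ∃ (κ : ℝ) (r : ℕ), 0 < κ ∧ 9 * κ ≤ 3 - 4 * γ ∧ 1 ≤ r ∧ 2 < r * κ ∧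
      1 < r * (1 - 2 * γ - β - 9 * κ / 2) ∧ p ≤ (2 * r : ℕ) := by
  -- The second bound leaves at least half of the gap `1 - 2γ - β` after subtracting `9κ/2`; all
  -- remaining conditions then hold for large `r`.
  set κ := min ((3 - 4 * γ) / 9) ((1 - 2 * γ - β) / 9) with hκ
  have h0 : 0 < κ := lt_min (by linarith) (by linarith)
  have h1 : κ ≤ (3 - 4 * γ) / 9 := min_le_left _ _
  have h2 : κ ≤ (1 - 2 * γ - β) / 9 := min_le_right _ _
  have h3 : 0 < 1 - 2 * γ - β - 9 * κ / 2 := by linarith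
  have ev : ∀ᶠ r : ℕ in atTop, 1 ≤ r ∧ 2 < r * κ ∧ 1 < r * (1 - 2 * γ - β - 9 * κ / 2) ∧
      p ≤ (r : ℝ) :=
    (eventually_ge_atTop 1).and (((tendsto_natCast_atTop_atTop.atTop_mul_const h0).eventually_gt_atTop
      2).and (((tendsto_natCast_atTop_atTop.atTop_mul_const h3).eventually_gt_atTop 1).and
      (tendsto_natCast_atTop_atTop.eventually_ge_atTop p)))
  obtain ⟨r, hr1, hr2, hr3, hr4⟩ := ev.exists
  refine ⟨κ, r, h0, by linarith, hr1, hr2, hr3, hr4.trans ?_⟩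
  push_cast
  linarith [(Nat.cast_nonneg r : (0 : ℝ) ≤ r)]

/-- `Y` is the limit, in the sense of distributions and almost surely for all times, of the
renormalised squares along `ε = 2^{-n}`. -/
def IsWickLimit {Ω : Type*} [MeasurableSpace Ω] (P : Measure Ω) (T : ℝ≥0) (ψ : ℝ → ℝ)
    (z : ℤ → ℝ≥0 → Ω → ℂ) (Y : ℝ≥0 → Ω → TorusDistribution) : Prop :=
  ∀ᵐ ω ∂P, ∀ t ≤ T, ∀ k, Tendsto (fun n : ℕ => mode (wickSquare P ψ z ((1 / 2) ^ n) t ω) k) atTop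
    (𝓝 (mode (Y t ω) k))

/-! ### Existence of the limit, rate of convergence and path regularity -/

section Limit

variable {Ω : Type*} [MeasurableSpace Ω] {P : Measure Ω} [IsProbabilityMeasure P]
  {T : ℝ≥0} {q : ℤ → ℂ} {W : ℤ → ℝ≥0 → Ω → ℂ} {z : ℤ → ℝ≥0 → Ω → ℂ} {ψ : ℝ → ℝ}
  (hW : IsCylindricalBM P W) (hz : IsOrnsteinUhlenbeck P T q W z)
  (hT : 0 < T) {γ : ℝ} (hγ : 1 / 2 ≤ γ) (hγ' : γ < 3 / 4) (hq : IsComparableSymbol γ q)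
  {χ φ : ℝ → ℝ} (hχφ : IsDyadicPartition χ φ) (hψ : IsCutoff ψ)
include hW hz hT hγ hγ' hq hχφ hψ

/-- The regularity `-1` lies below `1 - 2γ` because `γ < 3/4`. Summability in the norm uniform in
time gives one exceptional set for all `t` and `k`. -/
lemma IsOrnsteinUhlenbeck.ae_exists_tendsto_mode :
    ∀ᵐ ω ∂P, ∀ t ≤ T, ∃ u : TorusDistribution, ∀ k,
      Tendsto (fun n : ℕ => mode (wickSquare P ψ z ((1 / 2) ^ n) t ω) k) atTop (𝓝 (mode u k)) := by
  obtain ⟨κ, r, hκ, hκγ, hr, hr2, hrβ, -⟩ :=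
    exists_chaining_parameters (β := -1) hγ' (by linarith) 0
  obtain ⟨C, hC, h⟩ := hz.exists_wickSquare_sub_bound hW hT hγ hq hχφ hψ hκ hκγ hr hr2 hrβ
  choose Z hZ hle hint using fun n : ℕ => h ((1 / 2) ^ n) ((1 / 2) ^ n) ((1 / 2) ^ (n + 1))
    (by positivity) le_rfl (by positivity)
    (pow_le_pow_of_le_one (by norm_num) (by norm_num) n.le_succ)
  simp_rw [ofReal_half_pow_rpow] at hint
  filter_upwards [ae_tsum_ne_top_of_pow_le hZ (by lia) hle hC (ofReal_half_rpow_lt_one hκ) hint]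
    with ω hω t ht
  refine hχφ.exists_tendsto_mode (ne_top_of_le_ne_top hω (ENNReal.tsum_le_tsum fun n => ?_))
  exact le_ctNorm (fun t => wickSquare P ψ z ((1 / 2) ^ n) t ω -
    wickSquare P ψ z ((1 / 2) ^ (n + 1)) t ω) ht

lemma IsOrnsteinUhlenbeck.exists_isWickLimit :
    ∃ Y : ℝ≥0 → Ω → TorusDistribution,
      (∀ t ≤ T, ∀ k, Measurable fun ω => mode (Y t ω) k) ∧ IsWickLimit P T ψ z Y := by
  classical
  have hae := hz.ae_exists_tendsto_mode hW hT hγ hγ' hq hχφ hψ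
  -- The limit is set to zero on a measurable null set containing all failures, so that its modes
  -- are everywhere pointwise limits of measurable functions.
  obtain ⟨S, hS, hSm, hS0⟩ := exists_measurable_superset_of_null (ae_iff.1 hae)
  have hgood : ∀ ω ∉ S, ∀ t ≤ T, ∃ u : TorusDistribution, ∀ k,
      Tendsto (fun n : ℕ => mode (wickSquare P ψ z ((1 / 2) ^ n) t ω) k) atTop (𝓝 (mode u k)) :=
    fun ω hω => by_contra fun hn => hω (hS hn)
  choose! u hu using hgood
  refine ⟨fun t ω => if ω ∈ S then 0 else u ω t, fun t ht k => ?_, ?_⟩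
  · refine measurable_of_tendsto_metrizable (f := fun (n : ℕ) => Sᶜ.indicator
      fun ω => mode (wickSquare P ψ z ((1 / 2) ^ n) t ω) k)
      (fun n => (hz.measurable_mode_wickSquare hψ (by positivity) ht k).indicator hSm.compl)
      (tendsto_pi_nhds.2 fun ω => ?_)
    by_cases hω : ω ∈ S
    · simp [hω, mode_zero]
    · simpa [hω] using hu ω hω t ht k
  · filter_upwards [measure_eq_zero_iff_ae_notMem.1 hS0] with ω hω t ht k
    simpa [hω] using hu ω hω t ht k

omit hγ' in
/-- Quantitative convergence of the renormalised squares to their limit. -/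
lemma IsOrnsteinUhlenbeck.exists_wickSquare_sub_limit_bound {Y : ℝ≥0 → Ω → TorusDistribution}
    (hY : IsWickLimit P T ψ z Y) {κ : ℝ} (hκ : 0 < κ)
    (hκγ : 9 * κ ≤ 3 - 4 * γ) {β : ℝ} {r : ℕ} (hr : 1 ≤ r) (hr2 : 2 < r * κ)
    (hrβ : 1 < r * (1 - 2 * γ - β - 9 * κ / 2)) :
    ∃ C : ℝ≥0∞, C < ∞ ∧ ∀ ε : ℝ, 0 < ε →
      ∃ Z : Ω → ℝ≥0∞, Measurable Z ∧
        (∀ᵐ ω ∂P, (ctNorm χ φ T β fun t => wickSquare P ψ z ε t ω - Y t ω) ^ (2 * r) ≤ Z ω) ∧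
        ∫⁻ ω, Z ω ∂P ≤ C * ENNReal.ofReal (ε ^ κ) ^ (2 * r) := by
  obtain ⟨C, hC, h⟩ := hz.exists_wickSquare_sub_bound hW hT hγ hq hχφ hψ hκ hκγ hr hr2 hrβ
  refine ⟨C, hC, fun ε hε => ?_⟩
  -- Starting the dyadic sequence below `ε` allows `ρ = ε` in the comparison of two squares.
  obtain ⟨n₀, hn₀⟩ := exists_pow_lt_of_lt_one hε (by norm_num : (1 / 2 : ℝ) < 1)
  choose Z hZ hle hint using fun n : ℕ => h ε ε ((1 / 2) ^ (n + n₀)) hε le_rfl (by positivity)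
    ((pow_le_pow_of_le_one (by norm_num) (by norm_num) (Nat.le_add_left n₀ n)).trans hn₀.le)
  refine ⟨fun ω => liminf (fun n => Z n ω) atTop, Measurable.liminf hZ, ?_, ?_⟩
  · filter_upwards [hY, ae_all_iff.2 hle] with ω hω hZω
    -- Only convergence of modes to `Y` is known at this point; lower semicontinuity of the Besov
    -- norm suffices, and Fatou's lemma then bounds the expectation of the majorant.
    have h1 : ctNorm χ φ T β (fun t => wickSquare P ψ z ε t ω - Y t ω) ≤
        liminf (fun n : ℕ => ctNorm χ φ T β fun t => wickSquare P ψ z ε t ω -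
          wickSquare P ψ z ((1 / 2) ^ (n + n₀)) t ω) atTop := by
      refine iSup_le fun t => ?_
      refine (hχφ.besovNorm_le_liminf β (u := fun n : ℕ => wickSquare P ψ z ε t ω -
        wickSquare P ψ z ((1 / 2) ^ (n + n₀)) t ω) (l := atTop) fun k => ?_).trans ?_
      · simp_rw [mode_sub]
        exact (((tendsto_add_atTop_iff_nat n₀).2 (hω t t.2 k))).const_sub _
      · exact liminf_le_liminf (Eventually.of_forall fun n => le_ctNorm (fun t =>
          wickSquare P ψ z ε t ω - wickSquare P ψ z ((1 / 2) ^ (n + n₀)) t ω) t.2)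
    refine (pow_le_pow_left' h1 (2 * r)).trans ?_
    rw [Monotone.map_liminf_of_continuousAt (f := fun x : ℝ≥0∞ => x ^ (2 * r))
      (fun a b hab => pow_le_pow_left' hab _) _ (ENNReal.continuous_pow _).continuousAt]
    exact liminf_le_liminf (Eventually.of_forall hZω)
  · refine (lintegral_liminf_le hZ).trans ?_
    exact liminf_le_of_le (by isBoundedDefault) fun b hb => by
      obtain ⟨n, hn⟩ := hb.exists
      exact hn.trans (hint n)

omit hT hχφ in
-- Fatou's lemma along the dyadic sequence. The choice `9κ ≤ η` absorbs all losses in `η`, and `|k|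
-- ≥ 1` allows `1 + |k|` to be replaced by `|k|`.
lemma IsOrnsteinUhlenbeck.exists_lintegral_mode_limit_le {Y : ℝ≥0 → Ω → TorusDistribution}
    (hY : IsWickLimit P T ψ z Y) {η : ℝ} (hη : 0 < η) :
    ∃ C : ℝ, ∀ t ≤ T, ∀ k : ℤ, k ≠ 0 →
        ∫⁻ ω, ‖mode (Y t ω) k‖ₑ ^ 2 ∂P ≤ ENNReal.ofReal (C / |(k : ℝ)| ^ (3 - 4 * γ - η)) := by
  set κ := min ((3 - 4 * γ) / 9) (η / 9) with hκ
  have h0 : 0 < κ := lt_min (by linarith) (by linarith)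
  have h1 : κ ≤ (3 - 4 * γ) / 9 := min_le_left _ _
  have h2 : κ ≤ η / 9 := min_le_right _ _
  obtain ⟨C, hC, h⟩ := hz.exists_lintegral_mode_wickSquare_le hW hγ hq hψ h0 (by linarith)
  refine ⟨C, fun t ht k hk => ?_⟩
  have hk1 := one_le_abs_intCast hk
  calc ∫⁻ ω, ‖mode (Y t ω) k‖ₑ ^ 2 ∂P
      ≤ ∫⁻ ω, liminf (fun n : ℕ => ‖mode (wickSquare P ψ z ((1 / 2) ^ n) t ω) k‖ₑ ^ 2) atTop ∂P := by
        refine lintegral_mono_ae ?_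
        filter_upwards [hY] with ω hω
        exact (((ENNReal.continuous_pow 2).tendsto _).comp (hω t ht k).enorm).liminf_eq.ge
    _ ≤ liminf (fun n : ℕ => ∫⁻ ω, ‖mode (wickSquare P ψ z ((1 / 2) ^ n) t ω) k‖ₑ ^ 2 ∂P) atTop :=
        lintegral_liminf_le fun n =>
          (hz.measurable_mode_wickSquare hψ (by positivity) ht k).enorm.pow_const _
    _ ≤ ENNReal.ofReal (C * (1 + |(k : ℝ)|) ^ (-(3 - 4 * γ - 9 * κ))) :=
        liminf_le_of_le (by isBoundedDefault) fun b hb => by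
          obtain ⟨n, hn⟩ := hb.exists
          exact hn.trans (h _ (by positivity) k t ht)
    _ ≤ ENNReal.ofReal (C / |(k : ℝ)| ^ (3 - 4 * γ - η)) := by
        refine ENNReal.ofReal_le_ofReal ?_
        rw [div_eq_mul_inv, ← Real.rpow_neg (abs_nonneg _)]
        refine mul_le_mul_of_nonneg_left ?_ hC
        refine (Real.rpow_le_rpow_of_nonpos (by positivity) (by linarith : |(k : ℝ)| ≤ 1 + |(k : ℝ)|)
          (by linarith)).trans ?_
        exact Real.rpow_le_rpow_of_exponent_le hk1 (by linarith)

/-- The rate along `ε = 2^{-n}` is geometric, so the distances to the limit are almost surely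
summable and tend to zero. The approximants are trigonometric polynomials with continuous modes. -/
lemma IsOrnsteinUhlenbeck.ae_memCTHolder {Y : ℝ≥0 → Ω → TorusDistribution}
    (hY : IsWickLimit P T ψ z Y) {β : ℝ} (hβ : β < 1 - 2 * γ) :
    ∀ᵐ ω ∂P, MemCTHolder χ φ T β fun t => Y t ω := by
  obtain ⟨κ, r, hκ, hκγ, hr, hr2, hrβ, -⟩ := exists_chaining_parameters hγ' hβ 0
  obtain ⟨C, hC, h⟩ :=
    hz.exists_wickSquare_sub_limit_bound hW hT hγ hq hχφ hψ hY hκ hκγ hr hr2 hrβ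
  choose Z hZ hle hint using fun n : ℕ => h ((1 / 2) ^ n) (by positivity)
  simp_rw [ofReal_half_pow_rpow] at hint
  choose N hN using fun n : ℕ => hz.exists_wickSquare_eq hψ (ε := (1 / 2) ^ n) (by positivity)
  filter_upwards [ae_tsum_ne_top_of_pow_le hZ (by lia) hle hC (ofReal_half_rpow_lt_one hκ) hint,
    hz.ae_continuousOn_mode hW hq.1] with ω hω hcont
  refine hχφ.memCTHolder_of_tendsto (N := fun n => 2 * N n)
    (X := fun n t => wickSquare P ψ z ((1 / 2) ^ n) t ω) (fun n t ht => ?_) (fun n k => ?_)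
    (ENNReal.tendsto_atTop_zero_of_tsum_ne_top hω)
  · rw [hN n _ le_rfl t ht]
    exact isTrigPoly_wickPoly _ _ _ _ _ _
  · refine (hcont (cutoffSymbol ψ ((1 / 2) ^ n)) (N n) k).congr fun t ht => ?_
    simp only
    rw [hN n _ le_rfl t ht]

lemma IsOrnsteinUhlenbeck.tendsto_moment {Y : ℝ≥0 → Ω → TorusDistribution}
    (hY : IsWickLimit P T ψ z Y) {β : ℝ} (hβ : β < 1 - 2 * γ) {p : ℝ} (hp : 1 < p) :
    ∫⁻ ω, (ctNorm χ φ T β fun t => Y t ω) ^ p ∂P < ∞ ∧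
      Tendsto (fun ε : ℝ =>
        ∫⁻ ω, (ctNorm χ φ T β fun t => wickSquare P ψ z ε t ω - Y t ω) ^ p ∂P) (𝓝[>] 0) (𝓝 0) := by
  obtain ⟨κ, r, hκ, hκγ, hr, hr2, hrβ, hpr⟩ := exists_chaining_parameters hγ' hβ p
  have hr0 : 2 * r ≠ 0 := by lia
  obtain ⟨C, hC, h⟩ :=
    hz.exists_wickSquare_sub_limit_bound hW hT hγ hq hχφ hψ hY hκ hκγ hr hr2 hrβ
  have hp0 : 0 < p := by linarith
  have hs : 0 < p / (2 * r : ℕ) := div_pos hp0 (hp0.trans_le hpr)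
  constructor
  · obtain ⟨Z, hZ, hle, hint⟩ := h 1 one_pos
    obtain ⟨Z', hZ', hle', hint'⟩ :=
      hz.exists_wickSquare_bound hW hT hγ hq hχφ hψ hκ hκγ hr hr2 hrβ one_pos
    refine (lintegral_rpow_le_of_pow_le (P := P) ((hZ.add hZ').const_mul (2 ^ (2 * r))) ?_ hp0
      hpr).trans_lt ?_
    · filter_upwards [hle, hle'] with ω h1 h2
      refine (pow_le_pow_left' (hχφ.ctNorm_le_add T β _ fun t => wickSquare P ψ z 1 t ω) _).trans ?_
      refine (add_pow_le_two_pow_mul _ _ _).trans ?_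
      exact mul_le_mul_right (add_le_add h1 h2) _
    · refine ENNReal.rpow_lt_top_of_nonneg hs.le ?_
      simp only [Pi.add_apply]
      rw [lintegral_const_mul' _ _ (by simp), lintegral_add_left hZ]
      exact ENNReal.mul_ne_top (by simp) (ENNReal.add_ne_top.2
        ⟨(hint.trans_lt (ENNReal.mul_lt_top hC (by simp))).ne, hint'.ne⟩)
  · have hlim : Tendsto (fun ε : ℝ => (C * ENNReal.ofReal (ε ^ κ) ^ (2 * r)) ^ (p / (2 * r : ℕ)))
        (𝓝[>] 0) (𝓝 0) := by
      have h1 : Tendsto (fun ε : ℝ => ε ^ κ) (𝓝[>] 0) (𝓝 0) := by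
        have := (Real.continuousAt_rpow_const 0 κ (Or.inr hκ.le)).tendsto
        rw [Real.zero_rpow hκ.ne'] at this
        exact this.mono_left nhdsWithin_le_nhds
      have h2 := ((ENNReal.continuous_pow (2 * r)).tendsto _).comp (ENNReal.tendsto_ofReal h1)
      rw [ENNReal.ofReal_zero, zero_pow hr0] at h2
      have h3 := (ENNReal.Tendsto.const_mul h2 (Or.inr hC.ne)).ennrpow_const (p / (2 * r : ℕ))
      rwa [mul_zero, ENNReal.zero_rpow_of_pos hs] at h3
    refine tendsto_of_tendsto_of_tendsto_of_le_of_le' tendsto_const_nhds hlim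
      (Eventually.of_forall fun _ => zero_le) (eventually_mem_nhdsWithin.mono fun ε hε => ?_)
    obtain ⟨Z, hZ, hle, hint⟩ := h ε hε
    exact (lintegral_rpow_le_of_pow_le hZ hle hp0 hpr).trans (ENNReal.rpow_le_rpow hint hs.le)

end Limit

end BurgersOU

end

theorem propositionB5 {Ω : Type*} [MeasurableSpace Ω] (P : Measure Ω) [IsProbabilityMeasure P]
    (T : ℝ≥0) (hT : 0 < T) (γ : ℝ) (hγ : 1 / 2 ≤ γ) (hγ' : γ < 3 / 4)
    (q : ℤ → ℂ) (hq : IsComparableSymbol γ q)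
    (W : ℤ → ℝ≥0 → Ω → ℂ) (hW : IsCylindricalBM P W)
    (z : ℤ → ℝ≥0 → Ω → ℂ) (hz : IsOrnsteinUhlenbeck P T q W z)
    (χ φ : ℝ → ℝ) (hχφ : IsDyadicPartition χ φ) (ψ : ℝ → ℝ) (hψ : IsCutoff ψ) :
    ∃ Y : ℝ≥0 → Ω → TorusDistribution,
      (∀ t ≤ T, ∀ k, Measurable fun ω => mode (Y t ω) k) ∧
      (∀ η : ℝ, 0 < η → ∃ C : ℝ, ∀ t ≤ T, ∀ k : ℤ, k ≠ 0 →
        ∫⁻ ω, ‖mode (Y t ω) k‖ₑ ^ 2 ∂P ≤ ENNReal.ofReal (C / |(k : ℝ)| ^ (3 - 4 * γ - η))) ∧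
      ∀ β : ℝ, β < 1 - 2 * γ →
        (∀ᵐ ω ∂P, MemCTHolder χ φ T β fun t => Y t ω) ∧
        ∀ p : ℝ, 1 < p →
          ∫⁻ ω, (ctNorm χ φ T β fun t => Y t ω) ^ p ∂P < ∞ ∧
          Tendsto (fun ε : ℝ =>
              ∫⁻ ω, (ctNorm χ φ T β fun t => wickSquare P ψ z ε t ω - Y t ω) ^ p ∂P)
            (𝓝[>] 0) (𝓝 0) := by
  -- The process is fixed before `η`, `β` and `p`; each assertion uses only its characterisation as
  -- the limit of modes along `ε = 2^{-n}`.
  obtain ⟨Y, hYm, hY⟩ := hz.exists_isWickLimit hW hT hγ hγ' hq hχφ hψ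
  exact ⟨Y, hYm, fun η hη => hz.exists_lintegral_mode_limit_le hW hγ hγ' hq hψ hY hη,
    fun β hβ => ⟨hz.ae_memCTHolder hW hT hγ hγ' hq hχφ hψ hY hβ,
      fun p hp => hz.tendsto_moment hW hT hγ hγ' hq hχφ hψ hY hβ hp⟩⟩
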